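/- Let $H\in(\tfrac12,1)$, $\alpha\in(1-H,H)$, $x_0\in\mathbb R$, $\beta,\gamma\in\mathbb R\setminus\{0\}$, and let $g:[0,1]\to\mathbb R$ be $H$-Hölder continuous with $g(0)=g(1)=0$. For $a\in(0,1)$ let $[D_{0+}^{a}f](t)=\frac{1}{\Gamma(1-a)}\frac{d}{dt}\int_0^t (t-u)^{-a}f(u)\,du$ and $[D_{T-}^{a}f](t)=-\frac{1}{\Gamma(1-a)}\frac{d}{dt}\int_t^T (u-t)^{-a}f(u)\,du$ be the Riemann–Liouville derivatives, and put $$\int_0^t f\,dh:=-\int_0^t [D_{0+}^{\alpha}f](z)\,[D_{t-}^{1-\alpha}(h(\cdot)-h(t))](z)\,dz .$$ Let $\|f\|_{\alpha,\infty}=\sup_{t\in[0,1]}\Big(|f(t)|+\int_0^t\frac{|f(t)-f(s)|}{(t-s)^{\alpha+1}}ds\Big)$, and let $W_0^{\alpha,\infty}$ be the space of measurable $f:[0,1]\to\mathbb R$ with $\|f\|_{\alpha,\infty}<\infty$. Let $e_{0,0}(t)=(\min\{t,1-t\})^+$ and $e_{m,k}(t)=2^{-m/2}e_{0,0}(2^mt-k)$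 be the Faber–Schauder functions. For $f:[0,1]\to\mathbb R$ and $p\in\mathbb N_0$ let $$[S_pf](t)=f(0)(1-t)+f(1)t+\sum_{n=0}^{p}\sum_{l=0}^{2^n-1}2^{n(\frac12-H)}c_{n,l}(f)\,e_{n,l}(t),$$ $$c_{n,l}(f)=2^{nH}\Big[2f\big(\tfrac{l+1/2}{2^n}\big)-f\big(\tfrac{l+1}{2^n}\big)-f\big(\tfrac{l}{2^n}\big)\Big]$$ be the partial sums of the Takagi–Landsberg representation of $f$. Consider the linear equation $$X(t)=x_0+\beta\int_0^tX(z)\,dz+\gamma\int_0^tX\,dg,\qquad t\in[0,1],\tag{1}$$ and, for $p\in\mathbb N_0$, the truncated equation $$X_p(t)=x_0+\beta\int_0^t[S_pX_p](z)\,dz+\gamma\int_0^tS_pX_p\,d[S_pg],\qquad t\in[0,1].\tag{2}$$ Then (1) has a unique solution $X\in W_0^{\alpha,\infty}$; for all sufficiently large $p$, (2) has a unique solution $X_p$ among all functions $[0,1]\to\mathbb R$; and $\|X_p-X\|_{\alpha,\infty}\to0$ as $p\to\infty$. -/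

import Mathlib

open Set Filter Topology MeasureTheory
open scoped ENNReal NNReal

noncomputable section

/- All functions below are functions on the line of which only the values on `[0, 1]` matter. -/

/-- Left-sided Riemann–Liouville derivative `D_{0+}^α f` of order `α ∈ (0, 1)`. -/
def rlDerivLeft (α : ℝ) (f : ℝ → ℝ) (t : ℝ) : ℝ :=
  1 / Real.Gamma (1 - α) * deriv (fun r : ℝ => ∫ u in (0 : ℝ)..r, (r - u) ^ (-α) * f u) t

/-- Right-sided Riemann–Liouville derivative `D_{T-}^α f` of order `α ∈ (0, 1)`. -/
def rlDerivRight (T α : ℝ) (f : ℝ → ℝ) (t : ℝ) : ℝ :=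
  -(1 / Real.Gamma (1 - α)) * deriv (fun r : ℝ => ∫ u in r..T, (u - r) ^ (-α) * f u) t

/-- The integral `∫_0^t f dg = -∫_0^t D_{0+}^α f(z) D_{t-}^{1-α} [g(·) - g(t)](z) dz`. -/
def fracStieltjes (α : ℝ) (f g : ℝ → ℝ) (t : ℝ) : ℝ :=
  -∫ z in (0 : ℝ)..t, rlDerivLeft α f z * rlDerivRight t (1 - α) (fun s => g s - g t) z

/-- The mother Faber–Schauder function `e_{0,0}(t) = (min {t, 1 - t})^+`. -/
def faberSchauderZero (t : ℝ) : ℝ := max (min t (1 - t)) 0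

/-- The Faber–Schauder functions `e_{m,k}(t) = 2^{-m/2} e_{0,0}(2^m t - k)`. -/
def faberSchauder (m k : ℕ) (t : ℝ) : ℝ :=
  (2 : ℝ) ^ (-(m : ℝ) / 2) * faberSchauderZero ((2 : ℝ) ^ m * t - k)

/-- The coefficient
`c_{m,k} = 2^{mH} [2 f((k + 1/2)/2^m) - f((k + 1)/2^m) - f(k/2^m)]`
of `f` in its Takagi–Landsberg representation of order `H`. -/
def takagiLandsbergCoeff (H : ℝ) (f : ℝ → ℝ) (m k : ℕ) : ℝ :=
  (2 : ℝ) ^ ((m : ℝ) * H) *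
    (2 * f (((k : ℝ) + 1 / 2) / 2 ^ m) - f (((k : ℝ) + 1) / 2 ^ m) - f ((k : ℝ) / 2 ^ m))

/-- The partial sum `S_p f` of the Takagi–Landsberg representation of `f`. -/
def takagiLandsbergSum (H : ℝ) (p : ℕ) (f : ℝ → ℝ) (t : ℝ) : ℝ :=
  f 0 * (1 - t) + f 1 * t +
    ∑ n ∈ Finset.range (p + 1), ∑ l ∈ Finset.range (2 ^ n),
      (2 : ℝ) ^ ((n : ℝ) * (1 / 2 - H)) * takagiLandsbergCoeff H f n l * faberSchauder n l t

/-- The norm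
`‖f‖_{α,∞} = sup_{t ∈ [0,1]} (|f(t)| + ∫_0^t |f(t) - f(s)| / (t - s)^{α + 1} ds)`,
with values in `[0, ∞]`. -/
def nrNorm (α : ℝ) (f : ℝ → ℝ) : ℝ≥0∞ :=
  ⨆ t ∈ Icc (0 : ℝ) 1,
    (ENNReal.ofReal |f t| +
      ∫⁻ s in Ioo (0 : ℝ) t, ENNReal.ofReal (|f t - f s| / (t - s) ^ (α + 1)))

/-- The space `W_0^{α,∞}` of measurable functions on `[0, 1]` with `‖f‖_{α,∞} < ∞`. -/
def MemW (α : ℝ) (f : ℝ → ℝ) : Prop :=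
  AEMeasurable f (volume.restrict (Icc (0 : ℝ) 1)) ∧ nrNorm α f < ∞

/-- `X ∈ W_0^{α,∞}` solves `X(t) = x₀ + β ∫_0^t X(z) dz + γ ∫_0^t X dg` for `t ∈ [0, 1]`. -/
def IsLinearSolution (α β γ x₀ : ℝ) (g X : ℝ → ℝ) : Prop :=
  MemW α X ∧ ∀ t ∈ Icc (0 : ℝ) 1,
    X t = x₀ + β * (∫ z in (0 : ℝ)..t, X z) + γ * fracStieltjes α X g t

/-- `X` solves the truncated equation
`X(t) = x₀ + β ∫_0^t S_p X(z) dz + γ ∫_0^t S_p X d[S_p g]` for `t ∈ [0, 1]`.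
The right-hand side sees only finitely many values of `X` and is Lipschitz in `t`, so no
regularity of `X` has to be required. -/
def IsTruncatedSolution (H α β γ x₀ : ℝ) (g : ℝ → ℝ) (p : ℕ) (X : ℝ → ℝ) : Prop :=
  ∀ t ∈ Icc (0 : ℝ) 1,
    X t = x₀ + β * (∫ z in (0 : ℝ)..t, takagiLandsbergSum H p X z) +
      γ * fracStieltjes α (takagiLandsbergSum H p X) (takagiLandsbergSum H p g) t

end

/-!
The pathwise linear equation is solved by `X(t) = x₀ exp(β t + γ g(t))`, and the truncated equation
is an explicit trapezoidal recursion on a dyadic grid; the theorem compares the two formulas.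

**The integral.** For a fractionally regular integrand `f` the Riemann–Liouville derivative exists
almost everywhere and equals its Marchaud form (`FracRegular.rlDerivLeft_ae`), because the Marchaud
form is a density of the fractional integral of order `1 - α` (`FracRegular.integral_marchaud`).
The right-sided derivative reduces to the left-sided one by reflection. For a `C¹` integrator `h`,
associativity of causal convolution and the Beta integral turn the fractional Stieltjes integral
into `∫ f h' dz` (`FracRegular.fracStieltjes_of_deriv`). A Hölder integrator is a pointwise limit of
`C¹` integrators with the same Hölder constant, and the integral is continuous along such limits
(`FracRegular.tendsto_fracStieltjes`), so the integral is additive over adjacent intervals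
(`FracRegular.fracStieltjes_sub`). Power bounds for the Marchaud derivatives then give that
indefinite integrals are `H`-Hölder (`FracRegular.isHolder_fracStieltjes`) and Young's estimate
`|∫_s^t f dh - f(s) (h(t) - h(s))| ≤ K (t - s)^(2H)` (`IsHolder.abs_fracStieltjes_increment_le`).

**The linear equation.** Since `2H > 1`, a function whose increments are `O((t - s)^(2H))` is
constant. By Young's estimate this applies to `X - x₀ - β ∫ X dz - γ ∫ X dg`, which gives existence
(`isLinearSolution_exp`). A solution `Y` in `W_0^{α,∞}` is first seen to be `H`-Hölder, and then the
same principle applies to `Y(t) exp(-β t - γ g(t))`, which gives uniqueness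
(`IsLinearSolution.eq_exp`).

**The truncated equation.** The partial sum `S_p f` is the piecewise linear interpolation of `f` at
the multiples of `1 / N`, `N = 2^(p+1)` (`takagiLandsbergSum_eq`). On a grid cell `S_p g` is affine,
so with `δ_i = β / N + γ (g((i+1)/N) - g(i/N))` the equation reads
`x_{i+1} - x_i = δ_i (x_i + x_{i+1}) / 2` at the grid points, and it determines the solution as soon
as all `|δ_i| ≤ 1`. Its solution is `x_i = x₀ ∏_{j<i} (1 + δ_j/2) / (1 - δ_j/2)`. Each factor is
`exp(δ_j + O(δ_j²))` with `δ_j = O(N^(-H))`, so `x_i` differs from `X(i/N)` by `O(N^(1-2H))`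
(`abs_gridProd_sub_exp_le`), while the solutions keep an `H`-Hölder bound that does not depend on
`p` (`IsTruncatedSolution.isHolder`). Interpolating between the uniform norm and the `H`-Hölder
seminorm yields convergence in `W_0^{α,∞}`, because `α < H` (`tendsto_nrNorm_of_isHolder`).
-/

noncomputable section

/-! ### Causal convolution -/

/-- The causal convolution `(a * b)(x) = ∫_0^x a(x - u) b(u) du` on the half-line. -/
def causalConv (a b : ℝ → ℝ) (x : ℝ) : ℝ := ∫ u in (0 : ℝ)..x, a (x - u) * b u

theorem causalConv_comm (a b : ℝ → ℝ) (x : ℝ) : causalConv a b x = causalConv b a x := by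
  have := intervalIntegral.integral_comp_sub_left (a := 0) (b := x)
    (fun u => a u * b (x - u)) x
  simp only [sub_sub_cancel, sub_self, sub_zero] at this
  simp only [causalConv]
  rw [this]
  exact intervalIntegral.integral_congr fun u _ => mul_comm _ _

theorem causalConv_congr {a a' b b' : ℝ → ℝ} {x : ℝ} (hx : 0 ≤ x)
    (ha : ∀ᵐ u, u ∈ Ioo 0 x → a u = a' u) (hb : ∀ᵐ u, u ∈ Ioo 0 x → b u = b' u) :
    causalConv a b x = causalConv a' b' x := by
  have ha' : ∀ᵐ u, x - u ∈ Ioo 0 x → a (x - u) = a' (x - u) :=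
    (quasiMeasurePreserving_sub_left_of_right_invariant volume x).ae ha
  simp only [causalConv, intervalIntegral.integral_of_le hx, integral_Ioc_eq_integral_Ioo]
  refine setIntegral_congr_ae measurableSet_Ioo ?_
  filter_upwards [ha', hb] with u h1 h2 hu
  rw [h1 ⟨by linarith [hu.2], by linarith [hu.1]⟩, h2 hu]

theorem causalConv_congr_on {a a' b b' : ℝ → ℝ} {x : ℝ} (hx : 0 ≤ x)
    (ha : ∀ u ∈ Ioo 0 x, a u = a' u) (hb : ∀ u ∈ Ioo 0 x, b u = b' u) :
    causalConv a b x = causalConv a' b' x :=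
  causalConv_congr hx (Eventually.of_forall ha) (Eventually.of_forall hb)

theorem causalConv_eq_convolution {a b : ℝ → ℝ} (ha : ∀ u ≤ 0, a u = 0) (hb : ∀ u ≤ 0, b u = 0)
    {x : ℝ} (hx : 0 ≤ x) :
    causalConv a b x = convolution b a (ContinuousLinearMap.mul ℝ ℝ) volume x := by
  rw [causalConv, intervalIntegral.integral_of_le hx, integral_Ioc_eq_integral_Ioo,
    ← integral_indicator measurableSet_Ioo, convolution]
  congr 1
  ext t
  simp only [ContinuousLinearMap.mul_apply']
  by_cases ht : t ∈ Ioo 0 x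
  · rw [indicator_of_mem ht, mul_comm]
  · rw [indicator_of_notMem ht]
    by_cases h0 : t ≤ 0
    · rw [hb t h0, zero_mul]
    · have : x ≤ t := by
        by_contra h
        exact ht ⟨not_le.1 h0, not_le.1 h⟩
      rw [ha (x - t) (by linarith), mul_zero]

theorem convolution_eq_zero_of_nonpos {a b : ℝ → ℝ} (ha : ∀ u ≤ 0, a u = 0)
    (hb : ∀ u ≤ 0, b u = 0) {x : ℝ} (hx : x ≤ 0) :
    convolution b a (ContinuousLinearMap.mul ℝ ℝ) volume x = 0 := by
  rw [convolution]
  refine integral_eq_zero_of_ae (Eventually.of_forall fun t => ?_)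
  simp only [ContinuousLinearMap.mul_apply', Pi.zero_apply]
  by_cases h0 : t ≤ 0
  · rw [hb t h0, zero_mul]
  · rw [ha (x - t) (by linarith), mul_zero]

theorem causalConv_eq_convolution_indicator (a b : ℝ → ℝ) {T x : ℝ} (hx : 0 ≤ x) (hxT : x ≤ T) :
    causalConv a b x = convolution (indicator (Ioc 0 T) b) (indicator (Ioc 0 T) a)
      (ContinuousLinearMap.mul ℝ ℝ) volume x := by
  rw [← causalConv_eq_convolution _ _ hx]
  · refine causalConv_congr_on hx (fun u hu => ?_) (fun u hu => ?_) <;>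
    exact (indicator_of_mem (show u ∈ Ioc 0 T from ⟨hu.1, hu.2.le.trans hxT⟩) _).symm
  all_goals exact fun u hu => indicator_of_notMem (fun h => absurd h.1 (not_lt.2 hu)) _

/-- Associativity of causal convolution. A bounded third factor makes both sides converge at every
point, not only almost everywhere. -/
theorem causalConv_assoc {a b c : ℝ → ℝ} {T M x : ℝ} (hx : 0 ≤ x) (hxT : x ≤ T)
    (ha : IntegrableOn a (Ioc 0 T)) (hb : IntegrableOn b (Ioc 0 T))
    (hc : AEStronglyMeasurable c (volume.restrict (Ioc 0 T))) (hcM : ∀ u ∈ Ioc 0 T, |c u| ≤ M) :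
    causalConv (causalConv a b) c x = causalConv a (causalConv b c) x := by
  have hcI : IntegrableOn c (Ioc 0 T) :=
    IntegrableOn.of_bound measure_Ioc_lt_top hc M
      ((ae_restrict_iff' measurableSet_Ioc).2 (Eventually.of_forall hcM))
  set a' := indicator (Ioc 0 T) a
  set b' := indicator (Ioc 0 T) b
  set c' := indicator (Ioc 0 T) c
  have ia : Integrable a' := ha.integrable_indicator measurableSet_Ioc
  have ib : Integrable b' := hb.integrable_indicator measurableSet_Ioc
  have ic : Integrable c' := hcI.integrable_indicator measurableSet_Ioc
  have za : ∀ u ≤ 0, a' u = 0 := fun u hu =>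
    indicator_of_notMem (fun h => absurd h.1 (not_lt.2 hu)) _
  have zb : ∀ u ≤ 0, b' u = 0 := fun u hu =>
    indicator_of_notMem (fun h => absurd h.1 (not_lt.2 hu)) _
  have zc : ∀ u ≤ 0, c' u = 0 := fun u hu =>
    indicator_of_notMem (fun h => absurd h.1 (not_lt.2 hu)) _
  have eqv : ∀ d : ℝ → ℝ, ∀ u ∈ Ioo 0 x, d u = indicator (Ioc 0 T) d u := fun d u hu =>
    (indicator_of_mem (show u ∈ Ioc 0 T from ⟨hu.1, hu.2.le.trans hxT⟩) _).symm
  have e1 : causalConv (causalConv a b) c x = convolution c'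
      (convolution b' a' (ContinuousLinearMap.mul ℝ ℝ) volume)
      (ContinuousLinearMap.mul ℝ ℝ) volume x := by
    rw [← causalConv_eq_convolution (fun u hu => convolution_eq_zero_of_nonpos za zb hu) zc hx]
    exact causalConv_congr_on hx (fun u hu => causalConv_eq_convolution_indicator a b hu.1.le
      (hu.2.le.trans hxT)) (eqv c)
  have e2 : causalConv a (causalConv b c) x = convolution
      (convolution c' b' (ContinuousLinearMap.mul ℝ ℝ) volume) a'
      (ContinuousLinearMap.mul ℝ ℝ) volume x := by
    rw [← causalConv_eq_convolution za (fun u hu => convolution_eq_zero_of_nonpos zb zc hu) hx]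
    exact causalConv_congr_on hx (eqv a) (fun u hu => causalConv_eq_convolution_indicator b c
      hu.1.le (hu.2.le.trans hxT))
  rw [e1, e2, eq_comm]
  refine convolution_assoc _ _ _ _ (fun p q r => by simp [mul_assoc]) ic.1 ib.1 ia.1
    (ic.ae_convolution_exists _ ib) (ib.norm.ae_convolution_exists _ ia.norm) ?_
  have hG := (ib.norm.integrable_convolution (ContinuousLinearMap.mul ℝ ℝ) ia.norm).comp_sub_left x
  refine Integrable.bdd_mul (c := max M 0) hG ic.1.norm (Eventually.of_forall fun t => ?_)
  simp only [Real.norm_eq_abs, abs_abs]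
  by_cases ht : t ∈ Ioc 0 T
  · simp only [c', indicator_of_mem ht]
    exact (hcM t ht).trans (le_max_left _ _)
  · simp [c', indicator_of_notMem ht]

theorem integrableOn_causalConv {a b : ℝ → ℝ} {T : ℝ}
    (ha : IntegrableOn a (Ioc 0 T)) (hb : IntegrableOn b (Ioc 0 T)) :
    IntegrableOn (causalConv a b) (Ioc 0 T) := by
  have := ((hb.integrable_indicator measurableSet_Ioc).integrable_convolution
    (ContinuousLinearMap.mul ℝ ℝ) (ha.integrable_indicator measurableSet_Ioc)).integrableOn
      (s := Ioc 0 T)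
  exact this.congr_fun (fun u hu =>
    (causalConv_eq_convolution_indicator a b hu.1.le hu.2).symm) measurableSet_Ioc

theorem causalConv_one_left (b : ℝ → ℝ) (x : ℝ) :
    causalConv (fun _ => 1) b x = ∫ u in (0 : ℝ)..x, b u := by
  simp [causalConv]

theorem causalConv_one_right (a : ℝ → ℝ) (x : ℝ) :
    causalConv a (fun _ => 1) x = ∫ u in (0 : ℝ)..x, a u := by
  rw [causalConv_comm, causalConv_one_left]

theorem integrableOn_rpow_Ioc {a : ℝ} (ha : -1 < a) (T : ℝ) :
    IntegrableOn (fun x : ℝ => x ^ a) (Ioc 0 T) := by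
  rcases le_total 0 T with hT | hT
  · exact (intervalIntegrable_iff_integrableOn_Ioc_of_le hT).1
      (intervalIntegral.intervalIntegrable_rpow' ha)
  · simp [Ioc_eq_empty_of_le hT]

/-- The Beta integral: the kernels `x^(α-1)` and `x^(-α)` convolve to the constant
`Γ(α) Γ(1 - α)`. -/
theorem causalConv_rpow_rpow {α x : ℝ} (h0 : 0 < α) (h1 : α < 1) (hx : 0 < x) :
    causalConv (fun y => y ^ (α - 1)) (fun y => y ^ (-α)) x =
      Real.Gamma α * Real.Gamma (1 - α) := by
  have hb := Complex.betaIntegral_scaled ((1 - α : ℝ) : ℂ) (α : ℂ) hx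
  have hg := Complex.Gamma_mul_Gamma_eq_betaIntegral (s := ((1 - α : ℝ) : ℂ)) (t := (α : ℂ))
    (by simpa using h1) (by simpa using h0)
  have e0 : ((1 - α : ℝ) : ℂ) + (α : ℂ) = 1 := by push_cast; ring
  rw [e0, Complex.Gamma_one, one_mul] at hg
  rw [e0, sub_self, Complex.cpow_zero, one_mul, ← hg] at hb
  apply Complex.ofReal_injective
  rw [Complex.ofReal_mul, ← Complex.Gamma_ofReal, ← Complex.Gamma_ofReal, mul_comm, ← hb,
    causalConv, ← intervalIntegral.integral_ofReal]
  refine intervalIntegral.integral_congr fun u hu => ?_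
  rw [uIcc_of_le hx.le] at hu
  have h2 : (0 : ℝ) ≤ x - u := by linarith [hu.2]
  simp only [Complex.ofReal_mul]
  rw [Complex.ofReal_cpow hu.1, Complex.ofReal_cpow h2, mul_comm]
  push_cast
  congr 2
  ring

/-! ### Riemann–Liouville derivatives in Marchaud form -/

/-- The Marchaud form of the left-sided fractional derivative of order `α`, without the factor
`1 / Γ(1 - α)`. -/
def marchaud (α : ℝ) (f : ℝ → ℝ) (t : ℝ) : ℝ :=
  f t * t ^ (-α) + α * ∫ s in (0 : ℝ)..t, (f t - f s) * (t - s) ^ (-α - 1)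

/-- `f` is measurable on `(0, T]`, and both `|f(t)|` and the fractional increment integral
`∫_0^t |f(t) - f(s)| (t - s)^(-α-1) ds` are bounded by `M` for `t ∈ (0, T]`. -/
structure FracRegular (α T M : ℝ) (f : ℝ → ℝ) : Prop where
  meas : AEStronglyMeasurable f (volume.restrict (Ioc 0 T))
  abs_le : ∀ t ∈ Ioc 0 T, |f t| ≤ M
  integrable : ∀ t ∈ Ioc 0 T,
    IntervalIntegrable (fun s => (f t - f s) * (t - s) ^ (-α - 1)) volume 0 t
  integral_le : ∀ t ∈ Ioc 0 T, ∫ s in (0 : ℝ)..t, |f t - f s| * (t - s) ^ (-α - 1) ≤ M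

theorem FracRegular.mono {α T T' M : ℝ} {f : ℝ → ℝ} (hf : FracRegular α T M f) (hT : T' ≤ T) :
    FracRegular α T' M f where
  meas := hf.meas.mono_measure (Measure.restrict_mono (Ioc_subset_Ioc_right hT) le_rfl)
  abs_le t ht := hf.abs_le t ⟨ht.1, ht.2.trans hT⟩
  integrable t ht := hf.integrable t ⟨ht.1, ht.2.trans hT⟩
  integral_le t ht := hf.integral_le t ⟨ht.1, ht.2.trans hT⟩

theorem integrableOn_of_abs_le {T M : ℝ} {f : ℝ → ℝ}
    (hf : AEStronglyMeasurable f (volume.restrict (Ioc 0 T))) (hM : ∀ t ∈ Ioc 0 T, |f t| ≤ M) :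
    IntegrableOn f (Ioc 0 T) :=
  IntegrableOn.of_bound measure_Ioc_lt_top hf M
    ((ae_restrict_iff' measurableSet_Ioc).2 (Eventually.of_forall hM))

theorem FracRegular.integrableOn {α T M : ℝ} {f : ℝ → ℝ} (hf : FracRegular α T M f) :
    IntegrableOn f (Ioc 0 T) := integrableOn_of_abs_le hf.meas hf.abs_le

theorem integrableOn_shifted_rpow {ε : ℝ} (hε : 0 < ε) (a T : ℝ) :
    IntegrableOn (fun x : ℝ => (x + ε) ^ a) (Ioc 0 T) := by
  have : ContinuousOn (fun x : ℝ => (x + ε) ^ a) (Icc 0 T) := by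
    refine ContinuousOn.rpow_const (by fun_prop) fun x hx => Or.inl ?_
    linarith [hx.1]
  exact (this.integrableOn_Icc).mono_set Ioc_subset_Icc_self

theorem integral_shifted_rpow {α ε x : ℝ} (h0 : 0 < α) (hε : 0 < ε) (hx : 0 ≤ x) :
    ∫ u in (0 : ℝ)..x, α * (u + ε) ^ (-α - 1) = ε ^ (-α) - (x + ε) ^ (-α) := by
  rw [intervalIntegral.integral_const_mul, intervalIntegral.integral_comp_add_right
    (fun u => u ^ (-α - 1)), zero_add, integral_rpow (Or.inr ⟨by linarith, ?_⟩)]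
  · rw [sub_add_cancel]
    field_simp
    ring
  · rw [uIcc_of_le (by linarith)]
    exact fun h => absurd h.1 (not_le.2 hε)

/-- The increment integral with the regularised kernel splits into two convergent terms, which the
singular kernel does not allow. -/
theorem FracRegular.regularized_eq {α T M ε t : ℝ} {f : ℝ → ℝ} (hf : FracRegular α T M f)
    (h0 : 0 < α) (hε : 0 < ε) (ht : t ∈ Ioc 0 T) :
    α * ∫ s in (0 : ℝ)..t, (f t - f s) * (t - s + ε) ^ (-α - 1) =
      f t * (ε ^ (-α) - (t + ε) ^ (-α)) -
        causalConv (fun x => α * (x + ε) ^ (-α - 1)) f t := by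
  have hfi : IntervalIntegrable f volume 0 t :=
    (intervalIntegrable_iff_integrableOn_Ioc_of_le ht.1.le).2
      (hf.integrableOn.mono_set (Ioc_subset_Ioc_right ht.2))
  have hk : ContinuousOn (fun s : ℝ => α * (t - s + ε) ^ (-α - 1)) (uIcc 0 t) := by
    rw [uIcc_of_le ht.1.le]
    refine continuousOn_const.mul (ContinuousOn.rpow_const (by fun_prop) fun x hx => Or.inl ?_)
    linarith [hx.2]
  have e1 : ∫ s in (0 : ℝ)..t, f t * (α * (t - s + ε) ^ (-α - 1)) =
      f t * (ε ^ (-α) - (t + ε) ^ (-α)) := by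
    rw [intervalIntegral.integral_const_mul, ← integral_shifted_rpow h0 hε ht.1.le]
    have := intervalIntegral.integral_comp_sub_left (a := 0) (b := t)
      (fun s => α * (s + ε) ^ (-α - 1)) t
    simp only [sub_self, sub_zero] at this
    rw [this]
  rw [← e1, causalConv, ← intervalIntegral.integral_sub, ← intervalIntegral.integral_const_mul]
  · exact intervalIntegral.integral_congr fun s _ => by ring
  · exact (hk.intervalIntegrable).const_mul _
  · exact hfi.continuousOn_mul hk

theorem FracRegular.integral_regularized {α T M ε r : ℝ} {f : ℝ → ℝ} (hf : FracRegular α T M f)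
    (h0 : 0 < α) (hε : 0 < ε) (hr : r ∈ Icc 0 T) :
    ∫ t in (0 : ℝ)..r, α * ∫ s in (0 : ℝ)..t, (f t - f s) * (t - s + ε) ^ (-α - 1) =
      (∫ s in (0 : ℝ)..r, (r - s + ε) ^ (-α) * f s) - ∫ t in (0 : ℝ)..r, f t * (t + ε) ^ (-α) := by
  set k : ℝ → ℝ := fun x => α * (x + ε) ^ (-α - 1) with hkdef
  have hkI : IntegrableOn k (Ioc 0 T) := (integrableOn_shifted_rpow hε _ T).const_mul α
  have hfi : IntervalIntegrable f volume 0 r :=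
    (intervalIntegrable_iff_integrableOn_Ioc_of_le hr.1).2
      (hf.integrableOn.mono_set (Ioc_subset_Ioc_right hr.2))
  have hk1 : ContinuousOn (fun s : ℝ => (r - s + ε) ^ (-α)) (uIcc 0 r) := by
    rw [uIcc_of_le hr.1]
    refine ContinuousOn.rpow_const (by fun_prop) fun x hx => Or.inl ?_
    linarith [hx.2]
  have hk2 : ContinuousOn (fun s : ℝ => (s + ε) ^ (-α)) (uIcc 0 r) := by
    rw [uIcc_of_le hr.1]
    refine ContinuousOn.rpow_const (by fun_prop) fun x hx => Or.inl ?_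
    linarith [hx.1]
  have e1 : ∫ t in (0 : ℝ)..r, causalConv k f t =
      ∫ s in (0 : ℝ)..r, (ε ^ (-α) - (r - s + ε) ^ (-α)) * f s := by
    rw [← causalConv_one_left, ← causalConv_assoc hr.1 hr.2 (integrableOn_const
      measure_Ioc_lt_top.ne) hkI hf.meas hf.abs_le]
    refine causalConv_congr_on (a' := fun x => ε ^ (-α) - (x + ε) ^ (-α)) hr.1
      (fun u hu => ?_) (fun _ _ => rfl)
    rw [causalConv_one_left, integral_shifted_rpow h0 hε hu.1.le]
  have hcc : IntervalIntegrable (causalConv k f) volume 0 r :=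
    (intervalIntegrable_iff_integrableOn_Ioc_of_le hr.1).2
      ((integrableOn_causalConv hkI hf.integrableOn).mono_set (Ioc_subset_Ioc_right hr.2))
  have e2 : ∫ t in (0 : ℝ)..r, α * ∫ s in (0 : ℝ)..t, (f t - f s) * (t - s + ε) ^ (-α - 1) =
      ∫ t in (0 : ℝ)..r, (f t * (ε ^ (-α) - (t + ε) ^ (-α)) - causalConv k f t) := by
    refine intervalIntegral.integral_congr_ae (Eventually.of_forall fun t ht => ?_)
    rw [uIoc_of_le hr.1] at ht
    exact hf.regularized_eq h0 hε ⟨ht.1, ht.2.trans hr.2⟩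
  rw [e2, intervalIntegral.integral_sub _ hcc, e1, ← intervalIntegral.integral_sub,
    ← intervalIntegral.integral_sub]
  · exact intervalIntegral.integral_congr fun s _ => by ring
  · exact hfi.continuousOn_mul hk1
  · exact hfi.mul_continuousOn hk2
  · exact hfi.mul_continuousOn (continuousOn_const.sub hk2)
  · exact hfi.continuousOn_mul (continuousOn_const.sub hk1)
  · exact hfi.mul_continuousOn (continuousOn_const.sub hk2)

theorem shifted_rpow_le {a x ε : ℝ} (ha : a ≤ 0) (hx : 0 < x) (hε : 0 ≤ ε) :
    (x + ε) ^ a ≤ x ^ a :=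
  Real.rpow_le_rpow_of_nonpos hx (by linarith) ha

theorem tendsto_shifted_rpow {a x : ℝ} (hx : 0 < x) :
    Tendsto (fun n : ℕ => (x + 1 / ((n : ℝ) + 1)) ^ a) atTop (𝓝 (x ^ a)) := by
  have h1 : Tendsto (fun n : ℕ => x + 1 / ((n : ℝ) + 1)) atTop (𝓝 (x + 0)) :=
    tendsto_const_nhds.add tendsto_one_div_add_atTop_nhds_zero_nat
  rw [add_zero] at h1
  exact h1.rpow_const (Or.inl hx.ne')

theorem FracRegular.tendsto_regularized {α T M t : ℝ} {f : ℝ → ℝ} (hf : FracRegular α T M f)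
    (h0 : 0 < α) (ht : t ∈ Ioc 0 T) :
    Tendsto (fun n : ℕ => ∫ s in (0 : ℝ)..t, (f t - f s) * (t - s + 1 / ((n : ℝ) + 1)) ^ (-α - 1))
      atTop (𝓝 (∫ s in (0 : ℝ)..t, (f t - f s) * (t - s) ^ (-α - 1))) := by
  have hfi : IntervalIntegrable f volume 0 t :=
    (intervalIntegrable_iff_integrableOn_Ioc_of_le ht.1.le).2
      (hf.integrableOn.mono_set (Ioc_subset_Ioc_right ht.2))
  have ne : ∀ᵐ s : ℝ, s ≠ t := by simp [ae_iff, measure_singleton]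
  refine intervalIntegral.tendsto_integral_filter_of_dominated_convergence
    (fun s => ‖(f t - f s) * (t - s) ^ (-α - 1)‖) (Eventually.of_forall fun n => ?_)
    (Eventually.of_forall fun n => ?_) (hf.integrable t ht).norm ?_
  · have hk : ContinuousOn (fun s : ℝ => (t - s + 1 / ((n : ℝ) + 1)) ^ (-α - 1)) (uIcc 0 t) := by
      rw [uIcc_of_le ht.1.le]
      refine ContinuousOn.rpow_const (by fun_prop) fun x hx => Or.inl ?_
      have : (0 : ℝ) < 1 / ((n : ℝ) + 1) := by positivity
      linarith [hx.2]
    have := ((intervalIntegrable_const (c := f t)).sub hfi).mul_continuousOn hk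
    exact this.def'.aestronglyMeasurable
  · filter_upwards [ne] with s hs hs'
    rw [uIoc_of_le ht.1.le] at hs'
    have hst : 0 < t - s := sub_pos.2 (lt_of_le_of_ne hs'.2 hs)
    have hn : (0 : ℝ) ≤ 1 / ((n : ℝ) + 1) := by positivity
    rw [norm_mul, norm_mul]
    refine mul_le_mul_of_nonneg_left ?_ (norm_nonneg _)
    rw [Real.norm_of_nonneg (by positivity), Real.norm_of_nonneg (by positivity)]
    exact shifted_rpow_le (by linarith) hst hn
  · filter_upwards [ne] with s hs hs'
    rw [uIoc_of_le ht.1.le] at hs'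
    exact (tendsto_shifted_rpow (sub_pos.2 (lt_of_le_of_ne hs'.2 hs))).const_mul _

theorem FracRegular.abs_regularized_le {α T M ε t : ℝ} {f : ℝ → ℝ} (hf : FracRegular α T M f)
    (h0 : 0 < α) (hε : 0 ≤ ε) (ht : t ∈ Ioc 0 T) :
    |∫ s in (0 : ℝ)..t, (f t - f s) * (t - s + ε) ^ (-α - 1)| ≤ M := by
  have ne : ∀ᵐ s : ℝ, s ≠ t := by simp [ae_iff, measure_singleton]
  have hint : IntervalIntegrable (fun s => |f t - f s| * (t - s) ^ (-α - 1)) volume 0 t := by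
    refine (hf.integrable t ht).norm.congr_ae ?_
    refine (ae_restrict_iff' measurableSet_uIoc).2 (Eventually.of_forall fun s hs => ?_)
    rw [uIoc_of_le ht.1.le] at hs
    have := sub_nonneg.2 hs.2
    simp only [norm_mul, Real.norm_eq_abs]
    rw [abs_of_nonneg (Real.rpow_nonneg this _)]
  refine le_trans ?_ (hf.integral_le t ht)
  rw [← Real.norm_eq_abs]
  refine intervalIntegral.norm_integral_le_of_norm_le ht.1.le ?_ hint
  filter_upwards [ne] with s hs hs'
  have hst : 0 < t - s := sub_pos.2 (lt_of_le_of_ne hs'.2 hs)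
  rw [norm_mul, Real.norm_eq_abs, Real.norm_of_nonneg (by positivity)]
  exact mul_le_mul_of_nonneg_left (shifted_rpow_le (by linarith) hst hε) (abs_nonneg _)

/-- The increment integral is measurable in `t`, as a limit of the regularised ones. -/
theorem FracRegular.aestronglyMeasurable_integral {α T M : ℝ} {f : ℝ → ℝ}
    (hf : FracRegular α T M f) (h0 : 0 < α) :
    AEStronglyMeasurable (fun t => ∫ s in (0 : ℝ)..t, (f t - f s) * (t - s) ^ (-α - 1))
      (volume.restrict (Ioc 0 T)) := by
  refine aestronglyMeasurable_of_tendsto_ae (u := atTop) (f := fun (n : ℕ) t =>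
    ∫ s in (0 : ℝ)..t, (f t - f s) * (t - s + 1 / ((n : ℝ) + 1)) ^ (-α - 1)) (fun n => ?_)
    ((ae_restrict_iff' measurableSet_Ioc).2 (Eventually.of_forall fun t ht =>
      hf.tendsto_regularized h0 ht))
  have hε : (0 : ℝ) < 1 / ((n : ℝ) + 1) := by positivity
  set ε := 1 / ((n : ℝ) + 1)
  have hm : AEStronglyMeasurable (fun t => α⁻¹ * (f t * (ε ^ (-α) - (t + ε) ^ (-α)) -
        causalConv (fun x => α * (x + ε) ^ (-α - 1)) f t)) (volume.restrict (Ioc 0 T)) := by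
    refine ((hf.meas.mul ?_).sub (integrableOn_causalConv
      ((integrableOn_shifted_rpow hε _ T).const_mul α) hf.integrableOn).1).const_mul _
    exact (by fun_prop : Measurable fun t : ℝ => ε ^ (-α) - (t + ε) ^ (-α)).aestronglyMeasurable
  refine hm.congr ((ae_restrict_iff' measurableSet_Ioc).2 (Eventually.of_forall fun t ht => ?_))
  simp only
  rw [← hf.regularized_eq h0 hε ht, inv_mul_cancel_left₀ h0.ne']

theorem FracRegular.abs_marchaud_le {α T M t : ℝ} {f : ℝ → ℝ} (hf : FracRegular α T M f)
    (h0 : 0 < α) (ht : t ∈ Ioc 0 T) : |marchaud α f t| ≤ M * t ^ (-α) + α * M := by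
  have h1 := hf.abs_regularized_le h0 le_rfl ht
  simp only [add_zero] at h1
  rw [marchaud]
  refine (abs_add_le _ _).trans (add_le_add ?_ ?_)
  · rw [abs_mul, abs_of_nonneg (Real.rpow_nonneg ht.1.le _)]
    exact mul_le_mul_of_nonneg_right (hf.abs_le t ht) (Real.rpow_nonneg ht.1.le _)
  · rw [abs_mul, abs_of_pos h0]
    exact mul_le_mul_of_nonneg_left h1 h0.le

theorem FracRegular.integrableOn_marchaud {α T M : ℝ} {f : ℝ → ℝ} (hf : FracRegular α T M f)
    (h0 : 0 < α) (h1 : α < 1) : IntegrableOn (marchaud α f) (Ioc 0 T) := by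
  have hb : IntegrableOn (fun t : ℝ => M * t ^ (-α) + α * M) (Ioc 0 T) :=
    ((integrableOn_rpow_Ioc (by linarith) T).const_mul M).add
      (integrableOn_const measure_Ioc_lt_top.ne)
  refine Integrable.mono' hb ?_ ((ae_restrict_iff' measurableSet_Ioc).2
    (Eventually.of_forall fun t ht => hf.abs_marchaud_le h0 ht))
  refine (hf.meas.mul ?_).add ((hf.aestronglyMeasurable_integral h0).const_mul _)
  exact (by fun_prop : Measurable fun t : ℝ => t ^ (-α)).aestronglyMeasurable

/-- The Riemann–Liouville integral of order `1 - α` of `f` is a primitive of the Marchaud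
derivative. The singular kernel `x^(-α-1)` is replaced by `(x + ε)^(-α-1)`, for which the identity
is Fubini's theorem, and `ε → 0`. -/
theorem FracRegular.integral_marchaud {α T M r : ℝ} {f : ℝ → ℝ} (hf : FracRegular α T M f)
    (h0 : 0 < α) (h1 : α < 1) (hr : r ∈ Icc 0 T) :
    ∫ u in (0 : ℝ)..r, (r - u) ^ (-α) * f u = ∫ t in (0 : ℝ)..r, marchaud α f t := by
  have ne : ∀ᵐ s : ℝ, s ≠ r := by simp [ae_iff, measure_singleton]
  have hpos : ∀ n : ℕ, (0 : ℝ) < 1 / ((n : ℝ) + 1) := fun n => by positivity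
  have hfm : AEStronglyMeasurable f (volume.restrict (uIoc 0 r)) := by
    rw [uIoc_of_le hr.1]
    exact (hf.mono hr.2).meas
  have mem : ∀ t ∈ uIoc 0 r, t ∈ Ioc 0 T ∧ t ≤ r := fun t ht => by
    rw [uIoc_of_le hr.1] at ht
    exact ⟨⟨ht.1, ht.2.trans hr.2⟩, ht.2⟩
  have hker : IntervalIntegrable (fun x : ℝ => x ^ (-α)) volume 0 r :=
    intervalIntegral.intervalIntegrable_rpow' (by linarith)
  have hker' : IntervalIntegrable (fun x : ℝ => (r - x) ^ (-α)) volume 0 r := by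
    simpa using (hker.comp_sub_left r).symm
  have l1 : Tendsto (fun n : ℕ => ∫ t in (0 : ℝ)..r, α * ∫ s in (0 : ℝ)..t,
      (f t - f s) * (t - s + 1 / ((n : ℝ) + 1)) ^ (-α - 1)) atTop
      (𝓝 (∫ t in (0 : ℝ)..r, α * ∫ s in (0 : ℝ)..t, (f t - f s) * (t - s) ^ (-α - 1))) := by
    refine intervalIntegral.tendsto_integral_filter_of_dominated_convergence (fun _ => α * M)
      (Eventually.of_forall fun n => ?_) (Eventually.of_forall fun n => Eventually.of_forall
        fun t ht => ?_) intervalIntegrable_const (Eventually.of_forall fun t ht =>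
        (hf.tendsto_regularized h0 (mem t ht).1).const_mul _)
    · have hm : AEStronglyMeasurable (fun t => f t * ((1 / ((n : ℝ) + 1)) ^ (-α) -
          (t + (1 / ((n : ℝ) + 1))) ^ (-α)) - causalConv (fun x => α *
            (x + (1 / ((n : ℝ) + 1))) ^ (-α - 1)) f t) (volume.restrict (uIoc 0 r)) := by
        refine (hfm.mul ?_).sub ?_
        · exact (by fun_prop : Measurable fun t : ℝ => (1 / ((n : ℝ) + 1)) ^ (-α) -
            (t + 1 / ((n : ℝ) + 1)) ^ (-α)).aestronglyMeasurable
        · rw [uIoc_of_le hr.1]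
          exact (integrableOn_causalConv ((integrableOn_shifted_rpow (hpos n) _ r).const_mul α)
            (hf.mono hr.2).integrableOn).1
      refine hm.congr ((ae_restrict_iff' measurableSet_uIoc).2
        (Eventually.of_forall fun t ht => ?_))
      simp only
      rw [← hf.regularized_eq h0 (hpos n) (mem t ht).1]
    · rw [norm_mul, Real.norm_of_nonneg h0.le, Real.norm_eq_abs]
      exact mul_le_mul_of_nonneg_left (hf.abs_regularized_le h0 (hpos n).le (mem t ht).1) h0.le
  have l2 : Tendsto (fun n : ℕ => ∫ s in (0 : ℝ)..r, (r - s + 1 / ((n : ℝ) + 1)) ^ (-α) * f s)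
      atTop (𝓝 (∫ s in (0 : ℝ)..r, (r - s) ^ (-α) * f s)) := by
    refine intervalIntegral.tendsto_integral_filter_of_dominated_convergence
      (fun s => (r - s) ^ (-α) * M) (Eventually.of_forall fun n => ?_)
      (Eventually.of_forall fun n => ?_) (hker'.mul_const M) ?_
    · refine AEStronglyMeasurable.mul ?_ hfm
      exact (by fun_prop : Measurable fun s : ℝ =>
        (r - s + 1 / ((n : ℝ) + 1)) ^ (-α)).aestronglyMeasurable
    · filter_upwards [ne] with s hs hs'
      obtain ⟨hm, hsr⟩ := mem s hs'
      have hst : 0 < r - s := sub_pos.2 (lt_of_le_of_ne hsr hs)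
      have := hpos n
      rw [norm_mul, Real.norm_of_nonneg (by positivity), Real.norm_eq_abs]
      exact mul_le_mul (shifted_rpow_le (by linarith) hst this.le) (hf.abs_le s hm)
        (abs_nonneg _) (by positivity)
    · filter_upwards [ne] with s hs hs'
      exact (tendsto_shifted_rpow (sub_pos.2 (lt_of_le_of_ne (mem s hs').2 hs))).mul_const _
  have l3 : Tendsto (fun n : ℕ => ∫ t in (0 : ℝ)..r, f t * (t + 1 / ((n : ℝ) + 1)) ^ (-α))
      atTop (𝓝 (∫ t in (0 : ℝ)..r, f t * t ^ (-α))) := by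
    refine intervalIntegral.tendsto_integral_filter_of_dominated_convergence
      (fun s => M * s ^ (-α)) (Eventually.of_forall fun n => ?_)
      (Eventually.of_forall fun n => Eventually.of_forall fun s hs => ?_) (hker.const_mul M)
      (Eventually.of_forall fun s hs => (tendsto_shifted_rpow (mem s hs).1.1).const_mul _)
    · refine AEStronglyMeasurable.mul hfm ?_
      exact (by fun_prop : Measurable fun s : ℝ =>
        (s + 1 / ((n : ℝ) + 1)) ^ (-α)).aestronglyMeasurable
    · have hs0 := (mem s hs).1.1
      have := hpos n
      rw [norm_mul, Real.norm_eq_abs, Real.norm_of_nonneg (by positivity)]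
      exact mul_le_mul (hf.abs_le s (mem s hs).1) (shifted_rpow_le (by linarith) hs0 this.le)
        (by positivity) ((abs_nonneg _).trans (hf.abs_le s (mem s hs).1))
  have key := tendsto_nhds_unique l1
    (((l2.sub l3).congr fun n => (hf.integral_regularized h0 (hpos n) hr).symm))
  have hfk : IntervalIntegrable (fun t => f t * t ^ (-α)) volume 0 r := by
    refine (hker.const_mul M).mono_fun (hfm.mul ?_) ((ae_restrict_iff' measurableSet_uIoc).2
      (Eventually.of_forall fun s hs => ?_))
    · exact (by fun_prop : Measurable fun s : ℝ => s ^ (-α)).aestronglyMeasurable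
    · have hs0 := (mem s hs).1.1
      simp only [norm_mul]
      exact mul_le_mul_of_nonneg_right ((hf.abs_le s (mem s hs).1).trans (le_abs_self _))
        (norm_nonneg _)
  have hmi : IntervalIntegrable (marchaud α f) volume 0 r :=
    (intervalIntegrable_iff_integrableOn_Ioc_of_le hr.1).2
      ((hf.mono hr.2).integrableOn_marchaud h0 h1)
  have e : ∫ t in (0 : ℝ)..r, α * ∫ s in (0 : ℝ)..t, (f t - f s) * (t - s) ^ (-α - 1) =
      (∫ t in (0 : ℝ)..r, marchaud α f t) - ∫ t in (0 : ℝ)..r, f t * t ^ (-α) := by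
    rw [← intervalIntegral.integral_sub hmi hfk]
    exact intervalIntegral.integral_congr fun t _ => by simp [marchaud]
  linarith

/-- If a primitive on `[0, T]` of an integrable function `φ` is the fractional integral of order
`1 - α` of `f`, then the left-sided derivative of `f` is almost everywhere `φ / Γ(1 - α)`. -/
theorem rlDerivLeft_ae_eq {α T : ℝ} {f φ : ℝ → ℝ} (hφ : IntegrableOn φ (Ioc 0 T))
    (h : ∀ r ∈ Icc 0 T, ∫ u in (0 : ℝ)..r, (r - u) ^ (-α) * f u = ∫ t in (0 : ℝ)..r, φ t) :
    ∀ᵐ z, z ∈ Ioo 0 T → rlDerivLeft α f z = 1 / Real.Gamma (1 - α) * φ z := by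
  rcases le_or_gt T 0 with hT | hT
  · exact Eventually.of_forall fun z hz => absurd (hz.1.trans hz.2) (not_lt.2 hT)
  have hi : IntervalIntegrable φ volume 0 T :=
    (intervalIntegrable_iff_integrableOn_Ioc_of_le hT.le).2 hφ
  filter_upwards [hi.ae_hasDerivAt_integral] with z hz hzT
  have hd := hz (by rw [uIcc_of_le hT.le]; exact ⟨hzT.1.le, hzT.2.le⟩) 0
    (by rw [uIcc_of_le hT.le]; exact ⟨le_rfl, hT.le⟩)
  have : (fun r : ℝ => ∫ u in (0 : ℝ)..r, (r - u) ^ (-α) * f u) =ᶠ[𝓝 z]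
      fun r => ∫ t in (0 : ℝ)..r, φ t := by
    filter_upwards [Ioo_mem_nhds hzT.1 hzT.2] with r hr
    exact h r ⟨hr.1.le, hr.2.le⟩
  rw [rlDerivLeft, this.deriv_eq, hd.deriv]

theorem FracRegular.rlDerivLeft_ae {α T M : ℝ} {f : ℝ → ℝ} (hf : FracRegular α T M f)
    (h0 : 0 < α) (h1 : α < 1) :
    ∀ᵐ z, z ∈ Ioo 0 T → rlDerivLeft α f z = 1 / Real.Gamma (1 - α) * marchaud α f z :=
  rlDerivLeft_ae_eq (hf.integrableOn_marchaud h0 h1) fun _ hr => hf.integral_marchaud h0 h1 hr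

theorem rlDerivRight_eq_rlDerivLeft (T α : ℝ) (f : ℝ → ℝ) (z : ℝ) :
    rlDerivRight T α f z = rlDerivLeft α (fun v => f (T - v)) (T - z) := by
  set G : ℝ → ℝ := fun q => ∫ v in (0 : ℝ)..q, (q - v) ^ (-α) * f (T - v) with hG
  have e : (fun r : ℝ => ∫ u in r..T, (u - r) ^ (-α) * f u) = fun r => G (T - r) := by
    ext r
    have := intervalIntegral.integral_comp_sub_left (a := 0) (b := T - r)
      (fun u => (u - r) ^ (-α) * f u) T
    simp only [sub_sub_cancel, sub_zero] at this
    rw [← this, hG]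
    refine intervalIntegral.integral_congr fun v _ => ?_
    rw [sub_right_comm]
  rw [rlDerivRight, e, deriv_comp_const_sub, rlDerivLeft]
  ring

/-! ### Hölder functions -/

/-- `f` is Hölder continuous of order `η` with constant `C` on `[0, T]`. -/
def IsHolder (C η T : ℝ) (f : ℝ → ℝ) : Prop :=
  ∀ u ∈ Icc 0 T, ∀ v ∈ Icc 0 T, |f u - f v| ≤ C * |u - v| ^ η

theorem IsHolder.mono {C η T T' : ℝ} {f : ℝ → ℝ} (hf : IsHolder C η T f) (hT : T' ≤ T) :
    IsHolder C η T' f := fun u hu v hv =>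
  hf u ⟨hu.1, hu.2.trans hT⟩ v ⟨hv.1, hv.2.trans hT⟩

theorem IsHolder.continuousOn {C η T : ℝ} {f : ℝ → ℝ} (hf : IsHolder C η T f) (hη : 0 < η) :
    ContinuousOn f (Icc 0 T) := by
  intro u hu
  rw [ContinuousWithinAt, tendsto_iff_norm_sub_tendsto_zero]
  have h1 : Tendsto (fun v => C * |v - u| ^ η) (𝓝[Icc 0 T] u) (𝓝 0) := by
    have : ContinuousAt (fun v : ℝ => C * |v - u| ^ η) u :=
      (ContinuousAt.rpow_const (by fun_prop) (Or.inr hη.le)).const_mul C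
    have h2 := this.tendsto.mono_left (nhdsWithin_le_nhds (s := Icc 0 T))
    simpa [Real.zero_rpow hη.ne'] using h2
  refine squeeze_zero' (Eventually.of_forall fun _ => norm_nonneg _) ?_ h1
  filter_upwards [self_mem_nhdsWithin] with v hv
  exact hf v hv u hu

theorem IsHolder.shift {C η T s : ℝ} {f : ℝ → ℝ} (hf : IsHolder C η T f) (hs : 0 ≤ s) :
    IsHolder C η (T - s) fun u => f (s + u) := fun u hu v hv => by
  have := hf (s + u) ⟨by linarith [hu.1], by linarith [hu.2]⟩ (s + v)
    ⟨by linarith [hv.1], by linarith [hv.2]⟩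
  rwa [add_sub_add_left_eq_sub] at this

theorem IsHolder.sub_const {C η T : ℝ} {f : ℝ → ℝ} (hf : IsHolder C η T f) (c : ℝ) :
    IsHolder C η T fun u => f u - c := fun u hu v hv => by
  simpa using hf u hu v hv

theorem IsHolder.reflect {C η T : ℝ} {f : ℝ → ℝ} (hf : IsHolder C η T f) :
    IsHolder C η T fun u => f (T - u) - f T := fun u hu v hv => by
  have := hf (T - u) ⟨by linarith [hu.2], by linarith [hu.1]⟩ (T - v)
    ⟨by linarith [hv.2], by linarith [hv.1]⟩
  rwa [sub_sub_sub_cancel_left, abs_sub_comm v u, ← sub_sub_sub_cancel_right _ _ (f T)] at this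

theorem integral_sub_rpow {a t : ℝ} (ha : -1 < a) :
    ∫ s in (0 : ℝ)..t, (t - s) ^ a = t ^ (a + 1) / (a + 1) := by
  have := intervalIntegral.integral_comp_sub_left (a := 0) (b := t) (fun s : ℝ => s ^ a) t
  rw [this, sub_self, sub_zero, integral_rpow (Or.inl ha), Real.zero_rpow (by linarith), sub_zero]

theorem intervalIntegrable_sub_rpow {a : ℝ} (ha : -1 < a) (t : ℝ) :
    IntervalIntegrable (fun s : ℝ => (t - s) ^ a) volume 0 t := by
  simpa using ((intervalIntegral.intervalIntegrable_rpow' (a := 0) (b := t) ha).comp_sub_left t).symm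

theorem IsHolder.abs_increment_le {C η a T t s : ℝ} {f : ℝ → ℝ} (hf : IsHolder C η T f)
    (ht : t ∈ Ioc 0 T) (hs : s ∈ Ioo 0 t) :
    |f t - f s| * (t - s) ^ (-a - 1) ≤ C * (t - s) ^ (η - a - 1) := by
  have hts : 0 < t - s := sub_pos.2 hs.2
  have h := hf t ⟨ht.1.le, ht.2⟩ s ⟨hs.1.le, hs.2.le.trans ht.2⟩
  rw [abs_of_pos hts] at h
  calc |f t - f s| * (t - s) ^ (-a - 1) ≤ C * (t - s) ^ η * (t - s) ^ (-a - 1) :=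
        mul_le_mul_of_nonneg_right h (by positivity)
    _ = C * (t - s) ^ (η - a - 1) := by
        rw [mul_assoc, ← Real.rpow_add hts]
        ring_nf

theorem IsHolder.integrable_increment {C η a T t : ℝ} {f : ℝ → ℝ} (hf : IsHolder C η T f)
    (ha : 0 < a) (haη : a < η) (ht : t ∈ Ioc 0 T) :
    IntervalIntegrable (fun s => (f t - f s) * (t - s) ^ (-a - 1)) volume 0 t := by
  have ne : ∀ᵐ s : ℝ, s ≠ t := by simp [ae_iff, measure_singleton]
  have hb : IntervalIntegrable (fun s : ℝ => C * (t - s) ^ (η - a - 1)) volume 0 t :=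
    (intervalIntegrable_sub_rpow (by linarith) t).const_mul C
  refine hb.mono_fun' ?_ ((ae_restrict_iff' measurableSet_uIoc).2 ?_)
  · rw [uIoc_of_le ht.1.le]
    have hfm : AEStronglyMeasurable f (volume.restrict (Ioc 0 t)) :=
      ((hf.continuousOn (ha.trans haη)).mono ((Icc_subset_Icc_right ht.2).trans' Ioc_subset_Icc_self)
        ).aestronglyMeasurable measurableSet_Ioc
    refine (aestronglyMeasurable_const.sub hfm).mul ?_
    exact (by fun_prop : Measurable fun s : ℝ => (t - s) ^ (-a - 1)).aestronglyMeasurable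
  · filter_upwards [ne] with s hs hs'
    rw [uIoc_of_le ht.1.le] at hs'
    have hst : s < t := lt_of_le_of_ne hs'.2 hs
    have := sub_pos.2 hst
    rw [norm_mul, Real.norm_eq_abs, Real.norm_of_nonneg (by positivity)]
    exact hf.abs_increment_le ht ⟨hs'.1, hst⟩

theorem IsHolder.integral_increment_le {C η a T t : ℝ} {f : ℝ → ℝ} (hf : IsHolder C η T f)
    (ha : 0 < a) (haη : a < η) (ht : t ∈ Ioc 0 T) :
    ∫ s in (0 : ℝ)..t, |f t - f s| * (t - s) ^ (-a - 1) ≤ C / (η - a) * t ^ (η - a) := by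
  have hb : IntervalIntegrable (fun s : ℝ => C * (t - s) ^ (η - a - 1)) volume 0 t :=
    (intervalIntegrable_sub_rpow (by linarith) t).const_mul C
  have hi : IntervalIntegrable (fun s => |f t - f s| * (t - s) ^ (-a - 1)) volume 0 t := by
    refine (hf.integrable_increment ha haη ht).norm.congr_ae ?_
    refine (ae_restrict_iff' measurableSet_uIoc).2 (Eventually.of_forall fun s hs => ?_)
    rw [uIoc_of_le ht.1.le] at hs
    have := sub_nonneg.2 hs.2
    simp only [norm_mul, Real.norm_eq_abs]
    rw [abs_of_nonneg (Real.rpow_nonneg this _)]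
  refine (intervalIntegral.integral_mono_on_of_le_Ioo ht.1.le hi hb
    fun s hs => hf.abs_increment_le ht hs).trans (le_of_eq ?_)
  rw [intervalIntegral.integral_const_mul, integral_sub_rpow (by linarith), sub_add_cancel]
  ring

theorem IsHolder.abs_le {C η T t : ℝ} {f : ℝ → ℝ} (hf : IsHolder C η T f) (hC : 0 ≤ C)
    (hη : 0 ≤ η) (ht : t ∈ Icc 0 T) : |f t| ≤ |f 0| + C * T ^ η := by
  have h := hf t ht 0 ⟨le_rfl, ht.1.trans ht.2⟩
  rw [sub_zero, abs_of_nonneg ht.1] at h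
  have h2 : t ^ η ≤ T ^ η := Real.rpow_le_rpow ht.1 ht.2 hη
  have h3 := mul_le_mul_of_nonneg_left h2 hC
  have h4 := abs_sub_abs_le_abs_sub (f t) (f 0)
  linarith

theorem IsHolder.fracRegular {C η a T : ℝ} {f : ℝ → ℝ} (hf : IsHolder C η T f) (hC : 0 ≤ C)
    (ha : 0 < a) (haη : a < η) :
    FracRegular a T (max (|f 0| + C * T ^ η) (C / (η - a) * T ^ (η - a))) f where
  meas := ((hf.continuousOn (ha.trans haη)).mono Ioc_subset_Icc_self).aestronglyMeasurable
    measurableSet_Ioc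
  abs_le t ht := (hf.abs_le hC (ha.trans haη).le ⟨ht.1.le, ht.2⟩).trans (le_max_left _ _)
  integrable t ht := hf.integrable_increment ha haη ht
  integral_le t ht := by
    refine (hf.integral_increment_le ha haη ht).trans (le_trans ?_ (le_max_right _ _))
    have : 0 < η - a := sub_pos.2 haη
    exact mul_le_mul_of_nonneg_left (Real.rpow_le_rpow ht.1.le ht.2 this.le) (by positivity)

theorem IsHolder.abs_marchaud_le {C η a T t : ℝ} {f : ℝ → ℝ} (hf : IsHolder C η T f)
    (ha : 0 < a) (haη : a < η) (h0 : f 0 = 0) (ht : t ∈ Ioc 0 T) :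
    |marchaud a f t| ≤ C * (1 + a / (η - a)) * t ^ (η - a) := by
  have h1 := hf t ⟨ht.1.le, ht.2⟩ 0 ⟨le_rfl, ht.1.le.trans ht.2⟩
  rw [h0, sub_zero, sub_zero, abs_of_pos ht.1] at h1
  have h2 : |∫ s in (0 : ℝ)..t, (f t - f s) * (t - s) ^ (-a - 1)| ≤
      C / (η - a) * t ^ (η - a) := by
    refine le_trans ?_ (hf.integral_increment_le ha haη ht)
    refine (intervalIntegral.abs_integral_le_integral_abs ht.1.le).trans (le_of_eq ?_)
    refine intervalIntegral.integral_congr fun s hs => ?_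
    rw [uIcc_of_le ht.1.le] at hs
    have := sub_nonneg.2 hs.2
    simp only [abs_mul]
    rw [abs_of_nonneg (Real.rpow_nonneg this _)]
  have h3 : |f t * t ^ (-a)| ≤ C * t ^ (η - a) := by
    rw [abs_mul, abs_of_nonneg (Real.rpow_nonneg ht.1.le (-a)), sub_eq_add_neg,
      Real.rpow_add ht.1, ← mul_assoc]
    exact mul_le_mul_of_nonneg_right h1 (Real.rpow_nonneg ht.1.le _)
  rw [marchaud]
  refine (abs_add_le _ _).trans ?_
  rw [abs_mul a, abs_of_pos ha]
  calc _ ≤ C * t ^ (η - a) + a * (C / (η - a) * t ^ (η - a)) :=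
        add_le_add h3 (mul_le_mul_of_nonneg_left h2 ha.le)
    _ = _ := by ring

/-- Marchaud derivatives converge along pointwise convergent sequences with a common Hölder bound of
higher order. -/
theorem tendsto_marchaud {C η a T t : ℝ} {F : ℕ → ℝ → ℝ} {f : ℝ → ℝ}
    (hF : ∀ n, IsHolder C η T (F n)) (ha : 0 < a) (haη : a < η)
    (hlim : ∀ u ∈ Icc 0 T, Tendsto (fun n => F n u) atTop (𝓝 (f u))) (ht : t ∈ Ioc 0 T) :
    Tendsto (fun n => marchaud a (F n) t) atTop (𝓝 (marchaud a f t)) := by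
  have ne : ∀ᵐ s : ℝ, s ≠ t := by simp [ae_iff, measure_singleton]
  have hlt := hlim t ⟨ht.1.le, ht.2⟩
  refine (hlt.mul_const _).add (Tendsto.const_mul a ?_)
  refine intervalIntegral.tendsto_integral_filter_of_dominated_convergence
    (fun s => C * (t - s) ^ (η - a - 1)) (Eventually.of_forall fun n => ?_)
    (Eventually.of_forall fun n => ?_)
    ((intervalIntegrable_sub_rpow (by linarith) t).const_mul C)
    (Eventually.of_forall fun s hs => ?_)
  · exact ((hF n).integrable_increment ha haη ht).def'.aestronglyMeasurable
  · filter_upwards [ne] with s hs hs'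
    rw [uIoc_of_le ht.1.le] at hs'
    have hst : s < t := lt_of_le_of_ne hs'.2 hs
    have := sub_pos.2 hst
    rw [norm_mul, Real.norm_eq_abs, Real.norm_of_nonneg (by positivity)]
    exact (hF n).abs_increment_le ht ⟨hs'.1, hst⟩
  · rw [uIoc_of_le ht.1.le] at hs
    exact (hlt.sub (hlim s ⟨hs.1.le, hs.2.trans ht.2⟩)).mul_const _

/-- A Hölder function is the pointwise limit of continuously differentiable functions with the same
Hölder bound: its averages over intervals of length `1 / (n + 1)`. -/
theorem IsHolder.exists_smooth_approx {C η T : ℝ} {h : ℝ → ℝ} (hh : IsHolder C η T h)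
    (hC : 0 ≤ C) (hη : 0 < η) (hT : 0 ≤ T) :
    ∃ H w : ℕ → ℝ → ℝ, (∀ n, IsHolder C η T (H n)) ∧ (∀ n, Continuous (w n)) ∧
      (∀ n a b, H n b - H n a = ∫ u in a..b, w n u) ∧
      ∀ u ∈ Icc 0 T, Tendsto (fun n => H n u) atTop (𝓝 (h u)) := by
  -- `k` extends `h` to the line by its boundary values, which keeps the Hölder bound
  set p : ℝ → ℝ := fun u => max 0 (min T u) with hp
  have hpm : ∀ u, p u ∈ Icc 0 T := fun u => ⟨le_max_left _ _, max_le hT (min_le_left _ _)⟩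
  have hpl : ∀ u v, |p u - p v| ≤ |u - v| := fun u v => by
    refine (abs_max_sub_max_le_max _ _ _ _).trans (max_le (by simp) ?_)
    exact (abs_min_sub_min_le_max _ _ _ _).trans (max_le (by simp) le_rfl)
  have hpi : ∀ u ∈ Icc 0 T, p u = u := fun u hu => by simp [hp, hu.1, hu.2]
  set k : ℝ → ℝ := fun u => h (p u) with hk
  have hkh : ∀ u v, |k u - k v| ≤ C * |u - v| ^ η := fun u v =>
    (hh _ (hpm u) _ (hpm v)).trans
      (mul_le_mul_of_nonneg_left (Real.rpow_le_rpow (abs_nonneg _) (hpl u v) hη.le) hC)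
  have hkc : Continuous k := (hh.continuousOn hη).comp_continuous (by fun_prop) hpm
  have hki : ∀ a b, IntervalIntegrable k volume a b := fun a b => hkc.intervalIntegrable a b
  have hkci : ∀ (c a b : ℝ), IntervalIntegrable (fun y => k (c + y)) volume a b := fun c a b =>
    (by fun_prop : Continuous fun y => k (c + y)).intervalIntegrable a b
  refine ⟨fun n u => ((n : ℝ) + 1) * ∫ y in (0 : ℝ)..1 / ((n : ℝ) + 1), k (u + y),
    fun n u => ((n : ℝ) + 1) * (k (u + 1 / ((n : ℝ) + 1)) - k u), fun n u hu v hv => ?_,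
    fun n => by fun_prop, fun n a b => ?_, fun u hu => ?_⟩
  · have hn : (0 : ℝ) < (n : ℝ) + 1 := by positivity
    rw [← mul_sub, ← intervalIntegral.integral_sub (hkci _ _ _) (hkci _ _ _), abs_mul,
      abs_of_pos hn]
    have := intervalIntegral.norm_integral_le_of_norm_le_const (a := 0) (b := 1 / ((n : ℝ) + 1))
      (f := fun y => k (u + y) - k (v + y)) (C := C * |u - v| ^ η) (fun y _ => by
        simpa using hkh (u + y) (v + y))
    rw [Real.norm_eq_abs, sub_zero, abs_of_pos (by positivity : 0 < 1 / ((n : ℝ) + 1))] at this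
    refine (mul_le_mul_of_nonneg_left this hn.le).trans (le_of_eq ?_)
    field_simp
  · set δ := 1 / ((n : ℝ) + 1)
    have hd : ∀ u, HasDerivAt (fun u => ((n : ℝ) + 1) * ∫ y in (0 : ℝ)..δ, k (u + y))
        (((n : ℝ) + 1) * (k (u + δ) - k u)) u := fun u => by
      refine HasDerivAt.const_mul _ ?_
      have e : (fun u => ∫ y in (0 : ℝ)..δ, k (u + y)) =
          fun u => (∫ y in (0 : ℝ)..(u + δ), k y) - ∫ y in (0 : ℝ)..u, k y := by
        ext u
        rw [intervalIntegral.integral_comp_add_left, add_zero,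
          intervalIntegral.integral_interval_sub_left (hki _ _) (hki _ _)]
      rw [e]
      have h1 : HasDerivAt (fun x => ∫ y in (0 : ℝ)..x, k y) (k (u + δ)) (u + δ) :=
        (hkc.integral_hasStrictDerivAt 0 _).hasDerivAt
      have h2 : HasDerivAt (fun x => ∫ y in (0 : ℝ)..x, k y) (k u) u :=
        (hkc.integral_hasStrictDerivAt 0 _).hasDerivAt
      exact (h1.comp_add_const u δ).sub h2
    exact (intervalIntegral.integral_eq_sub_of_hasDerivAt (fun u _ => hd u)
      ((by fun_prop : Continuous fun u => ((n : ℝ) + 1) * (k (u + δ) - k u)).intervalIntegrable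
        _ _)).symm
  · rw [tendsto_iff_norm_sub_tendsto_zero]
    have hl : Tendsto (fun n : ℕ => C * (1 / ((n : ℝ) + 1)) ^ η) atTop (𝓝 0) := by
      have := (tendsto_one_div_add_atTop_nhds_zero_nat (𝕜 := ℝ)).rpow_const (Or.inr hη.le)
        (p := η)
      rw [Real.zero_rpow hη.ne'] at this
      simpa using this.const_mul C
    refine squeeze_zero (fun _ => norm_nonneg _) (fun n => ?_) hl
    have hn : (0 : ℝ) < (n : ℝ) + 1 := by positivity
    have hδ : (0 : ℝ) < 1 / ((n : ℝ) + 1) := by positivity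
    have e : h u = ((n : ℝ) + 1) * ∫ y in (0 : ℝ)..1 / ((n : ℝ) + 1), k u := by
      rw [intervalIntegral.integral_const, sub_zero, smul_eq_mul, hk]
      simp only [hpi u hu]
      field_simp
    rw [e, ← mul_sub, ← intervalIntegral.integral_sub (hkci _ _ _) intervalIntegrable_const,
      norm_mul, Real.norm_of_nonneg hn.le]
    have := intervalIntegral.norm_integral_le_of_norm_le_const (a := 0) (b := 1 / ((n : ℝ) + 1))
      (f := fun y => k (u + y) - k u) (C := C * (1 / ((n : ℝ) + 1)) ^ η) (fun y hy => by
        rw [uIoc_of_le hδ.le] at hy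
        refine (hkh (u + y) u).trans (mul_le_mul_of_nonneg_left ?_ hC)
        rw [add_sub_cancel_left, abs_of_pos hy.1]
        exact Real.rpow_le_rpow hy.1.le hy.2 hη.le)
    rw [sub_zero, abs_of_pos hδ] at this
    refine (mul_le_mul_of_nonneg_left this hn.le).trans (le_of_eq ?_)
    field_simp

/-! ### The fractional Stieltjes integral -/

/-- The fractional Stieltjes integral depends on the two fractional derivatives only up to null sets,
and after reflection of `[0, t]` it is a causal convolution of left-sided derivatives. -/
theorem fracStieltjes_eq_causalConv {α t : ℝ} {f h φ ψ : ℝ → ℝ} (ht : 0 ≤ t)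
    (hφ : ∀ᵐ z, z ∈ Ioo 0 t → rlDerivLeft α f z = φ z)
    (hψ : ∀ᵐ z, z ∈ Ioo 0 t → rlDerivLeft (1 - α) (fun v => h (t - v) - h t) z = ψ z) :
    fracStieltjes α f h t = -causalConv φ ψ t := by
  rw [causalConv_comm, ← causalConv_congr ht hψ hφ, fracStieltjes, causalConv]
  congr 1
  refine intervalIntegral.integral_congr fun z _ => ?_
  rw [rlDerivRight_eq_rlDerivLeft, mul_comm]

/-- Inversion of the fractional derivative: the kernel `x^(α-1)` convolved with the Marchaud
derivative of order `α` returns `Γ(α) Γ(1 - α) f`. -/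
theorem FracRegular.causalConv_marchaud {α T M : ℝ} {f : ℝ → ℝ} (hf : FracRegular α T M f)
    (h0 : 0 < α) (h1 : α < 1) :
    ∀ᵐ z, z ∈ Ioo 0 T → causalConv (fun x => x ^ (α - 1)) (marchaud α f) z =
      Real.Gamma α * Real.Gamma (1 - α) * f z := by
  rcases le_or_gt T 0 with hT | hT
  · exact Eventually.of_forall fun z hz => absurd (hz.1.trans hz.2) (not_lt.2 hT)
  set B := Real.Gamma α * Real.Gamma (1 - α)
  set k : ℝ → ℝ := fun x => x ^ (α - 1)
  have hk : IntegrableOn k (Ioc 0 T) := integrableOn_rpow_Ioc (by linarith) T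
  have hk' : IntegrableOn (fun x : ℝ => x ^ (-α)) (Ioc 0 T) :=
    integrableOn_rpow_Ioc (by linarith) T
  have hm := hf.integrableOn_marchaud h0 h1
  have key : ∀ r ∈ Icc 0 T, ∫ u in (0 : ℝ)..r, causalConv k (marchaud α f) u =
      ∫ u in (0 : ℝ)..r, B * f u := by
    intro r hr
    calc ∫ u in (0 : ℝ)..r, causalConv k (marchaud α f) u
        = causalConv (causalConv k (marchaud α f)) (fun _ => 1) r :=
          (causalConv_one_right _ _).symm
      _ = causalConv k (causalConv (marchaud α f) fun _ => 1) r :=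
          causalConv_assoc hr.1 hr.2 hk hm aestronglyMeasurable_const (M := 1) (by simp)
      _ = causalConv k (causalConv (fun x => x ^ (-α)) f) r := by
          refine causalConv_congr_on hr.1 (fun _ _ => rfl) fun u hu => ?_
          rw [causalConv_one_right]
          exact (hf.integral_marchaud h0 h1 ⟨hu.1.le, hu.2.le.trans hr.2⟩).symm
      _ = causalConv (causalConv k fun x => x ^ (-α)) f r :=
          (causalConv_assoc hr.1 hr.2 hk hk' hf.meas hf.abs_le).symm
      _ = causalConv (fun _ => B) f r :=
          causalConv_congr_on hr.1 (fun u hu => causalConv_rpow_rpow h0 h1 hu.1) fun _ _ => rfl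
      _ = ∫ u in (0 : ℝ)..r, B * f u := rfl
  have i1 : IntervalIntegrable (causalConv k (marchaud α f)) volume 0 T :=
    (intervalIntegrable_iff_integrableOn_Ioc_of_le hT.le).2 (integrableOn_causalConv hk hm)
  have i2 : IntervalIntegrable (fun u => B * f u) volume 0 T :=
    (intervalIntegrable_iff_integrableOn_Ioc_of_le hT.le).2 (hf.integrableOn.const_mul B)
  filter_upwards [i1.ae_hasDerivAt_integral, i2.ae_hasDerivAt_integral] with z h1 h2 hz
  have hz' : z ∈ uIcc 0 T := by rw [uIcc_of_le hT.le]; exact ⟨hz.1.le, hz.2.le⟩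
  have d1 := h1 hz' 0 left_mem_uIcc
  have d2 := h2 hz' 0 left_mem_uIcc
  refine d1.unique (d2.congr_of_eventuallyEq ?_)
  filter_upwards [Ioo_mem_nhds hz.1 hz.2] with r hr
  exact key r ⟨hr.1.le, hr.2.le⟩

/-- For a continuously differentiable integrator with derivative `w`, the fractional Stieltjes
integral is the ordinary integral of `f * w`. -/
theorem FracRegular.fracStieltjes_of_deriv {α t M : ℝ} {f h w : ℝ → ℝ} (hf : FracRegular α t M f)
    (h0 : 0 < α) (h1 : α < 1) (ht : 0 ≤ t) (hw : Continuous w)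
    (hh : ∀ a ∈ Icc 0 t, h t - h a = ∫ u in a..t, w u) :
    fracStieltjes α f h t = ∫ u in (0 : ℝ)..t, f u * w u := by
  set k : ℝ → ℝ := fun x => x ^ (α - 1) with hkdef
  set w' : ℝ → ℝ := fun y => w (t - y) with hw'
  have hw'c : Continuous w' := by fun_prop
  have hk : IntegrableOn k (Ioc 0 t) := integrableOn_rpow_Ioc (by linarith) t
  have hw'i : IntegrableOn w' (Ioc 0 t) :=
    hw'c.continuousOn.integrableOn_Icc.mono_set Ioc_subset_Icc_self
  obtain ⟨W, hW⟩ := isCompact_Icc.exists_bound_of_continuousOn (hw'c.continuousOn (s := Icc 0 t))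
  have hm := hf.integrableOn_marchaud h0 h1
  have hG := (Real.Gamma_pos_of_pos h0).ne'
  have hG' := (Real.Gamma_pos_of_pos (sub_pos.2 h1)).ne'
  -- the reflected integrator is `-∫ w'`, so its derivative of order `1 - α` is `-(k * w') / Γ(α)`
  have hint : ∀ r ∈ Icc 0 t, ∫ u in (0 : ℝ)..r, (r - u) ^ (-(1 - α)) * (h (t - u) - h t) =
      ∫ u in (0 : ℝ)..r, -causalConv k w' u := by
    intro r hr
    have e : ∀ u ∈ Ioo 0 r, h (t - u) - h t = -causalConv w' (fun _ => 1) u := fun u hu => by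
      have h2 := hh (t - u) ⟨by linarith [hu.2, hr.2], by linarith [hu.1]⟩
      have h3 := intervalIntegral.integral_comp_sub_left (a := 0) (b := u) w t
      rw [sub_zero] at h3
      rw [causalConv_one_right, hw', h3, ← h2]
      ring
    calc ∫ u in (0 : ℝ)..r, (r - u) ^ (-(1 - α)) * (h (t - u) - h t)
        = causalConv k (fun u => h (t - u) - h t) r := by
          simp only [causalConv, hkdef, neg_sub]
      _ = causalConv k (fun u => -causalConv w' (fun _ => 1) u) r :=
          causalConv_congr_on hr.1 (fun _ _ => rfl) e
      _ = -causalConv k (causalConv w' fun _ => 1) r := by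
          simp only [causalConv, mul_neg, intervalIntegral.integral_neg]
      _ = -causalConv (causalConv k w') (fun _ => 1) r := by
          rw [causalConv_assoc hr.1 hr.2 hk hw'i aestronglyMeasurable_const (M := 1) (by simp)]
      _ = ∫ u in (0 : ℝ)..r, -causalConv k w' u := by
          rw [causalConv_one_right, intervalIntegral.integral_neg]
  have hψ := rlDerivLeft_ae_eq (α := 1 - α) (f := fun v => h (t - v) - h t)
    (integrableOn_causalConv hk hw'i).neg hint
  rw [fracStieltjes_eq_causalConv ht (hf.rlDerivLeft_ae h0 h1) hψ, sub_sub_cancel]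
  have hb := hf.causalConv_marchaud h0 h1
  calc -causalConv (fun z => 1 / Real.Gamma (1 - α) * marchaud α f z)
        (fun z => 1 / Real.Gamma α * (-causalConv k w') z) t
      = 1 / (Real.Gamma α * Real.Gamma (1 - α)) *
          causalConv (marchaud α f) (causalConv k w') t := by
        rw [causalConv, causalConv, ← intervalIntegral.integral_neg,
          ← intervalIntegral.integral_const_mul]
        refine intervalIntegral.integral_congr fun u _ => ?_
        simp only [Pi.neg_apply]
        field_simp
    _ = 1 / (Real.Gamma α * Real.Gamma (1 - α)) *
          causalConv (causalConv k (marchaud α f)) w' t := by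
        rw [← causalConv_assoc ht le_rfl hm hk hw'c.aestronglyMeasurable
          (fun u hu => hW u ⟨hu.1.le, hu.2⟩)]
        congr 2
        ext x
        exact causalConv_comm _ _ _
    _ = 1 / (Real.Gamma α * Real.Gamma (1 - α)) *
          causalConv (fun z => Real.Gamma α * Real.Gamma (1 - α) * f z) w' t := by
        rw [causalConv_congr ht hb (Eventually.of_forall fun _ _ => rfl)]
    _ = ∫ u in (0 : ℝ)..t, f u * w u := by
        rw [causalConv_comm, causalConv, ← intervalIntegral.integral_const_mul]
        refine intervalIntegral.integral_congr fun u _ => ?_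
        simp only [hw', sub_sub_cancel]
        field_simp

/-- The fractional Stieltjes integral in terms of Marchaud derivatives. -/
theorem FracRegular.fracStieltjes_eq {α η t M C : ℝ} {f h : ℝ → ℝ} (hf : FracRegular α t M f)
    (h0 : 0 < α) (h1 : α < 1) (hα : 1 - α < η) (hC : 0 ≤ C) (hh : IsHolder C η t h)
    (ht : 0 ≤ t) :
    fracStieltjes α f h t = -(1 / (Real.Gamma α * Real.Gamma (1 - α)) *
      ∫ u in (0 : ℝ)..t, marchaud α f (t - u) *
        marchaud (1 - α) (fun v => h (t - v) - h t) u) := by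
  have hr := hh.reflect.fracRegular hC (sub_pos.2 h1) hα
  rw [fracStieltjes_eq_causalConv ht (hf.rlDerivLeft_ae h0 h1)
    (hr.rlDerivLeft_ae (sub_pos.2 h1) (by linarith)), sub_sub_cancel, causalConv,
    ← intervalIntegral.integral_const_mul]
  congr 1
  refine intervalIntegral.integral_congr fun u _ => ?_
  have hG := (Real.Gamma_pos_of_pos h0).ne'
  have hG' := (Real.Gamma_pos_of_pos (sub_pos.2 h1)).ne'
  field_simp

/-- The fractional Stieltjes integral is continuous along pointwise convergent sequences of
integrators with a common Hölder bound. -/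
theorem FracRegular.tendsto_fracStieltjes {α η t M C : ℝ} {f h : ℝ → ℝ} {H : ℕ → ℝ → ℝ}
    (hf : FracRegular α t M f) (h0 : 0 < α) (h1 : α < 1) (hα : 1 - α < η) (hC : 0 ≤ C)
    (hh : IsHolder C η t h) (hH : ∀ n, IsHolder C η t (H n)) (ht : 0 ≤ t)
    (hlim : ∀ u ∈ Icc 0 t, Tendsto (fun n => H n u) atTop (𝓝 (h u))) :
    Tendsto (fun n => fracStieltjes α f (H n) t) atTop (𝓝 (fracStieltjes α f h t)) := by
  rw [hf.fracStieltjes_eq h0 h1 hα hC hh ht]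
  simp only [fun n => hf.fracStieltjes_eq h0 h1 hα hC (hH n) ht]
  refine (Tendsto.const_mul _ ?_).neg
  have hmi : IntervalIntegrable (fun u => marchaud α f (t - u)) volume 0 t := by
    have := ((intervalIntegrable_iff_integrableOn_Ioc_of_le ht).2
      (hf.integrableOn_marchaud h0 h1)).comp_sub_left t
    simpa using this.symm
  have h1' : 0 < 1 - α := sub_pos.2 h1
  set K := C * (1 + (1 - α) / (η - (1 - α))) * t ^ (η - (1 - α))
  refine intervalIntegral.tendsto_integral_filter_of_dominated_convergence
    (fun u => ‖marchaud α f (t - u)‖ * K) (Eventually.of_forall fun n => ?_)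
    (Eventually.of_forall fun n => Eventually.of_forall fun u hu => ?_)
    (hmi.norm.mul_const _) (Eventually.of_forall fun u hu => ?_)
  · refine hmi.def'.aestronglyMeasurable.mul ?_
    rw [uIoc_of_le ht]
    exact (((hH n).reflect.fracRegular hC h1' hα).integrableOn_marchaud h1'
      (by linarith)).aestronglyMeasurable
  · rw [uIoc_of_le ht] at hu
    rw [norm_mul]
    refine mul_le_mul_of_nonneg_left ?_ (norm_nonneg _)
    refine ((hH n).reflect.abs_marchaud_le h1' hα (by simp) hu).trans ?_
    have hp : 0 < η - (1 - α) := by linarith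
    exact mul_le_mul_of_nonneg_left (Real.rpow_le_rpow hu.1.le hu.2 hp.le) (by positivity)
  · rw [uIoc_of_le ht] at hu
    refine Tendsto.const_mul _ (tendsto_marchaud (fun n => (hH n).reflect) h1' hα
      (fun v hv => ?_) hu)
    exact (hlim (t - v) ⟨by linarith [hv.2], by linarith [hv.1]⟩).sub (hlim t ⟨ht, le_rfl⟩)

theorem FracRegular.shift {α T M s : ℝ} {f : ℝ → ℝ} (hf : FracRegular α T M f) (hs : 0 ≤ s) :
    FracRegular α (T - s) M fun u => f (s + u) := by
  have mem : ∀ t ∈ Ioc 0 (T - s), s + t ∈ Ioc 0 T := fun t ht =>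
    ⟨by linarith [ht.1], by linarith [ht.2]⟩
  have hint : ∀ t ∈ Ioc 0 (T - s), IntervalIntegrable
      (fun v => (f (s + t) - f v) * (s + t - v) ^ (-α - 1)) volume s (s + t) := fun t ht =>
    (hf.integrable _ (mem t ht)).mono_set (by
      rw [uIcc_of_le (by linarith [ht.1]), uIcc_of_le (mem t ht).1.le]
      exact Icc_subset_Icc_left hs)
  refine ⟨?_, fun t ht => hf.abs_le _ (mem t ht), fun t ht => ?_, fun t ht => ?_⟩
  · have mp : MeasurePreserving (fun u : ℝ => s + u) (volume.restrict (Ioc 0 (T - s)))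
        (volume.restrict (Ioc s T)) := by
      have := (measurePreserving_add_left volume s).restrict_preimage
        (measurableSet_Ioc (a := s) (b := T))
      simpa [preimage_const_add_Ioc] using this
    exact (hf.meas.mono_measure (Measure.restrict_mono (Ioc_subset_Ioc_left hs) le_rfl)
      ).comp_measurePreserving mp
  · have := (hint t ht).comp_add_left s
    simpa [add_sub_add_left_eq_sub] using this
  · have e := intervalIntegral.integral_comp_add_left (a := 0) (b := t)
      (fun v => |f (s + t) - f v| * (s + t - v) ^ (-α - 1)) s
    simp only [add_sub_add_left_eq_sub, add_zero] at e
    rw [e]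
    refine le_trans ?_ (hf.integral_le _ (mem t ht))
    have hI : IntervalIntegrable (fun v => |f (s + t) - f v| * (s + t - v) ^ (-α - 1)) volume 0
        (s + t) := by
      refine (hf.integrable _ (mem t ht)).norm.congr_ae ?_
      refine (ae_restrict_iff' measurableSet_uIoc).2 (Eventually.of_forall fun v hv => ?_)
      rw [uIoc_of_le (mem t ht).1.le] at hv
      have := sub_nonneg.2 hv.2
      simp only [norm_mul, Real.norm_eq_abs]
      rw [abs_of_nonneg (Real.rpow_nonneg this _)]
    refine intervalIntegral.integral_mono_interval hs (by linarith [ht.1]) le_rfl ?_ hI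
    refine (ae_restrict_iff' measurableSet_Ioc).2 (Eventually.of_forall fun v hv => ?_)
    exact mul_nonneg (abs_nonneg _) (Real.rpow_nonneg (sub_nonneg.2 hv.2) _)

/-- Additivity of the fractional Stieltjes integral over adjacent intervals. -/
theorem FracRegular.fracStieltjes_sub {α η T M C s t : ℝ} {f h : ℝ → ℝ}
    (hf : FracRegular α T M f) (h0 : 0 < α) (h1 : α < 1) (hα : 1 - α < η) (hC : 0 ≤ C)
    (hh : IsHolder C η T h) (hs : 0 ≤ s) (hst : s ≤ t) (htT : t ≤ T) :
    fracStieltjes α f h t - fracStieltjes α f h s =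
      fracStieltjes α (fun u => f (s + u)) (fun u => h (s + u)) (t - s) := by
  have ht : 0 ≤ t := hs.trans hst
  obtain ⟨H, w, hH, hw, hHw, hlim⟩ := hh.exists_smooth_approx hC (by linarith) (ht.trans htT)
  have hf1 := hf.mono htT
  have hf2 := hf.mono (hst.trans htT)
  have hf3 := hf1.shift hs
  have hts : 0 ≤ t - s := sub_nonneg.2 hst
  have l1 := hf1.tendsto_fracStieltjes h0 h1 hα hC (hh.mono htT) (fun n => (hH n).mono htT) ht
    fun u hu => hlim u ⟨hu.1, hu.2.trans htT⟩
  have l2 := hf2.tendsto_fracStieltjes h0 h1 hα hC (hh.mono (hst.trans htT))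
    (fun n => (hH n).mono (hst.trans htT)) hs fun u hu => hlim u ⟨hu.1, hu.2.trans (hst.trans htT)⟩
  have l3 := hf3.tendsto_fracStieltjes h0 h1 hα hC ((hh.mono htT).shift hs)
    (fun n => ((hH n).mono htT).shift hs) hts
    fun u hu => hlim (s + u) ⟨by linarith [hu.1], by linarith [hu.2]⟩
  refine tendsto_nhds_unique (l1.sub l2) (l3.congr fun n => ?_)
  have hfi : IntervalIntegrable (fun u => f u * w n u) volume 0 t :=
    ((intervalIntegrable_iff_integrableOn_Ioc_of_le ht).2 hf1.integrableOn).mul_continuousOn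
      (hw n).continuousOn
  have hfi' : IntervalIntegrable (fun u => f u * w n u) volume 0 s :=
    ((intervalIntegrable_iff_integrableOn_Ioc_of_le hs).2 hf2.integrableOn).mul_continuousOn
      (hw n).continuousOn
  rw [hf1.fracStieltjes_of_deriv h0 h1 ht (hw n) fun a _ => hHw n a t,
    hf2.fracStieltjes_of_deriv h0 h1 hs (hw n) fun a _ => hHw n a s,
    hf3.fracStieltjes_of_deriv h0 h1 hts (w := fun u => w n (s + u)) (by fun_prop) fun a _ => ?_,
    intervalIntegral.integral_interval_sub_left hfi hfi',
    intervalIntegral.integral_comp_add_left (fun u => f u * w n u), add_zero, add_sub_cancel]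
  rw [intervalIntegral.integral_comp_add_left (w n), hHw]

/-- Subtracting a constant from the integrand. -/
theorem IsHolder.fracStieltjes_sub_const {α η D C t : ℝ} {f h : ℝ → ℝ}
    (hf : IsHolder D η t f) (hD : 0 ≤ D) (h0 : 0 < α) (h1 : α < 1) (hαη : α < η)
    (hα : 1 - α < η) (hC : 0 ≤ C) (hh : IsHolder C η t h) (ht : 0 ≤ t) (c : ℝ) :
    fracStieltjes α (fun u => f u - c) h t =
      fracStieltjes α f h t - c * (h t - h 0) := by
  obtain ⟨H, w, hH, hw, hHw, hlim⟩ := hh.exists_smooth_approx hC (by linarith) ht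
  have hf1 := hf.fracRegular hD h0 hαη
  have hf2 := (hf.sub_const c).fracRegular hD h0 hαη
  have l1 := hf1.tendsto_fracStieltjes h0 h1 hα hC hh hH ht hlim
  have l2 := hf2.tendsto_fracStieltjes h0 h1 hα hC hh hH ht hlim
  have l3 := ((hlim t ⟨ht, le_rfl⟩).sub (hlim 0 ⟨le_rfl, ht⟩)).const_mul c
  refine tendsto_nhds_unique l2 ((l1.sub l3).congr fun n => ?_)
  have hfi : IntervalIntegrable (fun u => f u * w n u) volume 0 t :=
    ((intervalIntegrable_iff_integrableOn_Ioc_of_le ht).2 hf1.integrableOn).mul_continuousOn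
      (hw n).continuousOn
  rw [hf1.fracStieltjes_of_deriv h0 h1 ht (hw n) fun a _ => hHw n a t,
    hf2.fracStieltjes_of_deriv h0 h1 ht (hw n) fun a _ => hHw n a t, hHw,
    ← intervalIntegral.integral_const_mul, ← intervalIntegral.integral_sub hfi
      (((hw n).intervalIntegrable _ _).const_mul c)]
  exact intervalIntegral.integral_congr fun u _ => by ring

/-- The integral over `[0, t]` with an integrand that is only fractionally regular is of order
`t^η`. -/
theorem FracRegular.abs_fracStieltjes_le {α η : ℝ} (h0 : 0 < α) (h1 : α < 1) (hα : 1 - α < η) :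
    ∃ K, 0 ≤ K ∧ ∀ (t M C : ℝ) (f h : ℝ → ℝ), FracRegular α t M f → 0 ≤ M → 0 ≤ C →
      IsHolder C η t h → 0 ≤ t → t ≤ 1 → |fracStieltjes α f h t| ≤ K * M * C * t ^ η := by
  have h1' : 0 < 1 - α := sub_pos.2 h1
  have hp : 0 < η - (1 - α) := by linarith
  have hG := Real.Gamma_pos_of_pos h0
  have hG' := Real.Gamma_pos_of_pos h1'
  refine ⟨1 / (Real.Gamma α * Real.Gamma (1 - α)) * (1 + (1 - α) / (η - (1 - α))) *
    (1 / (1 - α) + α), by positivity, fun t M C f h hf hM hC hh ht ht1 => ?_⟩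
  rcases ht.eq_or_lt with rfl | htpos
  · simp [fracStieltjes, Real.zero_rpow (show η ≠ 0 by linarith)]
  rw [hf.fracStieltjes_eq h0 h1 hα hC hh ht, abs_neg, abs_mul, abs_of_pos (by positivity)]
  set K1 := C * (1 + (1 - α) / (η - (1 - α))) * t ^ (η - (1 - α)) with hK1
  have hK1' : 0 ≤ K1 := by positivity
  have ne : ∀ᵐ s : ℝ, s ≠ t := by simp [ae_iff, measure_singleton]
  have hb : |∫ u in (0 : ℝ)..t, marchaud α f (t - u) *
      marchaud (1 - α) (fun v => h (t - v) - h t) u| ≤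
      ∫ u in (0 : ℝ)..t, (M * (t - u) ^ (-α) + α * M) * K1 := by
    rw [← Real.norm_eq_abs]
    refine intervalIntegral.norm_integral_le_of_norm_le ht ?_
      ((((intervalIntegrable_sub_rpow (by linarith) t).const_mul M).add
        intervalIntegrable_const).mul_const K1)
    filter_upwards [ne] with u hu hu'
    have htu : 0 < t - u := sub_pos.2 (lt_of_le_of_ne hu'.2 hu)
    rw [norm_mul]
    refine mul_le_mul (hf.abs_marchaud_le h0 ⟨htu, by linarith [hu'.1]⟩) ?_ (norm_nonneg _)
      (by positivity)
    refine (hh.reflect.abs_marchaud_le h1' hα (by simp) hu').trans ?_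
    exact mul_le_mul_of_nonneg_left (Real.rpow_le_rpow hu'.1.le hu'.2 hp.le) (by positivity)
  have e : ∫ u in (0 : ℝ)..t, (M * (t - u) ^ (-α) + α * M) * K1 =
      (M * (t ^ (1 - α) / (1 - α)) + α * M * t) * K1 := by
    rw [intervalIntegral.integral_mul_const, intervalIntegral.integral_add
      ((intervalIntegrable_sub_rpow (by linarith) t).const_mul M) intervalIntegrable_const,
      intervalIntegral.integral_const_mul, integral_sub_rpow (by linarith),
      intervalIntegral.integral_const, neg_add_eq_sub, sub_zero, smul_eq_mul]
    ring
  have ht' : t ≤ t ^ (1 - α) := by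
    calc t = t ^ (1 : ℝ) := (Real.rpow_one t).symm
      _ ≤ t ^ (1 - α) := Real.rpow_le_rpow_of_exponent_ge htpos ht1 (by linarith)
  have hsplit : t ^ η = t ^ (1 - α) * t ^ (η - (1 - α)) := by
    rw [← Real.rpow_add htpos]; ring_nf
  calc _ ≤ 1 / (Real.Gamma α * Real.Gamma (1 - α)) *
        ((M * (t ^ (1 - α) / (1 - α)) + α * M * t ^ (1 - α)) * K1) := by
        refine mul_le_mul_of_nonneg_left (hb.trans (e.le.trans ?_)) (by positivity)
        gcongr
    _ = _ := by
        rw [hsplit, hK1]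
        ring

/-- The integral over `[0, t]` with a Hölder integrand that vanishes at `0` is of order
`t^(2η)`. -/
theorem IsHolder.abs_fracStieltjes_le {α η : ℝ} (h0 : 0 < α) (h1 : α < 1) (hα : 1 - α < η)
    (hαη : α < η) :
    ∃ K, 0 ≤ K ∧ ∀ (t D C : ℝ) (f h : ℝ → ℝ), IsHolder D η t f → f 0 = 0 → 0 ≤ D → 0 ≤ C →
      IsHolder C η t h → 0 ≤ t → |fracStieltjes α f h t| ≤ K * D * C * t ^ (2 * η) := by
  have h1' : 0 < 1 - α := sub_pos.2 h1
  have hp : 0 < η - (1 - α) := by linarith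
  have hq : 0 < η - α := by linarith
  have hG := Real.Gamma_pos_of_pos h0
  have hG' := Real.Gamma_pos_of_pos h1'
  refine ⟨1 / (Real.Gamma α * Real.Gamma (1 - α)) * (1 + (1 - α) / (η - (1 - α))) *
    (1 + α / (η - α)), by positivity, fun t D C f h hf hf0 hD hC hh ht => ?_⟩
  rcases ht.eq_or_lt with rfl | htpos
  · simp [fracStieltjes, Real.zero_rpow (show 2 * η ≠ 0 by linarith)]
  rw [(hf.fracRegular hD h0 hαη).fracStieltjes_eq h0 h1 hα hC hh ht, abs_neg, abs_mul,
    abs_of_pos (by positivity)]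
  have ne : ∀ᵐ s : ℝ, s ≠ t := by simp [ae_iff, measure_singleton]
  have hb := intervalIntegral.norm_integral_le_of_norm_le_const_ae (a := 0) (b := t)
    (f := fun u => marchaud α f (t - u) * marchaud (1 - α) (fun v => h (t - v) - h t) u)
    (C := D * (1 + α / (η - α)) * t ^ (η - α) *
      (C * (1 + (1 - α) / (η - (1 - α))) * t ^ (η - (1 - α)))) (by
    filter_upwards [ne] with u hu hu'
    rw [uIoc_of_le ht] at hu'
    have htu : 0 < t - u := sub_pos.2 (lt_of_le_of_ne hu'.2 hu)
    rw [norm_mul]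
    refine mul_le_mul ((hf.abs_marchaud_le h0 hαη hf0 ⟨htu, by linarith [hu'.1]⟩).trans ?_)
      ((hh.reflect.abs_marchaud_le h1' hα (by simp) hu').trans ?_) (norm_nonneg _) (by positivity)
    · exact mul_le_mul_of_nonneg_left (Real.rpow_le_rpow htu.le (by linarith [hu'.1]) hq.le)
        (by positivity)
    · exact mul_le_mul_of_nonneg_left (Real.rpow_le_rpow hu'.1.le hu'.2 hp.le) (by positivity))
  rw [sub_zero, abs_of_pos htpos, Real.norm_eq_abs] at hb
  have hsplit : t ^ (2 * η) = t ^ (η - α) * t ^ (η - (1 - α)) * t := by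
    rw [← Real.rpow_add htpos, ← Real.rpow_add_one htpos.ne']
    ring_nf
  refine (mul_le_mul_of_nonneg_left hb (by positivity)).trans (le_of_eq ?_)
  rw [hsplit]
  ring

/-- A fractionally regular integrand produces a Hölder continuous indefinite integral. -/
theorem FracRegular.isHolder_fracStieltjes {α η M C : ℝ} {f h : ℝ → ℝ} (hf : FracRegular α 1 M f)
    (hM : 0 ≤ M) (h0 : 0 < α) (h1 : α < 1) (hα : 1 - α < η) (hC : 0 ≤ C)
    (hh : IsHolder C η 1 h) : ∃ K, 0 ≤ K ∧ IsHolder K η 1 (fracStieltjes α f h) := by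
  obtain ⟨K, hK, hb⟩ := FracRegular.abs_fracStieltjes_le h0 h1 hα
  refine ⟨K * M * C, by positivity, fun u hu v hv => ?_⟩
  wlog huv : v ≤ u generalizing u v
  · rw [abs_sub_comm, abs_sub_comm u v]
    exact this v hv u hu (le_of_not_ge huv)
  rw [hf.fracStieltjes_sub h0 h1 hα hC hh hv.1 huv hu.2, abs_of_nonneg (sub_nonneg.2 huv)]
  exact hb _ _ _ _ _ ((hf.mono hu.2).shift hv.1) hM hC ((hh.mono hu.2).shift hv.1)
    (sub_nonneg.2 huv) (by linarith [hu.2, hv.1])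

/-- Young's estimate for the increments of the integral. -/
theorem IsHolder.abs_fracStieltjes_increment_le {α η D C : ℝ} {f h : ℝ → ℝ}
    (hf : IsHolder D η 1 f) (hD : 0 ≤ D) (h0 : 0 < α) (h1 : α < 1) (hα : 1 - α < η) (hαη : α < η)
    (hC : 0 ≤ C) (hh : IsHolder C η 1 h) :
    ∃ K, 0 ≤ K ∧ ∀ s t, 0 ≤ s → s ≤ t → t ≤ 1 →
      |fracStieltjes α f h t - fracStieltjes α f h s - f s * (h t - h s)| ≤
        K * (t - s) ^ (2 * η) := by
  obtain ⟨K, hK, hb⟩ := IsHolder.abs_fracStieltjes_le h0 h1 hα hαη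
  refine ⟨K * D * C, by positivity, fun s t hs hst ht => ?_⟩
  have hts : 0 ≤ t - s := sub_nonneg.2 hst
  have hf' := (hf.mono ht).shift hs
  have hh' := (hh.mono ht).shift hs
  have e := hf'.fracStieltjes_sub_const hD h0 h1 hαη hα hC hh' hts (f s)
  rw [add_sub_cancel, add_zero] at e
  rw [(hf.fracRegular hD h0 hαη).fracStieltjes_sub h0 h1 hα hC hh hs hst ht, ← e]
  exact hb _ _ _ _ _ (hf'.sub_const _) (by simp) hD hC hh' hts

/-! ### The norm of `W_0^{α,∞}` -/

theorem isHolder_of_holderOnWith {C : ℝ≥0} {η : ℝ} {g : ℝ → ℝ} (hη : 0 ≤ η)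
    (hg : HolderOnWith C η.toNNReal g (Icc 0 1)) : IsHolder C η 1 g := fun u hu v hv => by
  have := hg.dist_le hu hv
  rwa [Real.dist_eq, Real.dist_eq, Real.coe_toNNReal _ hη] at this

theorem div_rpow_eq_mul_rpow {a α x : ℝ} (hx : 0 < x) :
    a / x ^ (α + 1) = a * x ^ (-α - 1) := by
  rw [show -α - 1 = -(α + 1) by ring, Real.rpow_neg hx.le, div_eq_mul_inv]

/-- Only values on `(0, 1]` enter `FracRegular`, and a finite norm makes the increment integrals
converge absolutely. -/
theorem MemW.fracRegular {α : ℝ} {f : ℝ → ℝ} (hf : MemW α f) :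
    ∃ M, 0 ≤ M ∧ FracRegular α 1 M f := by
  obtain ⟨hfm, hfN⟩ := hf
  have hm : AEStronglyMeasurable f (volume.restrict (Ioc 0 1)) :=
    hfm.aestronglyMeasurable.mono_measure (Measure.restrict_mono Ioc_subset_Icc_self le_rfl)
  have hle : ∀ t ∈ Ioc (0 : ℝ) 1, ENNReal.ofReal |f t| +
      ∫⁻ s in Ioo (0 : ℝ) t, ENNReal.ofReal (|f t - f s| / (t - s) ^ (α + 1)) ≤ nrNorm α f :=
    fun t ht => le_iSup₂ (f := fun t (_ : t ∈ Icc (0 : ℝ) 1) => ENNReal.ofReal |f t| +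
      ∫⁻ s in Ioo (0 : ℝ) t, ENNReal.ofReal (|f t - f s| / (t - s) ^ (α + 1))) t ⟨ht.1.le, ht.2⟩
  have hmeas : ∀ t ∈ Ioc (0 : ℝ) 1, AEStronglyMeasurable
      (fun s => (f t - f s) * (t - s) ^ (-α - 1)) (volume.restrict (Ioo 0 t)) := fun t ht => by
    refine (aestronglyMeasurable_const.sub (hm.mono_measure (Measure.restrict_mono
      (Ioo_subset_Ioc_self.trans (Ioc_subset_Ioc_right ht.2)) le_rfl))).mul ?_
    exact (by fun_prop : Measurable fun s : ℝ => (t - s) ^ (-α - 1)).aestronglyMeasurable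
  have heq : ∀ t : ℝ, ∫⁻ s in Ioo (0 : ℝ) t, ENNReal.ofReal (|f t - f s| / (t - s) ^ (α + 1)) =
      ∫⁻ s in Ioo (0 : ℝ) t, ENNReal.ofReal (|f t - f s| * (t - s) ^ (-α - 1)) := fun t =>
    setLIntegral_congr_fun measurableSet_Ioo fun s hs => by
      rw [div_rpow_eq_mul_rpow (sub_pos.2 hs.2)]
  have hnorm : ∀ t : ℝ, ∀ s ∈ Ioo (0 : ℝ) t, ‖(f t - f s) * (t - s) ^ (-α - 1)‖ =
      |f t - f s| * (t - s) ^ (-α - 1) := fun t s hs => by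
    rw [norm_mul, Real.norm_eq_abs,
      Real.norm_of_nonneg (Real.rpow_nonneg (sub_nonneg.2 hs.2.le) _)]
  refine ⟨(nrNorm α f).toReal, ENNReal.toReal_nonneg, hm, fun t ht => ?_, fun t ht => ?_,
    fun t ht => ?_⟩
  · exact (ENNReal.ofReal_le_iff_le_toReal hfN.ne).1 (le_self_add.trans (hle t ht))
  · rw [intervalIntegrable_iff_integrableOn_Ioo_of_le ht.1.le]
    refine ⟨hmeas t ht, ?_⟩
    rw [hasFiniteIntegral_iff_norm]
    refine lt_of_le_of_lt ((le_of_eq ?_).trans (le_add_self.trans (hle t ht))) hfN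
    rw [heq]
    exact setLIntegral_congr_fun measurableSet_Ioo fun s hs => by
      rw [hnorm t s hs]
  · rw [intervalIntegral.integral_of_le ht.1.le, integral_Ioc_eq_integral_Ioo,
      integral_eq_lintegral_of_nonneg_ae, ← heq]
    · exact ENNReal.toReal_mono hfN.ne (le_add_self.trans (hle t ht))
    · refine (ae_restrict_iff' measurableSet_Ioo).2 (Eventually.of_forall fun s hs => ?_)
      exact mul_nonneg (abs_nonneg _) (Real.rpow_nonneg (sub_nonneg.2 hs.2.le) _)
    · refine (hmeas t ht).norm.congr ((ae_restrict_iff' measurableSet_Ioo).2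
        (Eventually.of_forall fun s hs => ?_))
      exact hnorm t s hs

theorem IsHolder.nrNorm_le {C η α B : ℝ} {f : ℝ → ℝ} (hf : IsHolder C η 1 f) (hC : 0 ≤ C)
    (h0 : 0 < α) (hαη : α < η) (hB : ∀ t ∈ Icc (0 : ℝ) 1, |f t| ≤ B) :
    nrNorm α f ≤ ENNReal.ofReal (B + C / (η - α)) := by
  have hp : 0 < η - α := sub_pos.2 hαη
  have hB0 : 0 ≤ B := (abs_nonneg _).trans (hB 0 ⟨le_rfl, zero_le_one⟩)
  refine iSup₂_le fun t ht => ?_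
  rw [ENNReal.ofReal_add hB0 (by positivity)]
  refine add_le_add (ENNReal.ofReal_le_ofReal (hB t ht)) ?_
  rcases ht.1.eq_or_lt with rfl | htpos
  · simp
  have ht' : t ∈ Ioc (0 : ℝ) 1 := ⟨htpos, ht.2⟩
  have hi := (intervalIntegrable_iff_integrableOn_Ioo_of_le htpos.le).1
    (hf.integrable_increment h0 hαη ht')
  have hi' : IntegrableOn (fun s => |f t - f s| / (t - s) ^ (α + 1)) (Ioo 0 t) := by
    refine hi.norm.congr ((ae_restrict_iff' measurableSet_Ioo).2
      (Eventually.of_forall fun s hs => ?_))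
    simp only
    rw [norm_mul, Real.norm_eq_abs, Real.norm_of_nonneg (Real.rpow_nonneg
      (sub_nonneg.2 hs.2.le) _), div_rpow_eq_mul_rpow (sub_pos.2 hs.2)]
  rw [← ofReal_integral_eq_lintegral_ofReal hi' ((ae_restrict_iff' measurableSet_Ioo).2
      (Eventually.of_forall fun s hs => div_nonneg (abs_nonneg _)
        (Real.rpow_nonneg (sub_nonneg.2 hs.2.le) _)))]
  refine ENNReal.ofReal_le_ofReal ?_
  have e : ∫ s in Ioo 0 t, |f t - f s| / (t - s) ^ (α + 1) =
      ∫ s in (0 : ℝ)..t, |f t - f s| * (t - s) ^ (-α - 1) := by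
    rw [intervalIntegral.integral_of_le htpos.le, integral_Ioc_eq_integral_Ioo]
    exact setIntegral_congr_fun measurableSet_Ioo fun s hs =>
      div_rpow_eq_mul_rpow (sub_pos.2 hs.2)
  rw [e]
  refine (hf.integral_increment_le h0 hαη ht').trans ?_
  exact mul_le_of_le_one_right (by positivity) (Real.rpow_le_one ht.1 ht.2 hp.le)

theorem IsHolder.memW {C η α : ℝ} {f : ℝ → ℝ} (hf : IsHolder C η 1 f) (hC : 0 ≤ C)
    (h0 : 0 < α) (hαη : α < η) : MemW α f :=
  ⟨((hf.continuousOn (h0.trans hαη)).aestronglyMeasurable measurableSet_Icc).aemeasurable,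
    (hf.nrNorm_le hC h0 hαη fun _ ht => hf.abs_le hC (h0.trans hαη).le ht).trans_lt
      ENNReal.ofReal_lt_top⟩

/-! ### The linear equation -/

/-- A function whose increments are of order greater than one is constant. -/
theorem eq_of_increment_le_rpow {V : ℝ → ℝ} {K θ : ℝ} (hθ : 1 < θ)
    (hV : ∀ s t, 0 ≤ s → s ≤ t → t ≤ 1 → |V t - V s| ≤ K * (t - s) ^ θ) {t : ℝ}
    (ht : t ∈ Icc (0 : ℝ) 1) : V t = V 0 := by
  have hlim : Tendsto (fun n : ℕ => K * t ^ θ * (n : ℝ) ^ (-(θ - 1))) atTop (𝓝 0) := by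
    have := (tendsto_rpow_neg_atTop (sub_pos.2 hθ)).comp tendsto_natCast_atTop_atTop
    simpa using this.const_mul (K * t ^ θ)
  have hle : ∀ᶠ n : ℕ in atTop, |V t - V 0| ≤ K * t ^ θ * (n : ℝ) ^ (-(θ - 1)) := by
    filter_upwards [eventually_gt_atTop 0] with n hn
    have hn' : (0 : ℝ) < n := Nat.cast_pos.2 hn
    have hs := Finset.sum_range_sub (fun i : ℕ => V ((i : ℝ) * (t / n))) n
    have e : (n : ℝ) * (t / n) = t := by field_simp
    simp only [Nat.cast_zero, zero_mul, e] at hs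
    rw [← hs]
    refine (Finset.abs_sum_le_sum_abs _ _).trans ?_
    have hb : ∀ i ∈ Finset.range n, |V (((i + 1 : ℕ) : ℝ) * (t / n)) - V ((i : ℝ) * (t / n))| ≤
        K * (t / n) ^ θ := fun i hi => by
      have htn : 0 ≤ t / n := div_nonneg ht.1 hn'.le
      have hi' : ((i + 1 : ℕ) : ℝ) ≤ n := Nat.cast_le.2 (Finset.mem_range.1 hi)
      have h := hV ((i : ℝ) * (t / n)) (((i + 1 : ℕ) : ℝ) * (t / n)) (by positivity)
        (by gcongr; simp)
        ((mul_le_mul_of_nonneg_right hi' htn).trans (e.le.trans ht.2))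
      rw [Nat.cast_succ] at h ⊢
      rwa [← sub_mul, add_sub_cancel_left, one_mul] at h
    refine (Finset.sum_le_card_nsmul _ _ _ hb).trans (le_of_eq ?_)
    rw [Finset.card_range, nsmul_eq_mul, Real.div_rpow ht.1 hn'.le, neg_sub,
      Real.rpow_sub hn', Real.rpow_one]
    field_simp
  have := ge_of_tendsto hlim hle
  exact sub_eq_zero.1 (abs_nonpos_iff.1 this)

theorem abs_exp_sub_one_sub_le (y : ℝ) : |Real.exp y - 1 - y| ≤ y ^ 2 * Real.exp |y| := by
  have h := Complex.norm_exp_sub_sum_le_norm_mul_exp (y : ℂ) 2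
  simp only [Finset.sum_range_succ, Finset.sum_range_zero, Nat.factorial, pow_zero, pow_one] at h
  norm_num at h
  rw [← Complex.ofReal_exp, ← Complex.ofReal_one, ← Complex.ofReal_add, ← Complex.ofReal_sub,
    Complex.norm_real, Real.norm_eq_abs, ← sub_sub] at h
  exact h

theorem abs_exp_sub_exp_le {a b Q : ℝ} (ha : a ≤ Q) (hb : b ≤ Q) :
    |Real.exp a - Real.exp b| ≤ Real.exp Q * |a - b| := by
  wlog hab : b ≤ a generalizing a b
  · rw [abs_sub_comm, abs_sub_comm a b]
    exact this hb ha (le_of_not_ge hab)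
  rw [abs_of_nonneg (sub_nonneg.2 (Real.exp_le_exp.2 hab)), abs_of_nonneg (sub_nonneg.2 hab)]
  have h1 := Real.add_one_le_exp (b - a)
  have h2 : Real.exp b = Real.exp a * Real.exp (b - a) := by rw [← Real.exp_add]; ring_nf
  have h3 : Real.exp a - Real.exp b ≤ Real.exp a * (a - b) := by
    rw [h2]
    nlinarith [Real.exp_pos a]
  exact h3.trans (mul_le_mul_of_nonneg_right (Real.exp_le_exp.2 ha) (sub_nonneg.2 hab))

theorem IsHolder.affine {C H β γ : ℝ} {g : ℝ → ℝ} (hg : IsHolder C H 1 g) (hH : 0 < H)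
    (hH1 : H ≤ 1) : IsHolder (|β| + |γ| * C) H 1 fun t => β * t + γ * g t := fun u hu v hv => by
  have h1 : |u - v| ≤ |u - v| ^ H := by
    rcases (abs_nonneg (u - v)).eq_or_lt with h | h
    · rw [← h, Real.zero_rpow hH.ne']
    · have h2 : |u - v| ≤ 1 := by
        rw [_root_.abs_le]
        constructor <;> linarith [hu.1, hu.2, hv.1, hv.2]
      calc |u - v| = |u - v| ^ (1 : ℝ) := (Real.rpow_one _).symm
        _ ≤ _ := Real.rpow_le_rpow_of_exponent_ge h h2 hH1
  have e : β * u + γ * g u - (β * v + γ * g v) = β * (u - v) + γ * (g u - g v) := by ring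
  simp only
  rw [e]
  refine (abs_add_le _ _).trans ?_
  rw [abs_mul, abs_mul, add_mul, mul_assoc]
  exact add_le_add (mul_le_mul_of_nonneg_left h1 (abs_nonneg _))
    (mul_le_mul_of_nonneg_left (hg u hu v hv) (abs_nonneg _))

theorem IsHolder.exp {R H : ℝ} {ρ : ℝ → ℝ} (hρ : IsHolder R H 1 ρ) (hR : 0 ≤ R) (hH : 0 < H) :
    IsHolder (Real.exp (|ρ 0| + R) * R) H 1 fun t => Real.exp (ρ t) := fun u hu v hv => by
  have hb : ∀ t ∈ Icc (0 : ℝ) 1, ρ t ≤ |ρ 0| + R := fun t ht => by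
    simpa using (le_abs_self _).trans (hρ.abs_le hR hH.le ht)
  refine (abs_exp_sub_exp_le (hb u hu) (hb v hv)).trans ?_
  rw [mul_assoc]
  exact mul_le_mul_of_nonneg_left (hρ u hu v hv) (Real.exp_pos _).le

/-- First-order expansion of the exponential of a Hölder function. -/
theorem IsHolder.exp_increment_le {R H : ℝ} {ρ : ℝ → ℝ} (hρ : IsHolder R H 1 ρ) (hR : 0 ≤ R)
    (hH : 0 < H) : ∃ K, 0 ≤ K ∧ ∀ s t, 0 ≤ s → s ≤ t → t ≤ 1 →
      |Real.exp (ρ t) - Real.exp (ρ s) - Real.exp (ρ s) * (ρ t - ρ s)| ≤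
        K * (t - s) ^ (2 * H) := by
  refine ⟨Real.exp (|ρ 0| + R) * (R ^ 2 * Real.exp R), by positivity, fun s t hs hst ht => ?_⟩
  have hts : 0 ≤ t - s := sub_nonneg.2 hst
  have h1 := hρ t ⟨hs.trans hst, ht⟩ s ⟨hs, hst.trans ht⟩
  rw [abs_of_nonneg hts] at h1
  have h2 : |ρ t - ρ s| ≤ R :=
    h1.trans (mul_le_of_le_one_right hR (Real.rpow_le_one hts (by linarith) hH.le))
  have h3 : ρ s ≤ |ρ 0| + R := by
    simpa using (le_abs_self _).trans (hρ.abs_le hR hH.le ⟨hs, hst.trans ht⟩)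
  have e : Real.exp (ρ t) - Real.exp (ρ s) - Real.exp (ρ s) * (ρ t - ρ s) =
      Real.exp (ρ s) * (Real.exp (ρ t - ρ s) - 1 - (ρ t - ρ s)) := by
    rw [Real.exp_sub]
    field_simp
  have h4 : (ρ t - ρ s) ^ 2 ≤ R ^ 2 * (t - s) ^ (2 * H) := by
    rw [← sq_abs, mul_comm 2 H, Real.rpow_mul hts, Real.rpow_two, ← mul_pow]
    exact pow_le_pow_left₀ (abs_nonneg _) h1 2
  rw [e, abs_mul, abs_of_pos (Real.exp_pos _)]
  calc _ ≤ Real.exp (|ρ 0| + R) * (R ^ 2 * (t - s) ^ (2 * H) * Real.exp R) := by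
        refine mul_le_mul (Real.exp_le_exp.2 h3) ((abs_exp_sub_one_sub_le _).trans ?_)
          (abs_nonneg _) (Real.exp_pos _).le
        exact mul_le_mul h4 (Real.exp_le_exp.2 h2) (Real.exp_pos _).le (by positivity)
    _ = _ := by ring

/-- First-order expansion of `β ∫ Y dz + γ ∫ Y dg` for a Hölder integrand `Y`. -/
theorem IsHolder.linear_increment_le {α β γ H D C : ℝ} {Y g : ℝ → ℝ} (hY : IsHolder D H 1 Y)
    (hD : 0 ≤ D) (h0 : 0 < α) (h1 : α < 1) (hα : 1 - α < H) (hαH : α < H) (hH1 : H ≤ 1)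
    (hC : 0 ≤ C) (hg : IsHolder C H 1 g) :
    ∃ K, 0 ≤ K ∧ ∀ s t, 0 ≤ s → s ≤ t → t ≤ 1 →
      |(β * (∫ z in (0 : ℝ)..t, Y z) + γ * fracStieltjes α Y g t) -
        (β * (∫ z in (0 : ℝ)..s, Y z) + γ * fracStieltjes α Y g s) -
        Y s * (β * t + γ * g t - (β * s + γ * g s))| ≤ K * (t - s) ^ (2 * H) := by
  obtain ⟨K, hK, hb⟩ := hY.abs_fracStieltjes_increment_le hD h0 h1 hα hαH hC hg
  have hH : 0 < H := h0.trans hαH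
  refine ⟨|β| * D + |γ| * K, by positivity, fun s t hs hst ht => ?_⟩
  have hts : 0 ≤ t - s := sub_nonneg.2 hst
  have hYi : ∀ a b, a ∈ Icc (0 : ℝ) 1 → b ∈ Icc (0 : ℝ) 1 → IntervalIntegrable Y volume a b :=
    fun a b ha hb => ((hY.continuousOn hH).mono (uIcc_subset_Icc ha hb)).intervalIntegrable
  have m0 : (0 : ℝ) ∈ Icc (0 : ℝ) 1 := ⟨le_rfl, zero_le_one⟩
  have ms : s ∈ Icc (0 : ℝ) 1 := ⟨hs, hst.trans ht⟩
  have mt : t ∈ Icc (0 : ℝ) 1 := ⟨hs.trans hst, ht⟩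
  have e1 : (∫ z in (0 : ℝ)..t, Y z) - (∫ z in (0 : ℝ)..s, Y z) - Y s * (t - s) =
      ∫ z in s..t, (Y z - Y s) := by
    rw [intervalIntegral.integral_interval_sub_left (hYi _ _ m0 mt) (hYi _ _ m0 ms),
      intervalIntegral.integral_sub (hYi _ _ ms mt) intervalIntegrable_const,
      intervalIntegral.integral_const, smul_eq_mul]
    ring
  have h2 : |∫ z in s..t, (Y z - Y s)| ≤ D * (t - s) ^ (2 * H) := by
    have := intervalIntegral.norm_integral_le_of_norm_le_const (a := s) (b := t)
      (f := fun z => Y z - Y s) (C := D * (t - s) ^ H) (fun z hz => by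
        rw [uIoc_of_le hst] at hz
        refine (hY z ⟨hs.trans hz.1.le, hz.2.trans ht⟩ s ms).trans ?_
        rw [abs_of_pos (sub_pos.2 hz.1)]
        have hz' : 0 ≤ z - s := sub_nonneg.2 hz.1.le
        exact mul_le_mul_of_nonneg_left (Real.rpow_le_rpow hz' (by linarith [hz.2]) hH.le) hD)
    rw [abs_of_nonneg hts, Real.norm_eq_abs] at this
    refine this.trans ?_
    rcases hts.eq_or_lt with h | h
    · rw [← h, mul_zero, Real.zero_rpow (by linarith), mul_zero]
    · rw [mul_assoc]
      refine mul_le_mul_of_nonneg_left ?_ hD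
      rw [← Real.rpow_add_one h.ne']
      exact Real.rpow_le_rpow_of_exponent_ge h (by linarith) (by linarith)
  have e2 : (β * (∫ z in (0 : ℝ)..t, Y z) + γ * fracStieltjes α Y g t) -
        (β * (∫ z in (0 : ℝ)..s, Y z) + γ * fracStieltjes α Y g s) -
        Y s * (β * t + γ * g t - (β * s + γ * g s)) =
      β * (∫ z in s..t, (Y z - Y s)) +
        γ * (fracStieltjes α Y g t - fracStieltjes α Y g s - Y s * (g t - g s)) := by
    rw [← e1]; ring
  rw [e2]
  refine (abs_add_le _ _).trans ?_
  rw [abs_mul, abs_mul, add_mul, mul_assoc, mul_assoc]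
  exact add_le_add (mul_le_mul_of_nonneg_left h2 (abs_nonneg _))
    (mul_le_mul_of_nonneg_left (hb s t hs hst ht) (abs_nonneg _))

/-- The exponential `x₀ exp(β t + γ g(t))` solves the linear equation. -/
theorem isLinearSolution_exp {α β γ x₀ H C : ℝ} {g : ℝ → ℝ} (hH1 : H < 1)
    (hα : 1 - H < α) (hαH : α < H) (hC : 0 ≤ C) (hg : IsHolder C H 1 g) (hg0 : g 0 = 0) :
    IsLinearSolution α β γ x₀ g fun t => x₀ * Real.exp (β * t + γ * g t) := by
  have h0 : 0 < α := by linarith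
  have hHp : 0 < H := by linarith
  have hρ := hg.affine (β := β) (γ := γ) hHp hH1.le
  have hR : 0 ≤ |β| + |γ| * C := by positivity
  set ρ : ℝ → ℝ := fun t => β * t + γ * g t
  obtain ⟨K1, hK1, hE⟩ := hρ.exp_increment_le hR hHp
  have hX : IsHolder (|x₀| * (Real.exp (|ρ 0| + (|β| + |γ| * C)) * (|β| + |γ| * C))) H 1
      fun t => x₀ * Real.exp (ρ t) := fun u hu v hv => by
    simp only
    rw [← mul_sub, abs_mul, mul_assoc]
    exact mul_le_mul_of_nonneg_left (hρ.exp hR hHp u hu v hv) (abs_nonneg _)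
  have hD : 0 ≤ |x₀| * (Real.exp (|ρ 0| + (|β| + |γ| * C)) * (|β| + |γ| * C)) := by positivity
  refine ⟨hX.memW hD h0 hαH, fun t ht => ?_⟩
  obtain ⟨K2, hK2, hL⟩ := hX.linear_increment_le (β := β) (γ := γ) hD h0 (by linarith)
    (by linarith) hαH hH1.le hC hg
  set X : ℝ → ℝ := fun t => x₀ * Real.exp (ρ t) with hXdef
  set Z : ℝ → ℝ := fun t => β * (∫ z in (0 : ℝ)..t, X z) + γ * fracStieltjes α X g t with hZ
  have hconst := eq_of_increment_le_rpow (V := fun t => X t - Z t) (K := |x₀| * K1 + K2)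
    (θ := 2 * H) (by linarith) (fun s t hs hst ht => by
      have e : X t - Z t - (X s - Z s) =
          x₀ * (Real.exp (ρ t) - Real.exp (ρ s) - Real.exp (ρ s) * (ρ t - ρ s)) -
          (Z t - Z s - X s * (ρ t - ρ s)) := by
        simp only [hXdef]; ring
      rw [e]
      refine (abs_sub _ _).trans ?_
      rw [abs_mul, add_mul, mul_assoc |x₀|]
      exact add_le_add (mul_le_mul_of_nonneg_left (hE s t hs hst ht) (abs_nonneg _))
        (hL s t hs hst ht)) ht
  have hX0 : X 0 = x₀ := by simp [hXdef, ρ, hg0]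
  have hZ0 : Z 0 = 0 := by simp [hZ, fracStieltjes]
  simp only [hX0, hZ0, sub_zero] at hconst
  have : X t = x₀ + Z t := by linarith
  rw [this, hZ]
  ring

/-- Every solution of the linear equation is the exponential one: the product of a solution with
`exp(-β t - γ g(t))` has increments of order `2H > 1`. -/
theorem IsLinearSolution.eq_exp {α β γ x₀ H C : ℝ} {g Y : ℝ → ℝ} (hH1 : H < 1)
    (hα : 1 - H < α) (hαH : α < H) (hC : 0 ≤ C) (hg : IsHolder C H 1 g) (hg0 : g 0 = 0)
    (hY : IsLinearSolution α β γ x₀ g Y) {t : ℝ} (ht : t ∈ Icc (0 : ℝ) 1) :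
    Y t = x₀ * Real.exp (β * t + γ * g t) := by
  have h0 : 0 < α := by linarith
  have h1 : α < 1 := by linarith
  have hHp : 0 < H := by linarith
  have hα' : 1 - α < H := by linarith
  obtain ⟨hW, hYeq⟩ := hY
  obtain ⟨M, hM, hreg⟩ := hW.fracRegular
  obtain ⟨K, hK, hI⟩ := hreg.isHolder_fracStieltjes hM h0 h1 hα' hC hg
  have m0 : (0 : ℝ) ∈ Icc (0 : ℝ) 1 := ⟨le_rfl, zero_le_one⟩
  have hYi : ∀ a ∈ Icc (0 : ℝ) 1, IntervalIntegrable Y volume 0 a := fun a ha =>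
    (intervalIntegrable_iff_integrableOn_Ioc_of_le ha.1).2 (hreg.mono ha.2).integrableOn
  -- both integrals on the right-hand side are `H`-Hölder, hence so is `Y`
  have hYint : IsHolder M H 1 fun t => ∫ z in (0 : ℝ)..t, Y z := fun u hu v hv => by
    simp only
    rw [intervalIntegral.integral_interval_sub_left (hYi u hu) (hYi v hv)]
    have h2 := intervalIntegral.norm_integral_le_of_norm_le_const (a := v) (b := u) (f := Y)
      (C := M) (fun z hz => hreg.abs_le z ⟨(le_min hv.1 hu.1).trans_lt hz.1,
        hz.2.trans (max_le hv.2 hu.2)⟩)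
    refine h2.trans (mul_le_mul_of_nonneg_left ?_ hM)
    have h3 : |u - v| ≤ 1 := by
      rw [_root_.abs_le]
      constructor <;> linarith [hu.1, hu.2, hv.1, hv.2]
    rcases (abs_nonneg (u - v)).eq_or_lt with h | h
    · rw [← h, Real.zero_rpow hHp.ne']
    · calc |u - v| = |u - v| ^ (1 : ℝ) := (Real.rpow_one _).symm
        _ ≤ _ := Real.rpow_le_rpow_of_exponent_ge h h3 hH1.le
  have hYH : IsHolder (|β| * M + |γ| * K) H 1 Y := fun u hu v hv => by
    have e : Y u - Y v = β * ((∫ z in (0 : ℝ)..u, Y z) - ∫ z in (0 : ℝ)..v, Y z) +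
        γ * (fracStieltjes α Y g u - fracStieltjes α Y g v) := by
      rw [hYeq u hu, hYeq v hv]; ring
    rw [e]
    refine (abs_add_le _ _).trans ?_
    rw [abs_mul, abs_mul, add_mul, mul_assoc, mul_assoc]
    exact add_le_add (mul_le_mul_of_nonneg_left (hYint u hu v hv) (abs_nonneg _))
      (mul_le_mul_of_nonneg_left (hI u hu v hv) (abs_nonneg _))
  have hD : 0 ≤ |β| * M + |γ| * K := by positivity
  obtain ⟨K2, hK2, hL⟩ := hYH.linear_increment_le (β := β) (γ := γ) hD h0 h1 hα' hαH hH1.le hC hg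
  have hρ := hg.affine (β := -β) (γ := -γ) hHp hH1.le
  have hR : 0 ≤ |-β| + |-γ| * C := by positivity
  set ρ : ℝ → ℝ := fun t => -β * t + -γ * g t with hρdef
  obtain ⟨K1, hK1, hE⟩ := hρ.exp_increment_le hR hHp
  have hEH := hρ.exp hR hHp
  set E : ℝ → ℝ := fun t => Real.exp (ρ t) with hEdef
  have hDE : 0 ≤ Real.exp (|ρ 0| + (|-β| + |-γ| * C)) * (|-β| + |-γ| * C) := by positivity
  set DE := Real.exp (|ρ 0| + (|-β| + |-γ| * C)) * (|-β| + |-γ| * C)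
  set D := |β| * M + |γ| * K
  have hYb := fun s (hs : s ∈ Icc (0 : ℝ) 1) => hYH.abs_le hD hHp.le hs
  have hEb := fun s (hs : s ∈ Icc (0 : ℝ) 1) => hEH.abs_le hDE hHp.le hs
  have hconst := eq_of_increment_le_rpow (V := fun t => Y t * E t)
    (K := D * DE + (|Y 0| + D * 1 ^ H) * K1 + (|E 0| + DE * 1 ^ H) * K2)
    (θ := 2 * H) (by linarith) (fun s t hs hst ht => by
      have ms : s ∈ Icc (0 : ℝ) 1 := ⟨hs, hst.trans ht⟩
      have mt : t ∈ Icc (0 : ℝ) 1 := ⟨hs.trans hst, ht⟩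
      have hts : 0 ≤ t - s := sub_nonneg.2 hst
      have hl := hL s t hs hst ht
      have ey : (β * (∫ z in (0 : ℝ)..t, Y z) + γ * fracStieltjes α Y g t) -
          (β * (∫ z in (0 : ℝ)..s, Y z) + γ * fracStieltjes α Y g s) = Y t - Y s := by
        rw [hYeq t mt, hYeq s ms]; ring
      rw [ey] at hl
      have he := hE s t hs hst ht
      have hy' := hYH t mt s ms
      have he' := hEH t mt s ms
      rw [abs_of_nonneg hts] at hy' he'
      -- the first-order terms of `Y` and `E` cancel
      have e : Y t * E t - Y s * E s = (Y t - Y s) * (E t - E s) +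
          Y s * (E t - E s - E s * (ρ t - ρ s)) +
          E s * (Y t - Y s - Y s * (β * t + γ * g t - (β * s + γ * g s))) := by
        simp only [hρdef]; ring
      rw [e]
      refine (abs_add_three _ _ _).trans ?_
      rw [abs_mul, abs_mul, abs_mul, add_mul, add_mul]
      refine add_le_add (add_le_add ?_ ?_) ?_
      · calc |Y t - Y s| * |E t - E s| ≤ D * (t - s) ^ H * (DE * (t - s) ^ H) :=
              mul_le_mul hy' he' (abs_nonneg _) (by positivity)
          _ = D * DE * (t - s) ^ (2 * H) := by
              rw [mul_comm 2 H, Real.rpow_mul hts, Real.rpow_two]; ring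
      · rw [mul_assoc]
        exact mul_le_mul (hYb s ms) he (abs_nonneg _) (by positivity)
      · rw [mul_assoc]
        exact mul_le_mul (hEb s ms) hl (abs_nonneg _) (by positivity)) ht
  have hY0 : Y 0 = x₀ := by simpa [fracStieltjes] using hYeq 0 m0
  have hE0 : E 0 = 1 := by simp [hEdef, hρdef, hg0]
  simp only [hY0, hE0, mul_one] at hconst
  have h2 : -β * t + -γ * g t + (β * t + γ * g t) = 0 := by ring
  rw [← hconst, mul_assoc, hEdef, ← Real.exp_add, hρdef, h2, Real.exp_zero, mul_one]

/-! ### Partial Takagi–Landsberg sums as dyadic interpolation -/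

theorem faberSchauderZero_of_mem {x : ℝ} (h0 : 0 ≤ x) (h1 : x ≤ 1) :
    faberSchauderZero x = min x (1 - x) :=
  max_eq_left (le_min h0 (by linarith))

theorem faberSchauderZero_of_notMem {x : ℝ} (h : x ≤ 0 ∨ 1 ≤ x) : faberSchauderZero x = 0 := by
  refine max_eq_right ?_
  rcases h with h | h
  · exact (min_le_left _ _).trans h
  · exact (min_le_right _ _).trans (by linarith)

/-- The powers of two in the Takagi–Landsberg normalisation cancel, whatever `H` is. -/
theorem takagiLandsberg_term_eq (H : ℝ) (f : ℝ → ℝ) (n l : ℕ) (t : ℝ) :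
    (2 : ℝ) ^ ((n : ℝ) * (1 / 2 - H)) * takagiLandsbergCoeff H f n l * faberSchauder n l t =
      (2 * f (((l : ℝ) + 1 / 2) / 2 ^ n) - f (((l : ℝ) + 1) / 2 ^ n) - f ((l : ℝ) / 2 ^ n)) *
        faberSchauderZero ((2 : ℝ) ^ n * t - l) := by
  have h : (2 : ℝ) ^ ((n : ℝ) * (1 / 2 - H)) * (2 : ℝ) ^ ((n : ℝ) * H) *
      (2 : ℝ) ^ (-(n : ℝ) / 2) = 1 := by
    rw [← Real.rpow_add two_pos, ← Real.rpow_add two_pos]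
    ring_nf
    simp
  rw [takagiLandsbergCoeff, faberSchauder]
  linear_combination ((2 * f (((l : ℝ) + 1 / 2) / 2 ^ n) - f (((l : ℝ) + 1) / 2 ^ n) -
    f ((l : ℝ) / 2 ^ n)) * faberSchauderZero ((2 : ℝ) ^ n * t - l)) * h

/-- The `l`-th Faber–Schauder function of a level is the only one of that level which does not
vanish on the `l`-th dyadic interval. -/
theorem sum_faberSchauderZero (c : ℕ → ℝ) {n i : ℕ} (hi : i < 2 ^ n) {t : ℝ}
    (h0 : (i : ℝ) ≤ 2 ^ n * t) (h1 : 2 ^ n * t ≤ i + 1) :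
    ∑ l ∈ Finset.range (2 ^ n), c l * faberSchauderZero ((2 : ℝ) ^ n * t - l) =
      c i * min (2 ^ n * t - i) (1 - (2 ^ n * t - i)) := by
  rw [Finset.sum_eq_single i]
  · rw [faberSchauderZero_of_mem (by linarith) (by linarith)]
  · intro l _ hl
    rw [faberSchauderZero_of_notMem, mul_zero]
    rcases lt_or_gt_of_ne hl with h | h
    · have : (l : ℝ) + 1 ≤ i := by exact_mod_cast h
      right; linarith
    · have : (i : ℝ) + 1 ≤ l := by exact_mod_cast h
      left; linarith
  · exact fun h => absurd (Finset.mem_range.2 hi) h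

/-- The partial sum of the levels below `m` is the piecewise linear interpolation of `f` at the
multiples of `2^(-m)`. -/
theorem sum_takagiLandsberg_eq (H : ℝ) (f : ℝ → ℝ) (m : ℕ) : ∀ (i : ℕ) (_ : i < 2 ^ m) (t : ℝ)
    (_ : (i : ℝ) ≤ 2 ^ m * t) (_ : 2 ^ m * t ≤ i + 1),
    f 0 * (1 - t) + f 1 * t + ∑ n ∈ Finset.range m, ∑ l ∈ Finset.range (2 ^ n),
      (2 : ℝ) ^ ((n : ℝ) * (1 / 2 - H)) * takagiLandsbergCoeff H f n l * faberSchauder n l t =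
    f ((i : ℝ) / 2 ^ m) + (f (((i : ℝ) + 1) / 2 ^ m) - f ((i : ℝ) / 2 ^ m)) * (2 ^ m * t - i) := by
  induction m with
  | zero =>
    intro i hi t _ _
    obtain rfl : i = 0 := by simpa using hi
    simp
    ring
  | succ m ih =>
    intro i hi t h0 h1
    obtain ⟨j, hj⟩ : ∃ j, i = 2 * j ∨ i = 2 * j + 1 := ⟨i / 2, by omega⟩
    have hjm : j < 2 ^ m := by rw [pow_succ] at hi; omega
    rw [pow_succ] at h0 h1
    have hpow : (2 : ℝ) ^ m ≠ 0 := by positivity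
    have e0 : (2 * (j : ℝ)) / 2 ^ (m + 1) = j / 2 ^ m := by rw [pow_succ]; field_simp
    have e1 : (2 * (j : ℝ) + 1) / 2 ^ (m + 1) = (j + 1 / 2) / 2 ^ m := by
      rw [pow_succ]; field_simp
    have e2 : (2 * (j : ℝ) + 1 + 1) / 2 ^ (m + 1) = (j + 1) / 2 ^ m := by
      rw [pow_succ]; field_simp; ring
    rcases hj with rfl | rfl
    · push_cast at h0 h1 ⊢
      have g0 : (j : ℝ) ≤ 2 ^ m * t := by linarith
      have g1 : 2 ^ m * t ≤ (j : ℝ) + 1 := by linarith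
      rw [Finset.sum_range_succ, ← add_assoc, ih j hjm t g0 g1]
      simp only [takagiLandsberg_term_eq]
      rw [sum_faberSchauderZero _ hjm g0 g1, min_eq_left (by linarith), e0, e1, pow_succ]
      ring
    · push_cast at h0 h1 ⊢
      have g0 : (j : ℝ) ≤ 2 ^ m * t := by linarith
      have g1 : 2 ^ m * t ≤ (j : ℝ) + 1 := by linarith
      rw [Finset.sum_range_succ, ← add_assoc, ih j hjm t g0 g1]
      simp only [takagiLandsberg_term_eq]
      rw [sum_faberSchauderZero _ hjm g0 g1, min_eq_right (by linarith), e1, e2, pow_succ]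
      ring

theorem takagiLandsbergSum_eq (H : ℝ) (f : ℝ → ℝ) (p : ℕ) {i : ℕ} (hi : i < 2 ^ (p + 1)) {t : ℝ}
    (h0 : (i : ℝ) / 2 ^ (p + 1) ≤ t) (h1 : t ≤ ((i : ℝ) + 1) / 2 ^ (p + 1)) :
    takagiLandsbergSum H p f t = f ((i : ℝ) / 2 ^ (p + 1)) +
      (f (((i : ℝ) + 1) / 2 ^ (p + 1)) - f ((i : ℝ) / 2 ^ (p + 1))) * (2 ^ (p + 1) * t - i) := by
  have hN : (0 : ℝ) < 2 ^ (p + 1) := by positivity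
  rw [div_le_iff₀' hN] at h0
  rw [le_div_iff₀' hN] at h1
  exact sum_takagiLandsberg_eq H f (p + 1) i hi t h0 h1

/-- `S_p f` depends only on the values of `f` at the multiples of `2^(-(p+1))` in `[0, 1]`. -/
theorem takagiLandsbergSum_congr (H : ℝ) (p : ℕ) {f f' : ℝ → ℝ}
    (h : ∀ i : ℕ, i ≤ 2 ^ (p + 1) → f ((i : ℝ) / 2 ^ (p + 1)) = f' ((i : ℝ) / 2 ^ (p + 1))) :
    takagiLandsbergSum H p f = takagiLandsbergSum H p f' := by
  have key : ∀ n k : ℕ, n ≤ p + 1 → k ≤ 2 ^ n → f ((k : ℝ) / 2 ^ n) = f' ((k : ℝ) / 2 ^ n) := by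
    intro n k hn hk
    obtain ⟨q, hq⟩ := Nat.exists_eq_add_of_le hn
    have h2 := h (k * 2 ^ q) (by rw [hq, pow_add]; exact Nat.mul_le_mul_right _ hk)
    have e : ((k * 2 ^ q : ℕ) : ℝ) / 2 ^ (p + 1) = (k : ℝ) / 2 ^ n := by
      rw [hq, pow_add]; push_cast; field_simp
    rwa [e] at h2
  ext t
  have k0 := key 0 0 (by omega) (by omega)
  have k1 := key 0 1 (by omega) le_rfl
  simp only [Nat.cast_zero, Nat.cast_one, pow_zero, div_one] at k0 k1
  rw [takagiLandsbergSum, takagiLandsbergSum, k0, k1]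
  congr 1
  refine Finset.sum_congr rfl fun n hn => Finset.sum_congr rfl fun l hl => ?_
  have hn' : n < p + 1 := Finset.mem_range.1 hn
  have hl' : l < 2 ^ n := Finset.mem_range.1 hl
  have a1 := key (n + 1) (2 * l + 1) (by omega) (by rw [pow_succ]; omega)
  have a2 := key n (l + 1) (by omega) (by omega)
  have a3 := key n l (by omega) (by omega)
  have e : ((2 * l + 1 : ℕ) : ℝ) / 2 ^ (n + 1) = ((l : ℝ) + 1 / 2) / 2 ^ n := by
    rw [pow_succ]; push_cast; field_simp
  rw [e] at a1
  push_cast at a2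
  rw [takagiLandsbergCoeff, takagiLandsbergCoeff, a1, a2, a3]

theorem abs_faberSchauderZero_sub_le (x y : ℝ) :
    |faberSchauderZero x - faberSchauderZero y| ≤ |x - y| := by
  refine (abs_max_sub_max_le_max _ _ _ _).trans (max_le ?_ (by simp))
  refine (abs_min_sub_min_le_max _ _ _ _).trans (max_le le_rfl ?_)
  rw [sub_sub_sub_cancel_left, abs_sub_comm]

theorem exists_isHolder_finset_sum {ι : Type*} (s : Finset ι) {T η : ℝ} (F : ι → ℝ → ℝ)
    (hF : ∀ i ∈ s, ∃ C, 0 ≤ C ∧ IsHolder C η T (F i)) :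
    ∃ C, 0 ≤ C ∧ IsHolder C η T fun t => ∑ i ∈ s, F i t := by
  choose! C hC hH using hF
  refine ⟨∑ i ∈ s, C i, Finset.sum_nonneg hC, fun u hu v hv => ?_⟩
  simp only
  rw [← Finset.sum_sub_distrib, Finset.sum_mul]
  exact (Finset.abs_sum_le_sum_abs _ _).trans (Finset.sum_le_sum fun i hi => hH i hi u hu v hv)

theorem exists_isHolder_takagiLandsbergSum (H : ℝ) (p : ℕ) (f : ℝ → ℝ) :
    ∃ C, 0 ≤ C ∧ IsHolder C 1 1 (takagiLandsbergSum H p f) := by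
  obtain ⟨C, hC, hS⟩ := exists_isHolder_finset_sum (T := 1) (η := 1) (Finset.range (p + 1))
    (fun n t => ∑ l ∈ Finset.range (2 ^ n),
      (2 : ℝ) ^ ((n : ℝ) * (1 / 2 - H)) * takagiLandsbergCoeff H f n l * faberSchauder n l t)
    (fun n _ => exists_isHolder_finset_sum _ _ fun l _ => by
      set c := 2 * f (((l : ℝ) + 1 / 2) / 2 ^ n) - f (((l : ℝ) + 1) / 2 ^ n) - f ((l : ℝ) / 2 ^ n)
        with hc
      refine ⟨|c| * 2 ^ n, by positivity, fun u _ v _ => ?_⟩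
      simp only [takagiLandsberg_term_eq, ← hc]
      rw [← mul_sub, abs_mul, mul_assoc, Real.rpow_one]
      refine mul_le_mul_of_nonneg_left ((abs_faberSchauderZero_sub_le _ _).trans (le_of_eq ?_))
        (abs_nonneg _)
      rw [sub_sub_sub_cancel_right, ← mul_sub, abs_mul, abs_of_pos (by positivity)])
  refine ⟨|f 1 - f 0| + C, by positivity, fun u hu v hv => ?_⟩
  have h := hS u hu v hv
  rw [takagiLandsbergSum, takagiLandsbergSum, add_sub_add_comm, add_mul]
  refine (abs_add_le _ _).trans (add_le_add (le_of_eq ?_) h)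
  rw [Real.rpow_one, ← abs_mul]
  ring_nf

/-! ### Products of trapezoidal factors -/

/-- The increment of `ρ` over the `j`-th interval of the grid of mesh `1 / N`. -/
def gridIncrement (ρ : ℝ → ℝ) (N : ℝ) (j : ℕ) : ℝ := ρ (((j : ℝ) + 1) / N) - ρ ((j : ℝ) / N)

/-- The product of the factors `(1 + δ / 2) / (1 - δ / 2)` over the first `i` grid increments `δ`
of `ρ`, a discretisation of `exp(ρ(i / N) - ρ(0))`. -/
def gridProd (ρ : ℝ → ℝ) (N : ℝ) (i : ℕ) : ℝ :=
  ∏ j ∈ Finset.range i, (1 + gridIncrement ρ N j / 2) / (1 - gridIncrement ρ N j / 2)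

/-- The logarithm of `gridProd`. -/
def gridLog (ρ : ℝ → ℝ) (N : ℝ) (i : ℕ) : ℝ :=
  ∑ j ∈ Finset.range i,
    (Real.log (1 + gridIncrement ρ N j / 2) - Real.log (1 - gridIncrement ρ N j / 2))

theorem abs_log_ratio_sub_le {δ : ℝ} (hδ : |δ| ≤ 1) :
    |Real.log (1 + δ / 2) - Real.log (1 - δ / 2) - δ| ≤ δ ^ 2 := by
  have h2 : |δ / 2| ≤ 1 / 2 := by rw [abs_div, abs_two]; linarith
  have key : ∀ y : ℝ, |y| ≤ 1 / 2 → |y + Real.log (1 - y)| ≤ 2 * y ^ 2 := fun y hy => by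
    have h := Real.abs_log_sub_add_sum_range_le (lt_of_le_of_lt hy (by norm_num)) 1
    simp only [Finset.range_one, Finset.sum_singleton, zero_add, pow_one, Nat.cast_zero, div_one,
      one_add_one_eq_two, sq_abs] at h
    refine h.trans ?_
    rw [div_le_iff₀ (by linarith)]
    nlinarith [sq_nonneg y]
  have k1 := key (δ / 2) h2
  have k2 := key (-(δ / 2)) (by rwa [abs_neg])
  rw [sub_neg_eq_add, neg_sq] at k2
  have e : Real.log (1 + δ / 2) - Real.log (1 - δ / 2) - δ =
      (-(δ / 2) + Real.log (1 + δ / 2)) - (δ / 2 + Real.log (1 - δ / 2)) := by ring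
  rw [e]
  refine (abs_sub _ _).trans ((add_le_add k2 k1).trans (le_of_eq ?_))
  ring

section Grid

variable {ρ : ℝ → ℝ} {N R H : ℝ}

theorem abs_gridIncrement_le (hρ : IsHolder R H 1 ρ) (hN : 0 < N) {j : ℕ} (hj : (j : ℝ) + 1 ≤ N) :
    |gridIncrement ρ N j| ≤ R * N ^ (-H) := by
  have h := hρ (((j : ℝ) + 1) / N) ⟨by positivity, by rwa [div_le_one hN]⟩ ((j : ℝ) / N)
    ⟨by positivity, by rw [div_le_one hN]; linarith⟩
  rwa [← sub_div, add_sub_cancel_left, abs_of_pos (show 0 < 1 / N by positivity), one_div,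
    Real.inv_rpow hN.le, ← Real.rpow_neg hN.le] at h

theorem gridProd_eq_exp (h : ∀ j : ℕ, (j : ℝ) + 1 ≤ N → |gridIncrement ρ N j| ≤ 1) {i : ℕ}
    (hi : (i : ℝ) ≤ N) : gridProd ρ N i = Real.exp (gridLog ρ N i) := by
  rw [gridProd, gridLog, Real.exp_sum]
  refine Finset.prod_congr rfl fun j hj => ?_
  have hj' : (j : ℝ) + 1 ≤ i := by exact_mod_cast Finset.mem_range.1 hj
  obtain ⟨h1, h2⟩ := _root_.abs_le.1 (h j (hj'.trans hi))
  rw [Real.exp_sub, Real.exp_log (by linarith), Real.exp_log (by linarith)]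

theorem abs_gridLog_sub_sub_le (hρ : IsHolder R H 1 ρ) (hN : 0 < N) (hRN : R * N ^ (-H) ≤ 1)
    {i k : ℕ} (hik : i ≤ k) (hk : (k : ℝ) ≤ N) :
    |gridLog ρ N k - gridLog ρ N i - (ρ ((k : ℝ) / N) - ρ ((i : ℝ) / N))| ≤
      R ^ 2 * N ^ (1 - 2 * H) * ((k : ℝ) / N - (i : ℝ) / N) := by
  have e1 : ∀ m : ℕ, gridLog ρ N m - ρ ((m : ℝ) / N) = -ρ 0 + ∑ j ∈ Finset.range m,
      (Real.log (1 + gridIncrement ρ N j / 2) - Real.log (1 - gridIncrement ρ N j / 2) -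
        gridIncrement ρ N j) := fun m => by
    have h := Finset.sum_range_sub (fun j : ℕ => ρ ((j : ℝ) / N)) m
    simp only [Nat.cast_zero, zero_div, Nat.cast_succ] at h
    rw [Finset.sum_sub_distrib, gridLog]
    simp only [gridIncrement] at h ⊢
    rw [h]
    ring
  have e2 : gridLog ρ N k - gridLog ρ N i - (ρ ((k : ℝ) / N) - ρ ((i : ℝ) / N)) =
      ∑ j ∈ Finset.Ico i k, (Real.log (1 + gridIncrement ρ N j / 2) -
        Real.log (1 - gridIncrement ρ N j / 2) - gridIncrement ρ N j) := by
    rw [Finset.sum_Ico_eq_sub _ hik]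
    linarith [e1 k, e1 i]
  have hb : ∀ j ∈ Finset.Ico i k, |Real.log (1 + gridIncrement ρ N j / 2) -
      Real.log (1 - gridIncrement ρ N j / 2) - gridIncrement ρ N j| ≤ (R * N ^ (-H)) ^ 2 := by
    intro j hj
    have hj' : (j : ℝ) + 1 ≤ k := by exact_mod_cast (Finset.mem_Ico.1 hj).2
    have h := abs_gridIncrement_le hρ hN (hj'.trans hk)
    refine (abs_log_ratio_sub_le (h.trans hRN)).trans ?_
    rw [← sq_abs]
    exact pow_le_pow_left₀ (abs_nonneg _) h 2
  rw [e2]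
  refine (Finset.abs_sum_le_sum_abs _ _).trans
    ((Finset.sum_le_card_nsmul _ _ _ hb).trans (le_of_eq ?_))
  rw [Nat.card_Ico, nsmul_eq_mul, Nat.cast_sub hik, mul_pow, ← Real.rpow_two (N ^ (-H)),
    ← Real.rpow_mul hN.le, show 1 - 2 * H = -H * 2 + 1 by ring, Real.rpow_add_one hN.ne']
  field_simp

theorem rpow_one_sub_two_mul_le_one (hN : 1 ≤ N) (hH : 1 / 2 < H) : N ^ (1 - 2 * H) ≤ 1 :=
  Real.rpow_le_one_of_one_le_of_nonpos hN (by linarith)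

/-- The logarithm of the trapezoidal product inherits the Hölder bound of `ρ` on the grid. -/
theorem abs_gridLog_sub_le (hρ : IsHolder R H 1 ρ) (hN : 1 ≤ N) (hRN : R * N ^ (-H) ≤ 1)
    (hH : 1 / 2 < H) (hH1 : H < 1) {i k : ℕ} (hik : i ≤ k) (hk : (k : ℝ) ≤ N) :
    |gridLog ρ N k - gridLog ρ N i| ≤ (R + R ^ 2) * ((k : ℝ) / N - (i : ℝ) / N) ^ H := by
  have hN0 : 0 < N := by linarith
  have hik' : (i : ℝ) ≤ k := Nat.cast_le.2 hik
  have hd : 0 ≤ (k : ℝ) / N - (i : ℝ) / N := by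
    rw [← sub_div]
    exact div_nonneg (sub_nonneg.2 hik') hN0.le
  have hk1 : (k : ℝ) / N ≤ 1 := (div_le_one hN0).2 hk
  have hi0 : 0 ≤ (i : ℝ) / N := by positivity
  have h1 := abs_gridLog_sub_sub_le hρ hN0 hRN hik hk
  have h2 := hρ ((k : ℝ) / N) ⟨by positivity, hk1⟩ ((i : ℝ) / N) ⟨hi0, by linarith⟩
  rw [abs_of_nonneg hd] at h2
  set d := (k : ℝ) / N - (i : ℝ) / N
  have h3 : d ≤ d ^ H := by
    rcases hd.eq_or_lt with h | h
    · rw [← h, Real.zero_rpow (by linarith)]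
    · calc d = d ^ (1 : ℝ) := (Real.rpow_one _).symm
        _ ≤ _ := Real.rpow_le_rpow_of_exponent_ge h (by linarith) hH1.le
  have h4 : R ^ 2 * N ^ (1 - 2 * H) * d ≤ R ^ 2 * d ^ H := by
    rw [mul_assoc]
    refine mul_le_mul_of_nonneg_left ?_ (sq_nonneg R)
    exact (mul_le_of_le_one_left hd (rpow_one_sub_two_mul_le_one hN hH)).trans h3
  have e : gridLog ρ N k - gridLog ρ N i = (gridLog ρ N k - gridLog ρ N i -
    (ρ ((k : ℝ) / N) - ρ ((i : ℝ) / N))) + (ρ ((k : ℝ) / N) - ρ ((i : ℝ) / N)) := by ring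
  rw [e]
  refine (abs_add_le _ _).trans ?_
  linarith

theorem abs_gridLog_le (hρ : IsHolder R H 1 ρ) (hR : 0 ≤ R) (hN : 1 ≤ N)
    (hRN : R * N ^ (-H) ≤ 1) (hH : 1 / 2 < H) (hH1 : H < 1) {i : ℕ} (hi : (i : ℝ) ≤ N) :
    |gridLog ρ N i| ≤ R + R ^ 2 := by
  have hN0 : 0 < N := by linarith
  have h := abs_gridLog_sub_le hρ hN hRN hH hH1 (Nat.zero_le i) hi
  have h0 : gridLog ρ N 0 = 0 := by simp [gridLog]
  rw [h0, sub_zero, Nat.cast_zero, zero_div, sub_zero] at h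
  exact h.trans (mul_le_of_le_one_right (by positivity)
    (Real.rpow_le_one (by positivity) ((div_le_one hN0).2 hi) (by linarith)))

theorem abs_gridProd_le (hρ : IsHolder R H 1 ρ) (hR : 0 ≤ R) (hN : 1 ≤ N)
    (hRN : R * N ^ (-H) ≤ 1) (hH : 1 / 2 < H) (hH1 : H < 1) {i : ℕ} (hi : (i : ℝ) ≤ N) :
    |gridProd ρ N i| ≤ Real.exp (R + R ^ 2) := by
  rw [gridProd_eq_exp (fun j hj => (abs_gridIncrement_le hρ (by linarith) hj).trans hRN) hi,
    abs_of_pos (Real.exp_pos _)]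
  exact Real.exp_le_exp.2 ((le_abs_self _).trans (abs_gridLog_le hρ hR hN hRN hH hH1 hi))

theorem abs_gridProd_sub_le (hρ : IsHolder R H 1 ρ) (hR : 0 ≤ R) (hN : 1 ≤ N)
    (hRN : R * N ^ (-H) ≤ 1) (hH : 1 / 2 < H) (hH1 : H < 1) {i k : ℕ} (hik : i ≤ k)
    (hk : (k : ℝ) ≤ N) : |gridProd ρ N k - gridProd ρ N i| ≤
      Real.exp (R + R ^ 2) * (R + R ^ 2) * ((k : ℝ) / N - (i : ℝ) / N) ^ H := by
  have hi : (i : ℝ) ≤ N := (Nat.cast_le.2 hik).trans hk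
  have hinc := fun (j : ℕ) (hj : (j : ℝ) + 1 ≤ N) =>
    (abs_gridIncrement_le hρ (by linarith) hj).trans hRN
  have hb := fun (i : ℕ) (hi : (i : ℝ) ≤ N) =>
    (le_abs_self _).trans (abs_gridLog_le hρ hR hN hRN hH hH1 hi)
  rw [gridProd_eq_exp hinc hi, gridProd_eq_exp hinc hk, mul_assoc]
  exact (abs_exp_sub_exp_le (hb k hk) (hb i hi)).trans
    (mul_le_mul_of_nonneg_left (abs_gridLog_sub_le hρ hN hRN hH hH1 hik hk) (Real.exp_pos _).le)

/-- The trapezoidal product approximates the exponential: every factor is `exp(δ + O(δ²))`, and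
the sum of the squared increments is of order `N^(1-2H)`. -/
theorem abs_gridProd_sub_exp_le (hρ : IsHolder R H 1 ρ) (hR : 0 ≤ R) (hN : 1 ≤ N)
    (hRN : R * N ^ (-H) ≤ 1) (hH : 1 / 2 < H) (hH1 : H < 1) (h0 : ρ 0 = 0) {i : ℕ}
    (hi : (i : ℝ) ≤ N) : |gridProd ρ N i - Real.exp (ρ ((i : ℝ) / N))| ≤
      Real.exp (R + R ^ 2) * (R ^ 2 * N ^ (1 - 2 * H)) := by
  have hN0 : 0 < N := by linarith
  have hi1 : (i : ℝ) / N ≤ 1 := (div_le_one hN0).2 hi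
  have h1 := abs_gridLog_sub_sub_le hρ hN0 hRN (Nat.zero_le i) hi
  have hz : gridLog ρ N 0 = 0 := by simp [gridLog]
  rw [hz, sub_zero, Nat.cast_zero, zero_div, sub_zero, h0, sub_zero] at h1
  have h2 : ρ ((i : ℝ) / N) ≤ R + R ^ 2 := by
    have h := (le_abs_self _).trans (hρ.abs_le hR (by linarith)
      (t := (i : ℝ) / N) ⟨by positivity, hi1⟩)
    rw [h0, abs_zero, zero_add, Real.one_rpow, mul_one] at h
    nlinarith [sq_nonneg R]
  rw [gridProd_eq_exp (fun j hj => (abs_gridIncrement_le hρ hN0 hj).trans hRN) hi]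
  refine (abs_exp_sub_exp_le ((le_abs_self _).trans (abs_gridLog_le hρ hR hN hRN hH hH1 hi))
    h2).trans (mul_le_mul_of_nonneg_left (h1.trans ?_) (Real.exp_pos _).le)
  exact mul_le_of_le_one_right (by positivity) hi1

end Grid

/-! ### The truncated equation -/

/-- The right-hand side of the truncated equation, with the function `f` of which only the values
on the dyadic grid enter. -/
def truncatedRhs (H α β γ x₀ : ℝ) (g : ℝ → ℝ) (p : ℕ) (f : ℝ → ℝ) (t : ℝ) : ℝ :=
  x₀ + β * (∫ z in (0 : ℝ)..t, takagiLandsbergSum H p f z) +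
    γ * fracStieltjes α (takagiLandsbergSum H p f) (takagiLandsbergSum H p g) t

theorem truncatedRhs_zero (H α β γ x₀ : ℝ) (g : ℝ → ℝ) (p : ℕ) (f : ℝ → ℝ) :
    truncatedRhs H α β γ x₀ g p f 0 = x₀ := by
  simp [truncatedRhs, fracStieltjes]

theorem continuousOn_takagiLandsbergSum (H : ℝ) (p : ℕ) (f : ℝ → ℝ) :
    ContinuousOn (takagiLandsbergSum H p f) (Icc 0 1) := by
  obtain ⟨C, _, hf⟩ := exists_isHolder_takagiLandsbergSum H p f
  exact hf.continuousOn one_pos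

theorem succ_le_two_pow {i m : ℕ} (hi : i < 2 ^ m) : (i : ℝ) + 1 ≤ 2 ^ m := by
  exact_mod_cast hi

/-- On a cell of the dyadic grid the integrator `S_p g` is affine, so both integrals in the
truncated equation are multiples of `∫ S_p f dz`. -/
theorem truncatedRhs_sub {H α : ℝ} (β γ x₀ : ℝ) (h0 : 0 < α) (h1 : α < 1) (g : ℝ → ℝ) (p : ℕ)
    (f : ℝ → ℝ) {i : ℕ} (hi : i < 2 ^ (p + 1)) {t : ℝ} (ht0 : (i : ℝ) / 2 ^ (p + 1) ≤ t)
    (ht1 : t ≤ ((i : ℝ) + 1) / 2 ^ (p + 1)) :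
    truncatedRhs H α β γ x₀ g p f t - truncatedRhs H α β γ x₀ g p f ((i : ℝ) / 2 ^ (p + 1)) =
      2 ^ (p + 1) * gridIncrement (fun t => β * t + γ * g t) (2 ^ (p + 1)) i *
        ∫ z in (i : ℝ) / 2 ^ (p + 1)..t, takagiLandsbergSum H p f z := by
  have hN : (0 : ℝ) < 2 ^ (p + 1) := by positivity
  have hi' := succ_le_two_pow hi
  set N : ℝ := 2 ^ (p + 1) with hNdef
  set s : ℝ := (i : ℝ) / N with hs
  have hs0 : 0 ≤ s := by positivity
  have hr1 : ((i : ℝ) + 1) / N ≤ 1 := (div_le_one hN).2 hi'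
  have ht : t ≤ 1 := ht1.trans hr1
  set F := takagiLandsbergSum H p f
  set G := takagiLandsbergSum H p g
  obtain ⟨C, hC, hF⟩ := exists_isHolder_takagiLandsbergSum H p f
  obtain ⟨D, hD, hGh⟩ := exists_isHolder_takagiLandsbergSum H p g
  have hreg := hF.fracRegular hC h0 h1
  have hFi : ∀ a ∈ Icc (0 : ℝ) 1, IntervalIntegrable F volume 0 a := fun a ha =>
    (intervalIntegrable_iff_integrableOn_Ioc_of_le ha.1).2 (hreg.mono ha.2).integrableOn
  have eI : (∫ z in (0 : ℝ)..t, F z) - ∫ z in (0 : ℝ)..s, F z = ∫ z in s..t, F z :=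
    intervalIntegral.integral_interval_sub_left (hFi t ⟨hs0.trans ht0, ht⟩)
      (hFi s ⟨hs0, ht0.trans ht⟩)
  set c : ℝ := N * (g (((i : ℝ) + 1) / N) - g s) with hc
  have eS : fracStieltjes α F G t - fracStieltjes α F G s = c * ∫ z in s..t, F z := by
    rw [hreg.fracStieltjes_sub h0 h1 (by linarith) hD hGh hs0 ht0 ht,
      ((hreg.mono ht).shift hs0).fracStieltjes_of_deriv h0 h1 (sub_nonneg.2 ht0)
        (w := fun _ => c) continuous_const]
    · rw [intervalIntegral.integral_mul_const, intervalIntegral.integral_comp_add_left F, add_zero,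
        add_sub_cancel, mul_comm]
    · intro a ha
      have hNs : N * s = i := by rw [hs]; field_simp
      rw [takagiLandsbergSum_eq H g p hi (t := s + (t - s)) (by linarith) (by linarith),
        takagiLandsbergSum_eq H g p hi (t := s + a) (by linarith [ha.1])
          (by linarith [ha.2]), intervalIntegral.integral_const, smul_eq_mul]
      simp only [← hNdef, ← hs]
      rw [hc]
      ring
  have e1 : N * gridIncrement (fun t => β * t + γ * g t) N i = β + γ * c := by
    rw [gridIncrement, hc, hs]
    field_simp
    ring
  rw [e1, truncatedRhs, truncatedRhs, add_mul, ← eI, mul_assoc γ, eI, ← eS, ← eI]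
  ring

theorem integral_takagiLandsbergSum_cell (H : ℝ) (f : ℝ → ℝ) (p : ℕ) {i : ℕ}
    (hi : i < 2 ^ (p + 1)) :
    2 ^ (p + 1) * ∫ z in (i : ℝ) / 2 ^ (p + 1)..((i : ℝ) + 1) / 2 ^ (p + 1),
      takagiLandsbergSum H p f z =
    (f ((i : ℝ) / 2 ^ (p + 1)) + f (((i : ℝ) + 1) / 2 ^ (p + 1))) / 2 := by
  have hN : (0 : ℝ) < 2 ^ (p + 1) := by positivity
  set N : ℝ := 2 ^ (p + 1) with hNdef
  set a := f ((i : ℝ) / N)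
  set b := f (((i : ℝ) + 1) / N)
  have hle : (i : ℝ) / N ≤ ((i : ℝ) + 1) / N := by gcongr; simp
  have e : ∫ z in (i : ℝ) / N..((i : ℝ) + 1) / N, takagiLandsbergSum H p f z =
      ∫ z in (i : ℝ) / N..((i : ℝ) + 1) / N, (a + (b - a) * (N * z - i)) :=
    intervalIntegral.integral_congr fun z hz => by
      rw [uIcc_of_le hle] at hz
      exact takagiLandsbergSum_eq H f p hi hz.1 hz.2
  have hd : ∀ z ∈ uIcc ((i : ℝ) / N) (((i : ℝ) + 1) / N), HasDerivAt
      (fun z => a * z + (b - a) / (2 * N) * (N * z - i) ^ 2) (a + (b - a) * (N * z - i)) z := by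
    intro z _
    have h1 : HasDerivAt (fun z : ℝ => N * z - i) N z := by
      simpa using ((hasDerivAt_id z).const_mul N).sub_const (i : ℝ)
    have h2 := ((hasDerivAt_id z).const_mul a).add ((h1.pow 2).const_mul ((b - a) / (2 * N)))
    refine h2.congr_deriv ?_
    simp only [Nat.cast_ofNat]
    field_simp
    ring
  rw [e, intervalIntegral.integral_eq_sub_of_hasDerivAt hd
    ((by fun_prop : Continuous fun z => a + (b - a) * (N * z - i)).intervalIntegrable _ _)]
  field_simp
  ring

/-- The trapezoidal recursion satisfied by the right-hand side on the grid. -/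
theorem truncatedRhs_grid_succ {H α : ℝ} (β γ x₀ : ℝ) (h0 : 0 < α) (h1 : α < 1) (g : ℝ → ℝ)
    (p : ℕ) (f : ℝ → ℝ) {i : ℕ} (hi : i < 2 ^ (p + 1)) :
    truncatedRhs H α β γ x₀ g p f (((i : ℝ) + 1) / 2 ^ (p + 1)) =
      truncatedRhs H α β γ x₀ g p f ((i : ℝ) / 2 ^ (p + 1)) +
        gridIncrement (fun t => β * t + γ * g t) (2 ^ (p + 1)) i *
          ((f ((i : ℝ) / 2 ^ (p + 1)) + f (((i : ℝ) + 1) / 2 ^ (p + 1))) / 2) := by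
  have hle : (i : ℝ) / 2 ^ (p + 1) ≤ ((i : ℝ) + 1) / 2 ^ (p + 1) := by gcongr; simp
  have h := truncatedRhs_sub (H := H) β γ x₀ h0 h1 g p f hi hle le_rfl
  rw [← integral_takagiLandsbergSum_cell H f p hi]
  linear_combination h

/-- `gridProd` satisfies the trapezoidal recursion `x_{i+1} = x_i + δ_i (x_i + x_{i+1}) / 2`. -/
theorem gridProd_succ {ρ : ℝ → ℝ} {N : ℝ} {i : ℕ} (h : |gridIncrement ρ N i| ≤ 1) :
    gridProd ρ N (i + 1) = gridProd ρ N i +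
      gridIncrement ρ N i * ((gridProd ρ N i + gridProd ρ N (i + 1)) / 2) := by
  have h2 : 1 - gridIncrement ρ N i / 2 ≠ 0 := by
    have := (_root_.abs_le.1 h).2
    intro h3
    linarith
  have h3 : 2 - gridIncrement ρ N i ≠ 0 := fun h4 => h2 (by linarith)
  have e : gridProd ρ N (i + 1) = gridProd ρ N i *
      ((1 + gridIncrement ρ N i / 2) / (1 - gridIncrement ρ N i / 2)) := by
    rw [gridProd, Finset.prod_range_succ, gridProd]
  rw [e]
  field_simp
  ring

section Truncated

variable {H α β γ x₀ : ℝ} {g : ℝ → ℝ} {p : ℕ}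

/-- The values of a solution on the grid are forced by the trapezoidal recursion. -/
theorem IsTruncatedSolution.apply_grid (h0 : 0 < α) (h1 : α < 1)
    (hδ : ∀ i : ℕ, i < 2 ^ (p + 1) →
      |gridIncrement (fun t => β * t + γ * g t) (2 ^ (p + 1)) i| ≤ 1)
    {Y : ℝ → ℝ} (hY : IsTruncatedSolution H α β γ x₀ g p Y) (i : ℕ) (hi : i ≤ 2 ^ (p + 1)) :
    Y ((i : ℝ) / 2 ^ (p + 1)) =
      x₀ * gridProd (fun t => β * t + γ * g t) (2 ^ (p + 1)) i := by
  have hN : (0 : ℝ) < 2 ^ (p + 1) := by positivity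
  have hY' : ∀ t ∈ Icc (0 : ℝ) 1, Y t = truncatedRhs H α β γ x₀ g p Y t := hY
  induction i with
  | zero =>
    rw [Nat.cast_zero, zero_div, hY' 0 ⟨le_rfl, zero_le_one⟩, truncatedRhs_zero]
    simp [gridProd]
  | succ i ih =>
    have hi' : i < 2 ^ (p + 1) := hi
    have ih' := ih hi'.le
    have hr := succ_le_two_pow hi'
    have h2 := truncatedRhs_grid_succ (H := H) β γ x₀ h0 h1 g p Y hi'
    rw [← hY' _ ⟨by positivity, (div_le_one hN).2 hr⟩,
      ← hY' _ ⟨by positivity, (div_le_one hN).2 (by linarith)⟩, ih'] at h2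
    have h3 := gridProd_succ (hδ i hi')
    have h4 := (_root_.abs_le.1 (hδ i hi')).2
    rw [Nat.cast_succ]
    set δ := gridIncrement (fun t => β * t + γ * g t) (2 ^ (p + 1)) i
    have h5 : 1 - δ / 2 ≠ 0 := by
      intro h; linarith
    refine mul_left_cancel₀ h5 ?_
    linear_combination h2 - x₀ * h3

theorem IsTruncatedSolution.eqOn (h0 : 0 < α) (h1 : α < 1)
    (hδ : ∀ i : ℕ, i < 2 ^ (p + 1) →
      |gridIncrement (fun t => β * t + γ * g t) (2 ^ (p + 1)) i| ≤ 1)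
    {Y Z : ℝ → ℝ} (hY : IsTruncatedSolution H α β γ x₀ g p Y)
    (hZ : IsTruncatedSolution H α β γ x₀ g p Z) : EqOn Y Z (Icc 0 1) := by
  intro t ht
  rw [hY t ht, hZ t ht, takagiLandsbergSum_congr H p (f := Y) (f' := Z) fun i hi => by
    rw [hY.apply_grid h0 h1 hδ i hi, hZ.apply_grid h0 h1 hδ i hi]]

/-- The right-hand side evaluated at any interpolant of the trapezoidal recursion reproduces its grid
values, hence is a solution. -/
theorem exists_isTruncatedSolution (h0 : 0 < α) (h1 : α < 1)
    (hδ : ∀ i : ℕ, i < 2 ^ (p + 1) →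
      |gridIncrement (fun t => β * t + γ * g t) (2 ^ (p + 1)) i| ≤ 1) :
    ∃ Z, IsTruncatedSolution H α β γ x₀ g p Z := by
  have hN : (0 : ℝ) < 2 ^ (p + 1) := by positivity
  set ρ : ℝ → ℝ := fun t => β * t + γ * g t
  -- any function with the values forced by the recursion on the grid
  set W : ℝ → ℝ := fun t => x₀ * gridProd ρ (2 ^ (p + 1)) ⌊2 ^ (p + 1) * t⌋₊ with hWdef
  have hW : ∀ i : ℕ, W ((i : ℝ) / 2 ^ (p + 1)) = x₀ * gridProd ρ (2 ^ (p + 1)) i := fun i => by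
    simp only [hWdef]
    rw [mul_div_cancel₀ _ hN.ne', Nat.floor_natCast]
  have hgrid : ∀ i : ℕ, i ≤ 2 ^ (p + 1) →
      truncatedRhs H α β γ x₀ g p W ((i : ℝ) / 2 ^ (p + 1)) = W ((i : ℝ) / 2 ^ (p + 1)) := by
    intro i
    induction i with
    | zero =>
      intro _
      rw [hW, Nat.cast_zero, zero_div, truncatedRhs_zero]
      simp [gridProd]
    | succ i ih =>
      intro hi
      have h2 := truncatedRhs_grid_succ (H := H) β γ x₀ h0 h1 g p W (i := i) hi
      have h3 := gridProd_succ (hδ i hi)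
      have h4 := hW (i + 1)
      rw [Nat.cast_succ] at h4 ⊢
      rw [h2, ih (Nat.le_of_succ_le hi), h4, hW]
      linear_combination -x₀ * h3
  refine ⟨truncatedRhs H α β γ x₀ g p W, fun t _ => ?_⟩
  rw [takagiLandsbergSum_congr H p hgrid, truncatedRhs]

theorem exists_cell (m : ℕ) {t : ℝ} (ht : t ∈ Icc (0 : ℝ) 1) :
    ∃ i : ℕ, i < 2 ^ m ∧ (i : ℝ) / 2 ^ m ≤ t ∧ t ≤ ((i : ℝ) + 1) / 2 ^ m := by
  have hN : (0 : ℝ) < 2 ^ m := by positivity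
  rcases ht.2.eq_or_lt with rfl | h1
  · have h : 0 < 2 ^ m := by positivity
    have e : ((2 ^ m - 1 : ℕ) : ℝ) = 2 ^ m - 1 := by
      rw [Nat.cast_sub h]; push_cast; ring
    refine ⟨2 ^ m - 1, by omega, ?_, ?_⟩
    · rw [e, div_le_one hN]; linarith
    · rw [e, sub_add_cancel, div_self hN.ne']
  · have h0 : 0 ≤ 2 ^ m * t := mul_nonneg hN.le ht.1
    refine ⟨⌊2 ^ m * t⌋₊, ?_, ?_, ?_⟩
    · rw [Nat.floor_lt h0]
      push_cast
      nlinarith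
    · rw [div_le_iff₀' hN]
      exact Nat.floor_le h0
    · rw [le_div_iff₀' hN]
      exact (Nat.lt_floor_add_one _).le

variable {R : ℝ}

/-- A solution of the truncated equation is Hölder continuous of order `H` on every grid cell, with
a constant that does not depend on `p`. -/
theorem IsTruncatedSolution.abs_sub_le_of_cell (h0 : 0 < α) (h1 : α < 1) (hH : 1 / 2 < H)
    (hH1 : H < 1) (hR : 0 ≤ R) (hρ : IsHolder R H 1 fun t => β * t + γ * g t)
    (hRN : R * ((2 : ℝ) ^ (p + 1)) ^ (-H) ≤ 1) {Y : ℝ → ℝ}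
    (hY : IsTruncatedSolution H α β γ x₀ g p Y) {i : ℕ} (hi : i < 2 ^ (p + 1)) {s t : ℝ}
    (hs : (i : ℝ) / 2 ^ (p + 1) ≤ s) (hst : s ≤ t) (ht : t ≤ ((i : ℝ) + 1) / 2 ^ (p + 1)) :
    |Y t - Y s| ≤ R * (|x₀| * Real.exp (R + R ^ 2)) * (t - s) ^ H := by
  have hN : (0 : ℝ) < 2 ^ (p + 1) := by positivity
  have hN1 : (1 : ℝ) ≤ 2 ^ (p + 1) := one_le_pow₀ (by norm_num)
  have hi' := succ_le_two_pow hi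
  have hδ : ∀ i : ℕ, i < 2 ^ (p + 1) →
      |gridIncrement (fun t => β * t + γ * g t) (2 ^ (p + 1)) i| ≤ 1 := fun j hj =>
    (abs_gridIncrement_le hρ hN (succ_le_two_pow hj)).trans hRN
  have hgridv : ∀ j : ℕ, j ≤ 2 ^ (p + 1) →
      |Y ((j : ℝ) / 2 ^ (p + 1))| ≤ |x₀| * Real.exp (R + R ^ 2) := fun j hj => by
    rw [hY.apply_grid h0 h1 hδ j hj, abs_mul]
    exact mul_le_mul_of_nonneg_left
      (abs_gridProd_le hρ hR hN1 hRN hH hH1 (by exact_mod_cast hj)) (abs_nonneg _)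
  have hv0 := hgridv i hi.le
  have hv1 := hgridv (i + 1) hi
  rw [Nat.cast_succ] at hv1
  have hdi := abs_gridIncrement_le hρ hN hi'
  set δ := gridIncrement (fun t => β * t + γ * g t) (2 ^ (p + 1)) i
  set B := |x₀| * Real.exp (R + R ^ 2)
  set Z := takagiLandsbergSum H p Y with hZ
  have hZB : ∀ z, (i : ℝ) / 2 ^ (p + 1) ≤ z → z ≤ ((i : ℝ) + 1) / 2 ^ (p + 1) → |Z z| ≤ B := by
    intro z hz0 hz1
    rw [hZ, takagiLandsbergSum_eq H Y p hi hz0 hz1]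
    rw [div_le_iff₀' hN] at hz0
    rw [le_div_iff₀' hN] at hz1
    obtain ⟨a1, a2⟩ := _root_.abs_le.1 hv0
    obtain ⟨b1, b2⟩ := _root_.abs_le.1 hv1
    rw [_root_.abs_le]
    constructor <;> nlinarith
  have hi0 : 0 ≤ (i : ℝ) / 2 ^ (p + 1) := by positivity
  have hr1 : ((i : ℝ) + 1) / 2 ^ (p + 1) ≤ 1 := (div_le_one hN).2 hi'
  have hY' : ∀ t ∈ Icc (0 : ℝ) 1, Y t = truncatedRhs H α β γ x₀ g p Y t := hY
  have e1 := truncatedRhs_sub (H := H) β γ x₀ h0 h1 g p Y hi (hs.trans hst) ht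
  have e2 := truncatedRhs_sub (H := H) β γ x₀ h0 h1 g p Y hi hs (hst.trans ht)
  have hZi : ∀ z, (i : ℝ) / 2 ^ (p + 1) ≤ z → z ≤ 1 →
      IntervalIntegrable Z volume ((i : ℝ) / 2 ^ (p + 1)) z := fun z hz0 hz1 =>
    ((continuousOn_takagiLandsbergSum H p Y).mono
      (uIcc_subset_Icc ⟨hi0, hz0.trans hz1⟩ ⟨hi0.trans hz0, hz1⟩)).intervalIntegrable
  have hst' := intervalIntegral.integral_interval_sub_left (hZi t (hs.trans hst) (ht.trans hr1))
    (hZi s hs ((hst.trans ht).trans hr1))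
  have e : Y t - Y s = 2 ^ (p + 1) * δ * ∫ z in s..t, Z z := by
    rw [hY' t ⟨hi0.trans (hs.trans hst), ht.trans hr1⟩,
      hY' s ⟨hi0.trans hs, (hst.trans ht).trans hr1⟩, ← hst']
    linear_combination e1 - e2
  have hts : 0 ≤ t - s := sub_nonneg.2 hst
  have hI := intervalIntegral.norm_integral_le_of_norm_le_const (a := s) (b := t) (f := Z) (C := B)
    (fun z hz => by
      rw [uIoc_of_le hst] at hz
      exact hZB z (hs.trans hz.1.le) (hz.2.trans ht))
  rw [Real.norm_eq_abs, abs_of_nonneg hts] at hI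
  have hd1 : 2 ^ (p + 1) * (t - s) ≤ 1 := by
    rw [le_div_iff₀' hN] at ht
    rw [div_le_iff₀' hN] at hs
    linarith
  rcases hts.eq_or_lt with h | h
  · obtain rfl : s = t := by linarith
    simp [Real.zero_rpow (show H ≠ 0 by linarith)]
  -- the slope on the cell is of order `N^(1-H)`, and `N (t - s) ≤ 1`
  have hkey : (2 : ℝ) ^ (p + 1) * ((2 : ℝ) ^ (p + 1)) ^ (-H) * (t - s) ≤ (t - s) ^ H := by
    have e3 : (2 : ℝ) ^ (p + 1) * ((2 : ℝ) ^ (p + 1)) ^ (-H) * (t - s) =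
        (2 ^ (p + 1) * (t - s)) ^ (1 - H) * (t - s) ^ H := by
      rw [Real.mul_rpow hN.le hts, mul_assoc _ ((t - s) ^ (1 - H)), ← Real.rpow_add h,
        sub_add_cancel, Real.rpow_one, show 1 - H = -H + 1 by ring,
        Real.rpow_add_one hN.ne']
      ring
    rw [e3]
    exact mul_le_of_le_one_left (by positivity)
      (Real.rpow_le_one (by positivity) hd1 (by linarith))
  have hB : 0 ≤ B := by positivity
  rw [e, abs_mul, abs_mul, abs_of_pos hN]
  calc 2 ^ (p + 1) * |δ| * |∫ z in s..t, Z z|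
      ≤ 2 ^ (p + 1) * (R * ((2 : ℝ) ^ (p + 1)) ^ (-H)) * (B * (t - s)) := by gcongr
    _ = R * B * ((2 : ℝ) ^ (p + 1) * ((2 : ℝ) ^ (p + 1)) ^ (-H) * (t - s)) := by ring
    _ ≤ R * B * (t - s) ^ H := by gcongr

theorem IsTruncatedSolution.isHolder (h0 : 0 < α) (h1 : α < 1) (hH : 1 / 2 < H)
    (hH1 : H < 1) (hR : 0 ≤ R) (hρ : IsHolder R H 1 fun t => β * t + γ * g t)
    (hRN : R * ((2 : ℝ) ^ (p + 1)) ^ (-H) ≤ 1) {Y : ℝ → ℝ}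
    (hY : IsTruncatedSolution H α β γ x₀ g p Y) :
    IsHolder (|x₀| * Real.exp (R + R ^ 2) * (3 * R + R ^ 2)) H 1 Y := by
  have hN : (0 : ℝ) < 2 ^ (p + 1) := by positivity
  have hN1 : (1 : ℝ) ≤ 2 ^ (p + 1) := one_le_pow₀ (by norm_num)
  have hHp : 0 < H := by linarith
  intro t ht s hs
  wlog hst : s ≤ t generalizing s t
  · rw [abs_sub_comm, abs_sub_comm t s]
    exact this s hs t ht (le_of_not_ge hst)
  rw [abs_of_nonneg (sub_nonneg.2 hst)]
  have hδ : ∀ i : ℕ, i < 2 ^ (p + 1) →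
      |gridIncrement (fun t => β * t + γ * g t) (2 ^ (p + 1)) i| ≤ 1 := fun j hj =>
    (abs_gridIncrement_le hρ hN (succ_le_two_pow hj)).trans hRN
  obtain ⟨i, hi, hi0, hi1⟩ := exists_cell (p + 1) hs
  obtain ⟨k, hk, hk0, hk1⟩ := exists_cell (p + 1) ht
  set B := |x₀| * Real.exp (R + R ^ 2) with hB
  have hB0 : 0 ≤ B := by positivity
  have hP : 0 ≤ (t - s) ^ H := Real.rpow_nonneg (sub_nonneg.2 hst) _
  rcases lt_or_ge i k with hik | hik
  · have hik' : i + 1 ≤ k := hik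
    have hle : ((i : ℝ) + 1) / 2 ^ (p + 1) ≤ (k : ℝ) / 2 ^ (p + 1) := by
      gcongr
      exact_mod_cast hik'
    have c1 := hY.abs_sub_le_of_cell h0 h1 hH hH1 hR hρ hRN hi hi0 hi1 le_rfl
    have c2 := hY.abs_sub_le_of_cell h0 h1 hH hH1 hR hρ hRN hk le_rfl hk0 hk1
    have c3 := abs_gridProd_sub_le hρ hR hN1 hRN hH hH1 hik' (k := k)
      (by exact_mod_cast hk.le)
    have g1 := hY.apply_grid h0 h1 hδ (i + 1) hi
    have g2 := hY.apply_grid h0 h1 hδ k hk.le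
    rw [Nat.cast_succ] at c3 g1
    have m1 : (((i : ℝ) + 1) / 2 ^ (p + 1) - s) ^ H ≤ (t - s) ^ H :=
      Real.rpow_le_rpow (by linarith) (by linarith) hHp.le
    have m2 : (t - (k : ℝ) / 2 ^ (p + 1)) ^ H ≤ (t - s) ^ H :=
      Real.rpow_le_rpow (by linarith) (by linarith) hHp.le
    have m3 : ((k : ℝ) / 2 ^ (p + 1) - ((i : ℝ) + 1) / 2 ^ (p + 1)) ^ H ≤ (t - s) ^ H :=
      Real.rpow_le_rpow (by linarith) (by linarith) hHp.le
    have c4 : |Y ((k : ℝ) / 2 ^ (p + 1)) - Y (((i : ℝ) + 1) / 2 ^ (p + 1))| ≤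
        B * (R + R ^ 2) * (t - s) ^ H := by
      rw [g1, g2, ← mul_sub, abs_mul, hB, mul_assoc, mul_assoc, ← mul_assoc (Real.exp _)]
      refine mul_le_mul_of_nonneg_left (c3.trans ?_) (abs_nonneg _)
      exact mul_le_mul_of_nonneg_left m3 (by positivity)
    have c1' := c1.trans (mul_le_mul_of_nonneg_left m1 (by positivity))
    have c2' := c2.trans (mul_le_mul_of_nonneg_left m2 (by positivity))
    have e : Y t - Y s = (Y t - Y ((k : ℝ) / 2 ^ (p + 1))) +
        (Y ((k : ℝ) / 2 ^ (p + 1)) - Y (((i : ℝ) + 1) / 2 ^ (p + 1))) +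
        (Y (((i : ℝ) + 1) / 2 ^ (p + 1)) - Y s) := by ring
    rw [e]
    refine (abs_add_three _ _ _).trans ((add_le_add (add_le_add c2' c4) c1').trans (le_of_eq ?_))
    ring
  · have hle : (k : ℝ) ≤ i := Nat.cast_le.2 hik
    have c := hY.abs_sub_le_of_cell h0 h1 hH hH1 hR hρ hRN hi hi0 hst
      (hk1.trans (by gcongr))
    refine c.trans ?_
    have : R * B ≤ B * (3 * R + R ^ 2) := by
      nlinarith [mul_nonneg hB0 hR, mul_nonneg hB0 (sq_nonneg R)]
    exact mul_le_mul_of_nonneg_right this hP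

theorem IsTruncatedSolution.abs_sub_exp_le (h0 : 0 < α) (h1 : α < 1) (hH : 1 / 2 < H)
    (hH1 : H < 1) (hR : 0 ≤ R) (hρ : IsHolder R H 1 fun t => β * t + γ * g t) (hg0 : g 0 = 0)
    (hRN : R * ((2 : ℝ) ^ (p + 1)) ^ (-H) ≤ 1) {Y : ℝ → ℝ}
    (hY : IsTruncatedSolution H α β γ x₀ g p Y) {t : ℝ} (ht : t ∈ Icc (0 : ℝ) 1) :
    |Y t - x₀ * Real.exp (β * t + γ * g t)| ≤
      |x₀| * Real.exp (R + R ^ 2) * (2 * R * ((2 : ℝ) ^ (p + 1)) ^ (-H) +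
        R ^ 2 * ((2 : ℝ) ^ (p + 1)) ^ (1 - 2 * H)) := by
  have hN : (0 : ℝ) < 2 ^ (p + 1) := by positivity
  have hN1 : (1 : ℝ) ≤ 2 ^ (p + 1) := one_le_pow₀ (by norm_num)
  have hHp : 0 < H := by linarith
  have hδ : ∀ i : ℕ, i < 2 ^ (p + 1) →
      |gridIncrement (fun t => β * t + γ * g t) (2 ^ (p + 1)) i| ≤ 1 := fun j hj =>
    (abs_gridIncrement_le hρ hN (succ_le_two_pow hj)).trans hRN
  obtain ⟨i, hi, hi0, hi1⟩ := exists_cell (p + 1) ht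
  have hi' := succ_le_two_pow hi
  -- compare at the left end of the cell of `t`; the cell contributes `O(N^(-H))` on both sides
  have c1 := hY.abs_sub_le_of_cell h0 h1 hH hH1 hR hρ hRN hi le_rfl hi0 hi1
  have c2 := abs_gridProd_sub_exp_le hρ hR hN1 hRN hH hH1 (by simp [hg0]) (i := i) (by linarith)
  have hs : (i : ℝ) / 2 ^ (p + 1) ∈ Icc (0 : ℝ) 1 :=
    ⟨by positivity, (div_le_one hN).2 (by linarith)⟩
  have c3 := hρ.exp hR hHp ((i : ℝ) / 2 ^ (p + 1)) hs t ht
  have g1 := hY.apply_grid h0 h1 hδ i hi.le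
  have hd : (t - (i : ℝ) / 2 ^ (p + 1)) ^ H ≤ ((2 : ℝ) ^ (p + 1)) ^ (-H) := by
    rw [Real.rpow_neg hN.le, ← Real.inv_rpow hN.le]
    refine Real.rpow_le_rpow (by linarith) ?_ hHp.le
    rw [add_div] at hi1
    rw [← one_div]
    linarith
  rw [abs_sub_comm ((i : ℝ) / _), abs_of_nonneg (sub_nonneg.2 hi0)] at c3
  simp only [hg0, mul_zero, add_zero, abs_zero, zero_add] at c3
  set B := Real.exp (R + R ^ 2)
  have hexp : Real.exp R ≤ B := Real.exp_le_exp.2 (by nlinarith [sq_nonneg R])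
  have hBpos : 0 < B := Real.exp_pos _
  set s := (i : ℝ) / 2 ^ (p + 1)
  have c1' := c1.trans (mul_le_mul_of_nonneg_left hd (by positivity))
  have c2' : |Y s - x₀ * Real.exp (β * s + γ * g s)| ≤
      |x₀| * (B * (R ^ 2 * ((2 : ℝ) ^ (p + 1)) ^ (1 - 2 * H))) := by
    rw [g1, ← mul_sub, abs_mul]
    exact mul_le_mul_of_nonneg_left c2 (abs_nonneg _)
  have c3' : |x₀ * Real.exp (β * s + γ * g s) - x₀ * Real.exp (β * t + γ * g t)| ≤
      |x₀| * (B * R * ((2 : ℝ) ^ (p + 1)) ^ (-H)) := by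
    rw [← mul_sub, abs_mul]
    refine mul_le_mul_of_nonneg_left (c3.trans ?_) (abs_nonneg _)
    refine mul_le_mul (mul_le_mul_of_nonneg_right hexp hR) hd ?_ (by positivity)
    exact Real.rpow_nonneg (sub_nonneg.2 hi0) _
  have e : Y t - x₀ * Real.exp (β * t + γ * g t) = (Y t - Y s) +
      (Y s - x₀ * Real.exp (β * s + γ * g s)) +
      (x₀ * Real.exp (β * s + γ * g s) - x₀ * Real.exp (β * t + γ * g t)) := by ring
  rw [e]
  refine (abs_add_three _ _ _).trans
    ((add_le_add (add_le_add c1' c2') c3').trans (le_of_eq ?_))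
  ring

end Truncated

/-! ### Convergence -/

/-- Interpolation between the uniform norm and a Hölder seminorm. -/
theorem IsHolder.interpolate {K H η ε : ℝ} {f : ℝ → ℝ} (hf : IsHolder K H 1 f) (hK : 0 ≤ K)
    (hη : 0 < η) (hηH : η < H) (hε : ∀ t ∈ Icc (0 : ℝ) 1, |f t| ≤ ε) :
    IsHolder ((2 * ε) ^ (1 - η / H) * K ^ (η / H)) η 1 f := fun u hu v hv => by
  have hH : 0 < H := hη.trans hηH
  have hθ : η / H < 1 := (div_lt_one hH).2 hηH
  have h1 : |f u - f v| ≤ 2 * ε := (abs_sub _ _).trans (by linarith [hε u hu, hε v hv])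
  have h2 := hf u hu v hv
  have hθ0 : 0 < η / H := div_pos hη hH
  rcases (abs_nonneg (f u - f v)).eq_or_lt with h | h
  · rw [← h]
    have : 0 ≤ ε := (abs_nonneg _).trans (hε u hu)
    positivity
  calc |f u - f v| = |f u - f v| ^ (1 - η / H) * |f u - f v| ^ (η / H) := by
        rw [← Real.rpow_add h, sub_add_cancel, Real.rpow_one]
    _ ≤ (2 * ε) ^ (1 - η / H) * (K * |u - v| ^ H) ^ (η / H) :=
        mul_le_mul (Real.rpow_le_rpow h.le h1 (by linarith))
          (Real.rpow_le_rpow h.le h2 hθ0.le) (by positivity)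
          (Real.rpow_nonneg (h.le.trans h1) _)
    _ = (2 * ε) ^ (1 - η / H) * K ^ (η / H) * |u - v| ^ η := by
        rw [Real.mul_rpow hK (by positivity), ← Real.rpow_mul (abs_nonneg _),
          mul_div_cancel₀ _ hH.ne', mul_assoc]

/-- Uniform convergence together with a common Hölder bound of order greater than `α` implies
convergence in `W_0^{α,∞}`. -/
theorem tendsto_nrNorm_of_isHolder {α H K : ℝ} {F : ℕ → ℝ → ℝ} {ε : ℕ → ℝ} (h0 : 0 < α)
    (hαH : α < H) (hK : 0 ≤ K) (hF : ∀ᶠ p in atTop, IsHolder K H 1 (F p))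
    (hε : ∀ᶠ p in atTop, ∀ t ∈ Icc (0 : ℝ) 1, |F p t| ≤ ε p)
    (hlim : Tendsto ε atTop (𝓝 0)) : Tendsto (fun p => nrNorm α (F p)) atTop (𝓝 0) := by
  set η := (α + H) / 2 with hη
  have hη1 : α < η := by rw [hη]; linarith
  have hη2 : η < H := by rw [hη]; linarith
  have hH : 0 < H := h0.trans hαH
  have hθ : 0 < 1 - η / H := sub_pos.2 ((div_lt_one hH).2 hη2)
  have l1 : Tendsto (fun p => ENNReal.ofReal (ε p + (2 * ε p) ^ (1 - η / H) * K ^ (η / H) /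
      (η - α))) atTop (𝓝 0) := by
    have h2 := (hlim.const_mul 2).rpow_const (p := 1 - η / H) (Or.inr hθ.le)
    rw [mul_zero, Real.zero_rpow hθ.ne'] at h2
    have h3 := hlim.add ((h2.mul_const (K ^ (η / H))).div_const (η - α))
    simp only [zero_mul, zero_div, add_zero] at h3
    simpa using ENNReal.tendsto_ofReal h3
  refine tendsto_of_tendsto_of_tendsto_of_le_of_le' tendsto_const_nhds l1
    (Eventually.of_forall fun _ => bot_le) ?_
  filter_upwards [hF, hε] with p hp1 hp2
  have hεp : 0 ≤ ε p := (abs_nonneg _).trans (hp2 0 ⟨le_rfl, zero_le_one⟩)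
  exact (hp1.interpolate hK (h0.trans hη1) hη2 hp2).nrNorm_le (by positivity) h0 hη1 hp2

theorem tendsto_two_pow_succ_rpow {a : ℝ} (ha : a < 0) :
    Tendsto (fun p : ℕ => ((2 : ℝ) ^ (p + 1)) ^ a) atTop (𝓝 0) := by
  have h1 : Tendsto (fun p : ℕ => (2 : ℝ) ^ (p + 1)) atTop atTop :=
    (tendsto_pow_atTop_atTop_of_one_lt one_lt_two).comp (tendsto_add_atTop_nat 1)
  have h2 := (tendsto_rpow_neg_atTop (neg_pos.2 ha)).comp h1
  simpa [Function.comp_def] using h2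

end
theorem mainTheorem8 (H α β γ x₀ : ℝ) (hH : 1 / 2 < H) (hH1 : H < 1)
    (hα : 1 - H < α) (hαH : α < H) (hβ : β ≠ 0) (hγ : γ ≠ 0)
    (g : ℝ → ℝ) (hg : ∃ C : ℝ≥0, HolderOnWith C H.toNNReal g (Icc (0 : ℝ) 1))
    (hg0 : g 0 = 0) (hg1 : g 1 = 0) :
    ∃ X : ℝ → ℝ,
      IsLinearSolution α β γ x₀ g X ∧
      (∀ Y : ℝ → ℝ, IsLinearSolution α β γ x₀ g Y → EqOn Y X (Icc (0 : ℝ) 1)) ∧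
      (∀ᶠ p : ℕ in atTop, ∃ Z : ℝ → ℝ, IsTruncatedSolution H α β γ x₀ g p Z ∧
        ∀ Y : ℝ → ℝ, IsTruncatedSolution H α β γ x₀ g p Y → EqOn Y Z (Icc (0 : ℝ) 1)) ∧
      (∀ Xp : ℕ → ℝ → ℝ, (∀ᶠ p : ℕ in atTop, IsTruncatedSolution H α β γ x₀ g p (Xp p)) →
        Tendsto (fun p : ℕ => nrNorm α (fun t => Xp p t - X t)) atTop (𝓝 0)) := by
  obtain ⟨C, hC⟩ := hg
  have hHp : 0 < H := by linarith
  have h0 : 0 < α := by linarith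
  have h1 : α < 1 := by linarith
  have hgH : IsHolder C H 1 g := isHolder_of_holderOnWith hHp.le hC
  have hC0 : (0 : ℝ) ≤ C := C.2
  have hρ := hgH.affine (β := β) (γ := γ) hHp hH1.le
  have hR : 0 ≤ |β| + |γ| * C := by positivity
  set R := |β| + |γ| * C
  have hl1 := (tendsto_two_pow_succ_rpow (show -H < 0 by linarith)).const_mul R
  rw [mul_zero] at hl1
  have hRN : ∀ᶠ p : ℕ in atTop, R * ((2 : ℝ) ^ (p + 1)) ^ (-H) ≤ 1 :=
    (hl1.eventually_lt_const one_pos).mono fun _ h => h.le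
  refine ⟨fun t => x₀ * Real.exp (β * t + γ * g t),
    isLinearSolution_exp hH1 hα hαH hC0 hgH hg0,
    fun Y hY t ht => hY.eq_exp hH1 hα hαH hC0 hgH hg0 ht, ?_, fun Xp hXp => ?_⟩
  · filter_upwards [hRN] with p hp
    have hδ : ∀ i : ℕ, i < 2 ^ (p + 1) →
        |gridIncrement (fun t => β * t + γ * g t) (2 ^ (p + 1)) i| ≤ 1 := fun j hj =>
      (abs_gridIncrement_le hρ (by positivity) (succ_le_two_pow hj)).trans hp
    obtain ⟨Z, hZ⟩ := exists_isTruncatedSolution (H := H) (x₀ := x₀) h0 h1 hδ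
    exact ⟨Z, hZ, fun Y hY => hY.eqOn h0 h1 hδ hZ⟩
  · have hl2 := (tendsto_two_pow_succ_rpow (show 1 - 2 * H < 0 by linarith)).const_mul (R ^ 2)
    have hlim : Tendsto (fun p : ℕ => |x₀| * Real.exp (R + R ^ 2) *
        (2 * R * ((2 : ℝ) ^ (p + 1)) ^ (-H) + R ^ 2 * ((2 : ℝ) ^ (p + 1)) ^ (1 - 2 * H)))
        atTop (𝓝 0) := by
      have h2 := ((hl1.const_mul 2).add hl2).const_mul (|x₀| * Real.exp (R + R ^ 2))
      simpa [mul_assoc] using h2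
    refine tendsto_nrNorm_of_isHolder (K := |x₀| * Real.exp (R + R ^ 2) * (3 * R + R ^ 2) +
      |x₀| * (Real.exp R * R)) h0 hαH (by positivity) ?_ ?_ hlim
    · filter_upwards [hRN, hXp] with p hp hY u hu v hv
      have a1 := hY.isHolder h0 h1 hH hH1 hR hρ hp u hu v hv
      have a2 := hρ.exp hR hHp u hu v hv
      simp only [hg0, mul_zero, add_zero, abs_zero, zero_add] at a2
      have e : Xp p u - x₀ * Real.exp (β * u + γ * g u) -
          (Xp p v - x₀ * Real.exp (β * v + γ * g v)) = (Xp p u - Xp p v) -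
          x₀ * (Real.exp (β * u + γ * g u) - Real.exp (β * v + γ * g v)) := by ring
      rw [e]
      refine (abs_sub _ _).trans ?_
      rw [abs_mul, add_mul, mul_assoc |x₀| (Real.exp R * R)]
      exact add_le_add a1 (mul_le_mul_of_nonneg_left a2 (abs_nonneg _))
    · filter_upwards [hRN, hXp] with p hp hY t ht
      exact hY.abs_sub_exp_le h0 h1 hH hH1 hR hρ hg0 hp ht
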